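/- Let $b>0$ and let $\mu\in C^3[0,b]$ with $\mu(0)\neq 0$. Put $m(r)=\int_0^r x^2\mu(x)\,dx$ and assume that $m$ is strictly increasing on $[0,b]$, that $m(r)<r$ for $0<r\le b$ (no trapped surfaces initially) and that $m'(r)<3m(r)/r$ for $0<r\le b$ (no shell crossing). Let $t_c(r)=\frac23\sqrt{r^3/m(r)}$ for $0<r\le b$, let $t_0=\lim_{r\to0^+}t_c(r)=\frac23(\mu(0)/3)^{-1/2}$, and consider the marginally bound dust space-time with metric $$ds^2=-dt^2+(R_{,r}\,dr)^2+R^2\,d\Omega^2,\qquad R(r,t)^3=\tfrac94\,m(r)\,(t_c(r)-t)^2,\qquad 0\le t<t_c(r),$$ where $0<r<b$. An affinely parametrized future-directed null geodesic with conserved angular momentum $L$ is said to emanate from the central shell-focussing singularity if, for some $\epsilon>0$, it is defined for $s\in(0,\epsilon)$, $\dot t\ge 0$ and $\dot r$ are integrable on $(0,\epsilon)$, and $r(s)\to0$, $t(s)\to t_0$ as $s\to0^+$; that is, $(t(s),r(s))$ runs in the space-time and satisfies $$\ddot t+\frac{R_{,rt}}{R_{,r}}\dot t^2+\frac{L^2}{R^2}\Big(\frac{R_{,t}}{R}-\frac{R_{,rt}}{R_{,r}}\Big)=0,\qquad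 R_{,r}\ddot r+R_{,rr}\dot r^2+2R_{,rt}\dot r\dot t-\frac{L^2}{R^3}=0,\qquad -\dot t^2+(R_{,r}\dot r)^2+\frac{L^2}{R^2}=0,$$ with the azimuth along the geodesic, in its equatorial plane, given by $R^2\dot\varphi=L$. It is radial if $L=0$ and non-radial if $L\ne0$. Then there exist non-radial null geodesics which emanate from the central shell-focussing singularity if and only if there exist radial null geodesics which emanate from it. -/

import Mathlib

open Set Filter Topology MeasureTheory

noncomputable section

namespace DustCollapse

/-- The mass function `m(r) = ∫₀ʳ x² μ(x) dx` of an initial density profile `μ`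
(twice the Misner-Sharp mass, in units `8πG = c = 1`). In particular `m' = r² μ`. -/
def mass (μ : ℝ → ℝ) (r : ℝ) : ℝ := ∫ x in (0 : ℝ)..r, x ^ 2 * μ x

/-- Regular initial data, without shell crossing, for the marginally bound collapse of a dust
sphere of initial radius `b`: the initial density profile is `μ`, the radial coordinate is the
initial area radius, `R(r,0) = r`. -/
structure RegularData (b : ℝ) (μ : ℝ → ℝ) : Prop where
  radius_pos : 0 < b
  /-- The density is of class `C³` up to the end points. -/
  density_smooth : ContDiffOn ℝ 3 μ (Icc 0 b)
  density_center : μ 0 ≠ 0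
  mass_strictMono : StrictMonoOn (mass μ) (Icc 0 b)
  /-- There are no trapped surfaces initially: `m(r) < R(r,0) = r`. -/
  untrapped : ∀ r ∈ Ioc 0 b, mass μ r < r
  /-- No shell crossing: `m'(r) < 3 m(r) / r`. -/
  no_shell_crossing : ∀ r ∈ Ioc 0 b, r ^ 2 * μ r < 3 * mass μ r / r

/-- The time `t_c(r)` at which the shell `r > 0` reaches the shell-focussing singularity. -/
def collapseTime (μ : ℝ → ℝ) (r : ℝ) : ℝ := 2 / 3 * √(r ^ 3 / mass μ r)

/-- The time `t₀ = t_c(0) = lim_{r → 0} t_c(r)` of the central shell-focussing singularity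
`(r, t) = (0, t₀)`. -/
def singularTime (μ : ℝ → ℝ) : ℝ := 2 / 3 * (√(μ 0 / 3))⁻¹

/-- The area radius, `R³ = (9/4) m (t_c - t)²`. The space-time metric is
`ds² = -dt² + (∂R/∂r)² dr² + R² dΩ²`. -/
def R (μ : ℝ → ℝ) (r t : ℝ) : ℝ :=
  (9 / 4 * mass μ r * (collapseTime μ r - t) ^ 2) ^ (1 / 3 : ℝ)

/-- `∂R/∂r`. -/
def Rr (μ : ℝ → ℝ) (r t : ℝ) : ℝ := deriv (fun x => R μ x t) r

/-- `∂R/∂t`. -/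
def Rt (μ : ℝ → ℝ) (r t : ℝ) : ℝ := deriv (fun τ => R μ r τ) t

/-- `∂²R/∂r²`. -/
def Rrr (μ : ℝ → ℝ) (r t : ℝ) : ℝ := deriv (fun x => Rr μ x t) r

/-- `∂²R/∂r∂t`. -/
def Rrt (μ : ℝ → ℝ) (r t : ℝ) : ℝ := deriv (fun τ => Rr μ r τ) t

/-- `s ↦ (t(s), r(s), φ(s))`, `0 < s < ε`, is an affinely parametrized, future-directed null
geodesic with conserved angular momentum `L = R² dφ/ds` in the interior of the dust sphere of
initial radius `b` (in the equatorial plane, which by spherical symmetry is no restriction), and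
it emanates from the central shell-focussing singularity `(r, t) = (0, t₀)` at `s = 0`.

The centre `r = 0` need not be admitted in `inside`: it is part of the space-time only for
`t < t₀`, whereas `t ≥ t₀` along such a curve. -/
structure IsEmanatingNullGeodesic (b : ℝ) (μ : ℝ → ℝ) (L ε : ℝ) (t r φ : ℝ → ℝ) : Prop where
  eps_pos : 0 < ε
  smooth_t : ContDiffOn ℝ 2 t (Ioo 0 ε)
  smooth_r : ContDiffOn ℝ 2 r (Ioo 0 ε)
  smooth_φ : ContDiffOn ℝ 2 φ (Ioo 0 ε)
  /-- The curve runs in the space-time, i.e. before the shell-focussing singularity. -/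
  inside : ∀ s ∈ Ioo 0 ε, 0 < r s ∧ r s < b ∧ 0 ≤ t s ∧ t s < collapseTime μ (r s)
  angular_momentum : ∀ s ∈ Ioo 0 ε, R μ (r s) (t s) ^ 2 * deriv φ s = L
  geodesic_t : ∀ s ∈ Ioo 0 ε,
    deriv (deriv t) s + Rrt μ (r s) (t s) / Rr μ (r s) (t s) * deriv t s ^ 2
      + L ^ 2 / R μ (r s) (t s) ^ 2 *
        (Rt μ (r s) (t s) / R μ (r s) (t s) - Rrt μ (r s) (t s) / Rr μ (r s) (t s)) = 0
  geodesic_r : ∀ s ∈ Ioo 0 ε,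
    Rr μ (r s) (t s) * deriv (deriv r) s + Rrr μ (r s) (t s) * deriv r s ^ 2
      + 2 * Rrt μ (r s) (t s) * deriv r s * deriv t s - L ^ 2 / R μ (r s) (t s) ^ 3 = 0
  null : ∀ s ∈ Ioo 0 ε,
    -deriv t s ^ 2 + (Rr μ (r s) (t s) * deriv r s) ^ 2 + L ^ 2 / R μ (r s) (t s) ^ 2 = 0
  future : ∀ s ∈ Ioo 0 ε, 0 ≤ deriv t s
  integrable_t : IntegrableOn (deriv t) (Ioo 0 ε)
  integrable_r : IntegrableOn (deriv r) (Ioo 0 ε)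
  tendsto_r : Tendsto r (𝓝[>] 0) (𝓝 0)
  tendsto_t : Tendsto t (𝓝[>] 0) (𝓝 (singularTime μ))

/-- Some null geodesic with angular momentum `L` emanates from the central singularity. -/
def ExistsEmanating (b : ℝ) (μ : ℝ → ℝ) (L : ℝ) : Prop :=
  ∃ (ε : ℝ) (t r φ : ℝ → ℝ), IsEmanatingNullGeodesic b μ L ε t r φ

end DustCollapse

end

/-!
# Radial and non-radial null geodesics from the central singularity of a dust cloud

Any emanating null geodesic, radial or not, produces emanating null geodesics with every
sufficiently small angular momentum `L`, including `L = 0`; the equivalence follows at once.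

With `k = √(m / r³) = 2 / (3 t_c)` and `K = -k' > 0`, the area radius is `R = r w²`, where
`w³ = 1 - t / t_c`, and all its derivatives are rational in `w`, `r`, `t`, `k`, `K`. The radial null
rays are the solutions of `dt/dr = R_r`.

* A geodesic with `L ≠ 0` satisfies `dt ≥ R_r |dr|`. So in the past of one of its points it is not
  later than the radial ray through that point, and this ray cannot reach the centre before the
  time `t₀` of the singularity (`RegularData.exists_ray_of_existsEmanating`).
* The expansion of the density up to the third order leaves three possibilities
  (`RegularData.near_centre`). If `K / r² → ∞`, there is a ray along which `R ≤ const r³`. If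
  `K = O(r²)` and `k₀ - k = O(r K)`, this holds along every ray, because `t ≥ t₀`. If
  `k₀ - k = o(r³)`, no ray exists. On the other hand `R ≥ η² r³` along any ray, for some
  `η > 0`, as the rays are steeper than the curves `w = η r` where they meet. Thus `R` is
  comparable to `r³` (`RegularData.exists_controlled_ray`).
* In the region where `R` is comparable to `r³` and `t ≥ t₀`, the function `R_r` is convex in `t`,
  with `R_rtt ≥ const K / r⁶` (`NearCentre.le_areaRTT`). For three emanating rays `T < T₀ < T₁` the
  ratio `(T₁ - T) / (T₀ - T)` is therefore increasing, and as it is at least `1`, the quantity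
  `K (T₁ - T₀) / r⁶` is integrable at the centre (`IsRay.exists_potential`).
* With `r` as parameter and `exp Q = R_r dr/ds`, the geodesic equations become a system for
  `(t, Q)` in which `L` enters through `E = L² exp (-2 Q) / R²`. For `L = 0` one has
  `Q' = -R_rt`, and by convexity `R_rt ≥ (log (T₁ - T₀))'` for times after `T₁`. So
  `exp (-Q) ≤ T₁ - T₀` persists towards the centre, and the terms with `E` are then bounded by the
  integrable quantity above, times `L²`. For small `L` the solution therefore stays between `T₁` and
  `w = η r` up to the centre (`IsRay.exists_solution`), where it converges to the singularity. As
  `ds/dr = R_r exp (-Q)` is bounded, it takes a finite affine time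
  (`RegularData.existsEmanating_of_solution`).
-/

namespace DustCollapse

/-! ### Ordinary differential equations on an open interval -/

/-- A family of maps `f r : E → F`, `0 < r < b`, continuous in `r`, and bounded and Lipschitz
uniformly for `r` in compact subintervals of `(0, b)`. -/
structure IsTame {E F : Type*} [NormedAddCommGroup E] [NormedAddCommGroup F] (b : ℝ)
    (f : ℝ → E → F) : Prop where
  continuousOn : ∀ x, ContinuousOn (fun r => f r x) (Ioo 0 b)
  bound : ∀ p q, 0 < p → q < b → ∃ C, 0 ≤ C ∧ ∀ r ∈ Icc p q,
    (∀ x, ‖f r x‖ ≤ C) ∧ ∀ x y, ‖f r x - f r y‖ ≤ C * ‖x - y‖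

namespace IsTame

variable {E F G : Type*} [NormedAddCommGroup E] [NormedAddCommGroup F] [NormedAddCommGroup G]
  {b : ℝ}

lemma exists_bound {c : ℝ → ℝ} (hc : ContinuousOn c (Ioo 0 b)) {p q : ℝ} (hp : 0 < p)
    (hq : q < b) : ∃ C, 0 ≤ C ∧ ∀ r ∈ Icc p q, |c r| ≤ C := by
  obtain ⟨C, hC⟩ := isCompact_Icc.exists_bound_of_continuousOn (s := Icc p q)
    (hc.mono fun x hx => ⟨hp.trans_le hx.1, hx.2.trans_lt hq⟩)
  exact ⟨max C 0, le_max_right _ _, fun r hr => (hC r hr).trans (le_max_left _ _)⟩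

lemma exists_lower_bound {c : ℝ → ℝ} (hc : ContinuousOn c (Ioo 0 b))
    (hpos : ∀ r ∈ Ioo 0 b, 0 < c r) {p q : ℝ} (hp : 0 < p)
    (hq : q < b) : ∃ δ, 0 < δ ∧ ∀ r ∈ Icc p q, δ ≤ c r := by
  have hsub : Icc p q ⊆ Ioo 0 b := fun x hx => ⟨hp.trans_le hx.1, hx.2.trans_lt hq⟩
  rcases (Icc p q).eq_empty_or_nonempty with h | h
  · exact ⟨1, one_pos, by simp [h]⟩
  · obtain ⟨z, hz, hm⟩ := isCompact_Icc.exists_isMinOn h (hc.mono hsub)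
    exact ⟨c z, hpos z (hsub hz), fun r hr => hm hr⟩

lemma of_continuousOn {c : ℝ → ℝ} (hc : ContinuousOn c (Ioo 0 b)) :
    IsTame b (fun r (_ : E) => c r) where
  continuousOn _ := hc
  bound p q hp hq := by
    obtain ⟨C, hC0, hC⟩ := exists_bound hc hp hq
    refine ⟨C, hC0, fun r hr => ⟨fun _ => hC r hr, fun x y => ?_⟩⟩
    simp only [sub_self, norm_zero]; positivity

lemma add {f g : ℝ → E → F} (hf : IsTame b f) (hg : IsTame b g) :
    IsTame b (fun r x => f r x + g r x) where
  continuousOn x := (hf.continuousOn x).add (hg.continuousOn x)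
  bound p q hp hq := by
    obtain ⟨C, hC0, hC⟩ := hf.bound p q hp hq
    obtain ⟨D, hD0, hD⟩ := hg.bound p q hp hq
    refine ⟨C + D, by positivity, fun r hr => ⟨fun x => ?_, fun x y => ?_⟩⟩
    · exact (norm_add_le _ _).trans (add_le_add ((hC r hr).1 x) ((hD r hr).1 x))
    · rw [add_sub_add_comm, add_mul]
      exact (norm_add_le _ _).trans (add_le_add ((hC r hr).2 x y) ((hD r hr).2 x y))

lemma mul {f g : ℝ → E → ℝ} (hf : IsTame b f) (hg : IsTame b g) :
    IsTame b (fun r x => f r x * g r x) where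
  continuousOn x := (hf.continuousOn x).mul (hg.continuousOn x)
  bound p q hp hq := by
    obtain ⟨C, hC0, hC⟩ := hf.bound p q hp hq
    obtain ⟨D, hD0, hD⟩ := hg.bound p q hp hq
    refine ⟨C * D + (C * D + C * D), by positivity, fun r hr => ⟨fun x => ?_, fun x y => ?_⟩⟩
    · rw [norm_mul]
      have := mul_le_mul ((hC r hr).1 x) ((hD r hr).1 x) (norm_nonneg _) hC0
      have : 0 ≤ C * D := by positivity
      linarith
    · have h1 : f r x * g r x - f r y * g r y
          = (f r x - f r y) * g r x + f r y * (g r x - g r y) := by ring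
      rw [h1]
      refine (norm_add_le _ _).trans ?_
      rw [norm_mul, norm_mul]
      have h2 := mul_le_mul ((hC r hr).2 x y) ((hD r hr).1 x) (norm_nonneg _)
        (mul_nonneg hC0 (norm_nonneg _))
      have h3 := mul_le_mul ((hC r hr).1 y) ((hD r hr).2 x y) (norm_nonneg _) hC0
      have : 0 ≤ C * D * ‖x - y‖ := by positivity
      nlinarith

lemma const_mul {c : ℝ → ℝ} {g : ℝ → E → ℝ} (hc : ContinuousOn c (Ioo 0 b)) (hg : IsTame b g) :
    IsTame b (fun r x => c r * g r x) := (of_continuousOn hc).mul hg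

lemma sub {f g : ℝ → E → ℝ} (hf : IsTame b f) (hg : IsTame b g) :
    IsTame b (fun r x => f r x - g r x) := by
  have := hf.add (const_mul (c := fun _ => (-1 : ℝ)) continuousOn_const hg)
  convert this using 3
  ring

lemma prodMk {f : ℝ → E → F} {g : ℝ → E → G} (hf : IsTame b f) (hg : IsTame b g) :
    IsTame b (fun r x => (f r x, g r x)) where
  continuousOn x := (hf.continuousOn x).prodMk (hg.continuousOn x)
  bound p q hp hq := by
    obtain ⟨C, hC0, hC⟩ := hf.bound p q hp hq
    obtain ⟨D, hD0, hD⟩ := hg.bound p q hp hq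
    refine ⟨C + D, by positivity, fun r hr => ⟨fun x => ?_, fun x y => ?_⟩⟩
    · refine max_le (((hC r hr).1 x).trans ?_) (((hD r hr).1 x).trans ?_) <;> linarith
    · refine max_le (((hC r hr).2 x y).trans ?_) (((hD r hr).2 x y).trans ?_) <;>
        · have := norm_nonneg (x - y)
          gcongr
          linarith

lemma comp_right {f : ℝ → F → G} (hf : IsTame b f) {π : E → F}
    (hπ : ∀ x y, ‖π x - π y‖ ≤ ‖x - y‖) : IsTame b (fun r x => f r (π x)) where
  continuousOn x := hf.continuousOn (π x)
  bound p q hp hq := by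
    obtain ⟨C, hC0, hC⟩ := hf.bound p q hp hq
    refine ⟨C, hC0, fun r hr => ⟨fun x => (hC r hr).1 _, fun x y => ?_⟩⟩
    exact ((hC r hr).2 _ _).trans (by gcongr; exact hπ x y)

/-- The retraction of `ℝ` to the interval between `lo r` and `hi r`. -/
lemma clamp {lo hi : ℝ → ℝ} (hlo : ContinuousOn lo (Ioo 0 b)) (hhi : ContinuousOn hi (Ioo 0 b)) :
    IsTame b (fun r (x : ℝ) => min (hi r) (max (lo r) x)) where
  continuousOn x := hhi.inf (hlo.sup continuousOn_const)
  bound p q hp hq := by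
    obtain ⟨C, hC0, hC⟩ := exists_bound hlo hp hq
    obtain ⟨D, hD0, hD⟩ := exists_bound hhi hp hq
    refine ⟨C + D + 1, by positivity, fun r hr => ⟨fun x => ?_, fun x y => ?_⟩⟩
    · have h1 := abs_le.1 (hC r hr)
      have h2 := abs_le.1 (hD r hr)
      rw [Real.norm_eq_abs, abs_le]
      constructor
      · refine le_min (by linarith) (le_max_of_le_left (by linarith))
      · exact (min_le_left _ _).trans (by linarith)
    · have h : |min (hi r) (max (lo r) x) - min (hi r) (max (lo r) y)| ≤ |x - y| := by
        have h1 := abs_min_sub_min_le_max (hi r) (max (lo r) x) (hi r) (max (lo r) y)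
        have h2 := abs_max_sub_max_le_max (lo r) x (lo r) y
        simp only [sub_self, abs_zero] at h1 h2
        refine h1.trans (max_le (abs_nonneg _) (h2.trans (max_le (abs_nonneg _) le_rfl)))
      simp only [Real.norm_eq_abs]
      have := abs_nonneg (x - y)
      nlinarith

/-- Composition with a `C¹` function on `(0, ∞)`, for families with a positive lower bound. -/
lemma comp {f : ℝ → E → ℝ} (hf : IsTame b f) {δ : ℝ → ℝ} (hδ : ContinuousOn δ (Ioo 0 b))
    (hδ0 : ∀ r ∈ Ioo 0 b, 0 < δ r) (hfδ : ∀ r ∈ Ioo 0 b, ∀ x, δ r ≤ f r x) {φ : ℝ → ℝ}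
    (hφ : ContDiffOn ℝ 1 φ (Ioi 0)) : IsTame b (fun r x => φ (f r x)) where
  continuousOn x := hφ.continuousOn.comp (hf.continuousOn x)
    fun r hr => (hδ0 r hr).trans_le (hfδ r hr x)
  bound p q hp hq := by
    obtain ⟨C, hC0, hC⟩ := hf.bound p q hp hq
    obtain ⟨d, hd0, hd⟩ := exists_lower_bound hδ hδ0 hp hq
    have hsub : Icc p q ⊆ Ioo 0 b := fun x hx => ⟨hp.trans_le hx.1, hx.2.trans_lt hq⟩
    have hsub' : Icc d C ⊆ Ioi 0 := fun x hx => hd0.trans_le hx.1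
    obtain ⟨A, hA⟩ := isCompact_Icc.exists_bound_of_continuousOn (hφ.continuousOn.mono hsub')
    have hderiv : ContinuousOn (deriv φ) (Ioi 0) :=
      hφ.continuousOn_deriv_of_isOpen isOpen_Ioi le_rfl
    obtain ⟨B, hB⟩ := isCompact_Icc.exists_bound_of_continuousOn (hderiv.mono hsub')
    have hmem : ∀ r ∈ Icc p q, ∀ x, f r x ∈ Icc d C := fun r hr x =>
      ⟨(hd r hr).trans (hfδ r (hsub hr) x), (le_abs_self _).trans ((hC r hr).1 x)⟩
    refine ⟨max A (max B 0 * C), (by positivity : (0 : ℝ) ≤ max B 0 * C).trans (le_max_right _ _),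
      fun r hr => ⟨fun x => (hA _ (hmem r hr x)).trans (le_max_left _ _), fun x y => ?_⟩⟩
    have h1 := (convex_Icc d C).norm_image_sub_le_of_norm_deriv_le (f := φ) (C := max B 0)
      (fun z hz => (hφ.differentiableOn one_ne_zero).differentiableAt
        (Ioi_mem_nhds (hsub' hz))) (fun z hz => (hB z hz).trans (le_max_left _ _))
      (hmem r hr y) (hmem r hr x)
    refine h1.trans ?_
    have h2 := (hC r hr).2 x y
    have h3 : max B 0 * ‖f r x - f r y‖ ≤ max B 0 * (C * ‖x - y‖) := by gcongr
    refine h3.trans ?_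
    rw [← mul_assoc]
    gcongr
    exact le_max_right _ _

/-- `exp (-2 x)`, cut off where `x < l r`. -/
lemma exp_neg_max {l : ℝ → ℝ} (hl : ContinuousOn l (Ioo 0 b)) :
    IsTame b (fun r (x : ℝ) => Real.exp (-2 * max (l r) x)) where
  continuousOn x := by
    have := (hl.sup (continuousOn_const (c := x)))
    exact Real.continuous_exp.comp_continuousOn (continuousOn_const.mul this)
  bound p q hp hq := by
    obtain ⟨C, hC0, hC⟩ := exists_bound hl hp hq
    refine ⟨2 * Real.exp (2 * C), by positivity, fun r hr => ?_⟩
    have hle : ∀ x, Real.exp (-2 * max (l r) x) ≤ Real.exp (2 * C) := fun x => by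
      have h1 := (abs_le.1 (hC r hr)).1
      have h2 := le_max_left (l r) x
      exact Real.exp_le_exp.2 (by linarith)
    refine ⟨fun x => ?_, fun x y => ?_⟩
    · rw [Real.norm_eq_abs, abs_of_pos (Real.exp_pos _)]
      have := hle x
      have := Real.exp_pos (2 * C)
      linarith
    · have h1 := (convex_Ici (l r)).norm_image_sub_le_of_norm_hasDerivWithin_le
        (f := fun z : ℝ => Real.exp (-2 * z)) (f' := fun z => Real.exp (-2 * z) * (-2))
        (C := 2 * Real.exp (2 * C))
        (fun z _ => by
          have := ((hasDerivAt_id z).const_mul (-2 : ℝ)).exp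
          simpa using this.hasDerivWithinAt)
        (fun z hz => by
          have h := hle z
          rw [max_eq_right hz] at h
          rw [norm_mul, Real.norm_eq_abs, abs_of_pos (Real.exp_pos _), norm_neg,
            Real.norm_ofNat]
          linarith)
        (le_max_left (l r) y) (le_max_left (l r) x)
      refine h1.trans ?_
      gcongr
      have h2 := abs_max_sub_max_le_max (l r) x (l r) y
      simp only [sub_self, abs_zero] at h2
      exact h2.trans (max_le (abs_nonneg _) le_rfl)

variable [NormedSpace ℝ E]

lemma eqOn_Icc {f : ℝ → E → E} (hf : IsTame b f) {u v : ℝ → E} {p q r₁ : ℝ} (hp : 0 < p)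
    (hq : q < b) (hr₁ : r₁ ∈ Icc p q)
    (hu : ∀ r ∈ Icc p q, HasDerivWithinAt u (f r (u r)) (Icc p q) r)
    (hv : ∀ r ∈ Icc p q, HasDerivWithinAt v (f r (v r)) (Icc p q) r) (h : u r₁ = v r₁) :
    EqOn u v (Icc p q) := by
  obtain ⟨C, hC0, hC⟩ := hf.bound p q hp hq
  have hlip : ∀ t ∈ Icc p q, LipschitzOnWith ⟨C, hC0⟩ (f t) univ := fun t ht => by
    refine LipschitzOnWith.of_dist_le_mul fun x _ y _ => ?_
    rw [dist_eq_norm, dist_eq_norm]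
    exact (hC t ht).2 x y
  have hcu : ContinuousOn u (Icc p q) := fun r hr => (hu r hr).continuousWithinAt
  have hcv : ContinuousOn v (Icc p q) := fun r hr => (hv r hr).continuousWithinAt
  have hsubl : Icc p r₁ ⊆ Icc p q := Icc_subset_Icc_right hr₁.2
  have hsubr : Icc r₁ q ⊆ Icc p q := Icc_subset_Icc_left hr₁.1
  have key : ∀ {w : ℝ → E} {w' : E} {t : ℝ}, t ∈ Icc p q → HasDerivWithinAt w w' (Icc p q) t →
      (t ≠ p → HasDerivWithinAt w w' (Iic t) t) ∧ (t ≠ q → HasDerivWithinAt w w' (Ici t) t) := by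
    intro w w' t ht hw
    constructor
    · intro hne
      exact hw.mono_of_mem_nhdsWithin
        (mem_of_superset (Icc_mem_nhdsLE (lt_of_le_of_ne ht.1 hne.symm))
        (Icc_subset_Icc_right ht.2))
    · intro hne
      exact hw.mono_of_mem_nhdsWithin (mem_of_superset (Icc_mem_nhdsGE (lt_of_le_of_ne ht.2 hne))
        (Icc_subset_Icc_left ht.1))
  have hl : EqOn u v (Icc p r₁) := by
    refine ODE_solution_unique_of_mem_Icc_left (v := f) (s := fun _ => univ) (K := ⟨C, hC0⟩)
      (fun t ht => hlip t ⟨ht.1.le, ht.2.trans hr₁.2⟩) (hcu.mono hsubl) (fun t ht => ?_)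
      (fun _ _ => mem_univ _) (hcv.mono hsubl) (fun t ht => ?_) (fun _ _ => mem_univ _) h
    · have hm : t ∈ Icc p q := ⟨ht.1.le, ht.2.trans hr₁.2⟩
      exact (key hm (hu t hm)).1 ht.1.ne'
    · have hm : t ∈ Icc p q := ⟨ht.1.le, ht.2.trans hr₁.2⟩
      exact (key hm (hv t hm)).1 ht.1.ne'
  have hr : EqOn u v (Icc r₁ q) := by
    refine ODE_solution_unique_of_mem_Icc_right (v := f) (s := fun _ => univ) (K := ⟨C, hC0⟩)
      (fun t ht => hlip t ⟨hr₁.1.trans ht.1, ht.2.le⟩) (hcu.mono hsubr) (fun t ht => ?_)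
      (fun _ _ => mem_univ _) (hcv.mono hsubr) (fun t ht => ?_) (fun _ _ => mem_univ _) h
    · have hm : t ∈ Icc p q := ⟨hr₁.1.trans ht.1, ht.2.le⟩
      exact (key hm (hu t hm)).2 ht.2.ne
    · have hm : t ∈ Icc p q := ⟨hr₁.1.trans ht.1, ht.2.le⟩
      exact (key hm (hv t hm)).2 ht.2.ne
  intro t ht
  rcases le_total t r₁ with h1 | h1
  · exact hl ⟨ht.1, h1⟩
  · exact hr ⟨h1, ht.2⟩

lemma exists_solution_Icc [CompleteSpace E] {f : ℝ → E → E} (hf : IsTame b f) {p q r₁ : ℝ}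
    (hp : 0 < p) (hq : q < b) (hr₁ : r₁ ∈ Icc p q) (x₁ : E) :
    ∃ u : ℝ → E, u r₁ = x₁ ∧ ∀ r ∈ Icc p q, HasDerivWithinAt u (f r (u r)) (Icc p q) r := by
  obtain ⟨C, hC0, hC⟩ := hf.bound p q hp hq
  have hM : 0 ≤ C * max (q - r₁) (r₁ - p) :=
    mul_nonneg hC0 (le_max_of_le_left (by linarith [hr₁.2]))
  have hPL : IsPicardLindelof f (⟨r₁, hr₁⟩ : Icc p q) x₁ ⟨_, hM⟩ 0 ⟨C, hC0⟩ ⟨C, hC0⟩ :=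
    { lipschitzOnWith := fun t ht => by
        refine LipschitzOnWith.of_dist_le_mul fun x _ y _ => ?_
        rw [dist_eq_norm, dist_eq_norm]
        exact (hC t ht).2 x y
      continuousOn := fun x _ => (hf.continuousOn x).mono
        fun z hz => ⟨hp.trans_le hz.1, hz.2.trans_lt hq⟩
      norm_le := fun t ht x _ => (hC t ht).1 x
      mul_max_le := by simp only [NNReal.coe_zero, sub_zero]; exact le_rfl }
  exact hPL.exists_eq_forall_mem_Icc_hasDerivWithinAt₀

/-- A tame vector field has a solution on all of `(0, b)` through every point. -/
theorem exists_solution [CompleteSpace E] {f : ℝ → E → E} (hf : IsTame b f) {r₁ : ℝ}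
    (hr₁ : r₁ ∈ Ioo 0 b) (x₁ : E) :
    ∃ u : ℝ → E, u r₁ = x₁ ∧ ∀ r ∈ Ioo 0 b, HasDerivAt u (f r (u r)) r := by
  -- Solutions on compact intervals around `r₁` agree where both are defined.
  let lo : ℝ → ℝ := fun r => min r r₁ / 2
  let hi : ℝ → ℝ := fun r => (max r r₁ + b) / 2
  have hlo : ∀ r ∈ Ioo 0 b, 0 < lo r ∧ lo r < r ∧ lo r < r₁ := fun r hr => by
    have h1 : 0 < min r r₁ := lt_min hr.1 hr₁.1
    have h2 := min_le_left r r₁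
    have h3 := min_le_right r r₁
    refine ⟨?_, ?_, ?_⟩ <;> simp only [lo] <;> linarith
  have hhi : ∀ r ∈ Ioo 0 b, hi r < b ∧ r < hi r ∧ r₁ < hi r := fun r hr => by
    have h1 : max r r₁ < b := max_lt hr.2 hr₁.2
    have h2 := le_max_left r r₁
    have h3 := le_max_right r r₁
    refine ⟨?_, ?_, ?_⟩ <;> simp only [hi] <;> linarith
  have hex : ∀ r, ∃ u : ℝ → E, r ∈ Ioo 0 b → u r₁ = x₁ ∧
      ∀ z ∈ Icc (lo r) (hi r), HasDerivWithinAt u (f z (u z)) (Icc (lo r) (hi r)) z := by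
    intro r
    by_cases hr : r ∈ Ioo 0 b
    · obtain ⟨u, hu⟩ := hf.exists_solution_Icc (hlo r hr).1 (hhi r hr).1
        ⟨(hlo r hr).2.2.le, (hhi r hr).2.2.le⟩ x₁
      exact ⟨u, fun _ => hu⟩
    · exact ⟨fun _ => x₁, fun h => absurd h hr⟩
  choose u hu using hex
  have hagree : ∀ r ∈ Ioo 0 b, ∀ z ∈ Ioo 0 b, z ∈ Icc (lo r) (hi r) → u z z = u r z := by
    intro r hr z hz hzr
    have hsub1 : Icc (max (lo r) (lo z)) (min (hi r) (hi z)) ⊆ Icc (lo r) (hi r) :=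
      Icc_subset_Icc (le_max_left _ _) (min_le_left _ _)
    have hsub2 : Icc (max (lo r) (lo z)) (min (hi r) (hi z)) ⊆ Icc (lo z) (hi z) :=
      Icc_subset_Icc (le_max_right _ _) (min_le_right _ _)
    refine hf.eqOn_Icc (lt_max_of_lt_left (hlo r hr).1) (min_lt_of_left_lt (hhi r hr).1)
      (r₁ := r₁) ⟨max_le (hlo r hr).2.2.le (hlo z hz).2.2.le,
        le_min (hhi r hr).2.2.le (hhi z hz).2.2.le⟩
      (fun t ht => ((hu z hz).2 t (hsub2 ht)).mono hsub2)
      (fun t ht => ((hu r hr).2 t (hsub1 ht)).mono hsub1) ((hu z hz).1.trans (hu r hr).1.symm)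
      ⟨max_le hzr.1 (hlo z hz).2.1.le, le_min hzr.2 (hhi z hz).2.1.le⟩
  refine ⟨fun r => u r r, (hu r₁ hr₁).1, fun r hr => ?_⟩
  have hmem : Icc (lo r) (hi r) ∈ 𝓝 r := Icc_mem_nhds (hlo r hr).2.1 (hhi r hr).2.1
  have h1 := ((hu r hr).2 r (mem_of_mem_nhds hmem)).hasDerivAt hmem
  refine h1.congr_of_eventuallyEq ?_
  filter_upwards [hmem, Ioo_mem_nhds hr.1 hr.2] with z hz hz'
  exact hagree r hr z hz' hz

/-- Solutions of a scalar equation keep their order towards smaller `r`. -/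
theorem lt_of_lt {f : ℝ → ℝ → ℝ} (hf : IsTame b f) {u v : ℝ → ℝ} {r₁ : ℝ} (hr₁ : r₁ < b)
    (hu : ∀ r ∈ Ioc 0 r₁, HasDerivAt u (f r (u r)) r)
    (hv : ∀ r ∈ Ioc 0 r₁, HasDerivAt v (f r (v r)) r) (h : u r₁ < v r₁) :
    ∀ r ∈ Ioc 0 r₁, u r < v r := by
  intro r hr
  by_contra! hle
  have hsub : Icc r r₁ ⊆ Ioc 0 r₁ := fun z hz => ⟨hr.1.trans_le hz.1, hz.2⟩
  have hcont : ContinuousOn (fun z => u z - v z) (Icc r r₁) := fun z hz =>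
    ((hu z (hsub hz)).continuousAt.sub (hv z (hsub hz)).continuousAt).continuousWithinAt
  obtain ⟨z, hz, hz0⟩ := intermediate_value_Icc' hr.2 hcont
    (show (0 : ℝ) ∈ Icc (u r₁ - v r₁) (u r - v r) from ⟨by linarith, by linarith⟩)
  have := hf.eqOn_Icc hr.1 hr₁ hz (fun t ht => (hu t (hsub ht)).hasDerivWithinAt)
    (fun t ht => (hv t (hsub ht)).hasDerivWithinAt) (by simpa [sub_eq_zero] using hz0)
    (right_mem_Icc.2 hr.2)
  exact h.ne this

end IsTame

/-- The last zero before `q` of a function that is positive at `q` but not at `p < q`. -/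
theorem exists_last_zero {Y : ℝ → ℝ} {p q : ℝ} (hY : ContinuousOn Y (Icc p q)) (hq : 0 < Y q)
    (hpq : p ≤ q) (hp : Y p ≤ 0) :
    ∃ z ∈ Ico p q, Y z = 0 ∧ ∀ y ∈ Ioc z q, 0 < Y y := by
  have hcpt : IsCompact (Icc p q ∩ Y ⁻¹' Iic 0) :=
    isCompact_Icc.of_isClosed_subset (hY.preimage_isClosed_of_isClosed isClosed_Icc isClosed_Iic)
      inter_subset_left
  obtain ⟨z, ⟨hz, hz0⟩, hmax⟩ := hcpt.exists_isGreatest ⟨p, ⟨left_mem_Icc.2 hpq, hp⟩⟩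
  have hz0' : Y z ≤ 0 := hz0
  have hzlt : z < q := lt_of_le_of_ne hz.2 (by rintro rfl; linarith)
  have hposr : ∀ y ∈ Ioc z q, 0 < Y y := fun y hy => by
    by_contra! hy0
    exact absurd (hmax ⟨⟨hz.1.trans hy.1.le, hy.2⟩, hy0⟩) (not_le.2 hy.1)
  refine ⟨z, ⟨hz.1, hzlt⟩, le_antisymm hz0' ?_, hposr⟩
  by_contra! hneg
  obtain ⟨y, hy, hy0⟩ := intermediate_value_Icc hz.2 (hY.mono (Icc_subset_Icc_left hz.1))
    (show (0 : ℝ) ∈ Icc (Y z) (Y q) from ⟨hz0', hq.le⟩)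
  rcases hy.1.eq_or_lt with h | h
  · rw [← h] at hy0; linarith
  · exact (hposr y ⟨h, hy.2⟩).ne' hy0

/-- A function that is positive at `r₁` and has negative derivative at its zeros is positive to
the left of `r₁`. -/
theorem pos_of_deriv_neg_at_zeros {Y : ℝ → ℝ} {Y' : ℝ → ℝ} {r₁ : ℝ}
    (hY : ∀ r ∈ Ioc 0 r₁, HasDerivAt Y (Y' r) r) (h₁ : 0 < Y r₁)
    (hneg : ∀ r ∈ Ioo 0 r₁, Y r = 0 → Y' r < 0) : ∀ r ∈ Ioc 0 r₁, 0 < Y r := by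
  intro r hr
  by_contra! hle
  obtain ⟨z, hz, hzero, hposr⟩ := exists_last_zero (fun z hz =>
    (hY z ⟨hr.1.trans_le hz.1, hz.2⟩).continuousAt.continuousWithinAt) h₁ hr.2 hle
  have hz0 := hr.1.trans_le hz.1
  have hd0 := hneg z ⟨hz0, hz.2⟩ hzero
  have hslope := (hasDerivAt_iff_tendsto_slope.1 (hY z ⟨hz0, hz.2.le⟩)).mono_left
    (nhdsWithin_mono z (fun y (hy : z < y) => hy.ne') : 𝓝[>] z ≤ 𝓝[≠] z)
  have : 0 ≤ Y' z := by
    refine ge_of_tendsto hslope ?_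
    filter_upwards [Ioc_mem_nhdsGT hz.2] with y hy
    rw [slope_def_field, hzero, sub_zero]
    exact div_nonneg (hposr y hy).le (by linarith [hy.1])
  linarith

/-! ### Secants and reparametrization -/

/-- For a function on `[a, c]` with second derivative at least `M`, the slopes of the secants from
`a` grow at rate at least `M / 2`. -/
theorem secant_sub_secant_ge {f f' f'' : ℝ → ℝ} {a b c M : ℝ} (hab : a < b) (hbc : b < c)
    (hf : ∀ t ∈ Icc a c, HasDerivAt f (f' t) t) (hf' : ∀ t ∈ Icc a c, HasDerivAt f' (f'' t) t)
    (hM : ∀ t ∈ Icc a c, M ≤ f'' t) :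
    M / 2 * (c - b) ≤ (f c - f a) / (c - a) - (f b - f a) / (b - a) := by
  have hg : ∀ t ∈ Icc a c, HasDerivAt (fun t => f t - M / 2 * t ^ 2) (f' t - M * t) t :=
    fun t ht => by
      exact ((hf t ht).sub ((hasDerivAt_pow 2 t).const_mul (M / 2))).congr_deriv
        (by push_cast; ring)
  have hg' : ∀ t ∈ Icc a c, HasDerivAt (fun t => f' t - M * t) (f'' t - M) t := fun t ht => by
    exact ((hf' t ht).sub ((hasDerivAt_id t).const_mul M)).congr_deriv (by ring)
  have hconv : ConvexOn ℝ (Icc a c) (fun t => f t - M / 2 * t ^ 2) := by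
    refine convexOn_of_hasDerivWithinAt2_nonneg (convex_Icc a c)
      (fun t ht => (hg t ht).continuousAt.continuousWithinAt)
      (fun t ht => (hg t (interior_subset ht)).hasDerivWithinAt)
      (fun t ht => (hg' t (interior_subset ht)).hasDerivWithinAt)
      (fun t ht => by linarith [hM t (interior_subset ht)])
  have h := hconv.secant_mono (a := a) (x := b) (y := c) ⟨le_rfl, (hab.trans hbc).le⟩
    ⟨hab.le, hbc.le⟩ ⟨(hab.trans hbc).le, le_rfl⟩ hab.ne' (hab.trans hbc).ne' hbc.le
  have h1 : 0 < b - a := by linarith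
  have h2 : 0 < c - a := by linarith
  have e1 : (f b - M / 2 * b ^ 2 - (f a - M / 2 * a ^ 2)) / (b - a)
      = (f b - f a) / (b - a) - M / 2 * (b + a) := by field_simp; ring
  have e2 : (f c - M / 2 * c ^ 2 - (f a - M / 2 * a ^ 2)) / (c - a)
      = (f c - f a) / (c - a) - M / 2 * (c + a) := by field_simp; ring
  rw [e1, e2] at h
  linarith

/-- The slope of a secant of a convex function is at most the derivative at its right end. -/
theorem sub_le_deriv_right_mul {f f' f'' : ℝ → ℝ} {a c : ℝ} (hac : a ≤ c)
    (hf : ∀ t ∈ Icc a c, HasDerivAt f (f' t) t) (hf' : ∀ t ∈ Icc a c, HasDerivAt f' (f'' t) t)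
    (h0 : ∀ t ∈ Icc a c, 0 ≤ f'' t) : f c - f a ≤ f' c * (c - a) := by
  rcases hac.eq_or_lt with rfl | hlt
  · simp
  obtain ⟨z, hz, he⟩ := exists_hasDerivAt_eq_slope f f' hlt
    (fun t ht => (hf t ht).continuousAt.continuousWithinAt) (fun t ht => hf t ⟨ht.1.le, ht.2.le⟩)
  have hmono : MonotoneOn f' (Icc a c) := monotoneOn_of_hasDerivWithinAt_nonneg (convex_Icc a c)
    (fun t ht => (hf' t ht).continuousAt.continuousWithinAt)
    (fun t ht => (hf' t (interior_subset ht)).hasDerivWithinAt)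
    (fun t ht => h0 t (interior_subset ht))
  have h1 := hmono ⟨hz.1.le, hz.2.le⟩ ⟨hlt.le, le_rfl⟩ hz.2.le
  rw [he, div_le_iff₀ (by linarith)] at h1
  exact h1

/-- If `ds/dr = f(r)` is positive and bounded on `(0, r₁)`, then `r` is a function of `s` near
`s = 0`, with `r → 0` as `s → 0`. -/
theorem exists_reparametrization {f : ℝ → ℝ} {r₁ C : ℝ} (hr₁ : 0 < r₁)
    (hc : ContinuousOn f (Ioo 0 r₁)) (hpos : ∀ r ∈ Ioo 0 r₁, 0 < f r)
    (hC : ∀ r ∈ Ioo 0 r₁, f r ≤ C) :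
    ∃ ε > 0, ∃ ρ : ℝ → ℝ, (∀ s ∈ Ioo 0 ε, ρ s ∈ Ioo 0 r₁ ∧ HasDerivAt ρ (f (ρ s))⁻¹ s) ∧
      Tendsto ρ (𝓝[>] 0) (𝓝 0) := by
  have hint : IntegrableOn f (Ioo 0 r₁) := by
    refine IntegrableOn.of_bound (by simp) (hc.aestronglyMeasurable measurableSet_Ioo) C ?_
    filter_upwards [ae_restrict_mem measurableSet_Ioo] with r hr
    rw [Real.norm_eq_abs, abs_of_pos (hpos r hr)]
    exact hC r hr
  have hii : ∀ p q, 0 ≤ p → p ≤ q → q < r₁ → IntervalIntegrable f volume p q :=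
    fun p q hp hpq hq => by
      rw [intervalIntegrable_iff_integrableOn_Ioc_of_le hpq]
      exact hint.mono_set fun x hx => ⟨hp.trans_lt hx.1, hx.2.trans_lt hq⟩
  set S : ℝ → ℝ := fun r => ∫ x in (0 : ℝ)..r, f x with hS
  have hderiv : ∀ r ∈ Ioo 0 r₁, HasDerivAt S (f r) r := fun r hr =>
    intervalIntegral.integral_hasDerivAt_right (hii 0 r le_rfl hr.1.le hr.2)
      (hc.stronglyMeasurableAtFilter isOpen_Ioo r hr) (hc.continuousAt (Ioo_mem_nhds hr.1 hr.2))
  have hmono : StrictMonoOn S (Ioo 0 r₁) := by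
    refine strictMonoOn_of_hasDerivWithinAt_pos (convex_Ioo _ _) (f' := f)
      (fun r hr => (hderiv r hr).continuousAt.continuousWithinAt) ?_ ?_
    · rw [interior_Ioo]; exact fun r hr => (hderiv r hr).hasDerivWithinAt
    · rw [interior_Ioo]; exact hpos
  have hSpos : ∀ r ∈ Ioo 0 r₁, 0 < S r := fun r hr =>
    intervalIntegral.intervalIntegral_pos_of_pos_on (hii 0 r le_rfl hr.1.le hr.2)
      (fun x hx => hpos x ⟨hx.1, hx.2.trans hr.2⟩) hr.1
  have hSle : ∀ r ∈ Ioo 0 r₁, S r ≤ C * r := fun r hr => by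
    have h1 := intervalIntegral.integral_mono_on_of_le_Ioo hr.1.le (hii 0 r le_rfl hr.1.le hr.2)
      (_root_.intervalIntegrable_const (c := C))
      (fun x hx => hC x ⟨hx.1, hx.2.trans hr.2⟩)
    simpa [mul_comm] using h1
  have hC0 : 0 < C := (hpos (r₁ / 2) ⟨by linarith, by linarith⟩).trans_le
    (hC (r₁ / 2) ⟨by linarith, by linarith⟩)
  set q := r₁ / 2 with hq
  have hqm : q ∈ Ioo 0 r₁ := ⟨by linarith, by linarith⟩
  have hex : ∀ s, ∃ r, s ∈ Ioo 0 (S q) → r ∈ Ioo 0 q ∧ S r = s := by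
    intro s
    by_cases hs : s ∈ Ioo 0 (S q)
    · set p := min (q / 2) (s / (2 * C)) with hp
      have hp0 : 0 < p := lt_min (by linarith) (div_pos hs.1 (by linarith))
      have hpq : p < q := (min_le_left _ _).trans_lt (by linarith)
      have hpm : p ∈ Ioo 0 r₁ := ⟨hp0, hpq.trans hqm.2⟩
      have hSp : S p < s := by
        refine (hSle p hpm).trans_lt ?_
        have : C * p ≤ C * (s / (2 * C)) := by gcongr; exact min_le_right _ _
        have e : C * (s / (2 * C)) = s / 2 := by field_simp
        linarith [hs.1]
      obtain ⟨r, hr, he⟩ := intermediate_value_Ioo hpq.le (f := S)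
        (fun x hx =>
          (hderiv x ⟨hp0.trans_le hx.1, hx.2.trans_lt hqm.2⟩).continuousAt.continuousWithinAt)
        ⟨hSp, hs.2⟩
      exact ⟨r, fun _ => ⟨⟨hp0.trans hr.1, hr.2⟩, he⟩⟩
    · exact ⟨0, fun h => absurd h hs⟩
  choose ρ hρ using hex
  have hρm : ∀ s ∈ Ioo 0 (S q), ρ s ∈ Ioo 0 r₁ := fun s hs =>
    ⟨(hρ s hs).1.1, (hρ s hs).1.2.trans hqm.2⟩
  have hSρ : ∀ r ∈ Ioo 0 q, S r ∈ Ioo 0 (S q) ∧ ρ (S r) = r := fun r hr => by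
    have hr' : r ∈ Ioo 0 r₁ := ⟨hr.1, hr.2.trans hqm.2⟩
    have h1 : S r ∈ Ioo 0 (S q) := ⟨hSpos r hr', hmono hr' hqm hr.2⟩
    exact ⟨h1, hmono.injOn (hρm _ h1) hr' (hρ _ h1).2⟩
  have hρmono : StrictMonoOn ρ (Ioo 0 (S q)) := fun s hs s' hs' hlt => by
    rw [← hmono.lt_iff_lt (hρm s hs) (hρm s' hs'), (hρ s hs).2, (hρ s' hs').2]
    exact hlt
  refine ⟨S q, hSpos q hqm, ρ, fun s hs => ⟨hρm s hs, ?_⟩, ?_⟩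
  · have hcont : ContinuousAt ρ s := by
      refine hρmono.continuousAt_of_image_mem_nhds (Ioo_mem_nhds hs.1 hs.2) ?_
      refine mem_of_superset (Ioo_mem_nhds (hρ s hs).1.1 (hρ s hs).1.2) fun r hr => ?_
      exact ⟨S r, (hSρ r hr).1, (hSρ r hr).2⟩
    refine HasDerivAt.of_local_left_inverse hcont (hderiv _ (hρm s hs)) (hpos _ (hρm s hs)).ne' ?_
    filter_upwards [Ioo_mem_nhds hs.1 hs.2] with s' hs' using (hρ s' hs').2
  · refine tendsto_order.2 ⟨fun a ha => ?_, fun a ha => ?_⟩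
    · filter_upwards [Ioo_mem_nhdsGT (hSpos q hqm)] with s hs using ha.trans (hρm s hs).1
    · have hm : min a q / 2 ∈ Ioo 0 q := by
        have h1 : 0 < min a q := lt_min ha hqm.1
        have h2 := min_le_right a q
        exact ⟨by linarith, by linarith⟩
      filter_upwards [Ioo_mem_nhdsGT (hSρ _ hm).1.1] with s hs
      have hs' : s ∈ Ioo 0 (S q) := ⟨hs.1, hs.2.trans (hSρ _ hm).1.2⟩
      have := hρmono hs' (hSρ _ hm).1 hs.2
      rw [(hSρ _ hm).2] at this
      have h2 := min_le_left a q
      have h1 : 0 < min a q := lt_min ha hqm.1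
      linarith

/-! ### The initial data near the centre -/

/-- `√(m / r³)`, which is `2 / (3 t_c)`. -/
noncomputable def shape (μ : ℝ → ℝ) (r : ℝ) : ℝ := √(mass μ r / r ^ 3)

/-- Minus the derivative of `shape`. -/
noncomputable def shapeSlope (μ : ℝ → ℝ) (r : ℝ) : ℝ :=
  (3 * (mass μ r / r ^ 3) - μ r) / (2 * r * shape μ r)

/-- What the geodesic equations use of the initial data: `k = √(m / r³)` is a positive function on
`(0, b)` with limit `k₀ > 0` at the centre and negative derivative `-K`, where `K` is of
class `C¹`. -/
structure Profile (b k₀ : ℝ) (k K : ℝ → ℝ) : Prop where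
  k₀_pos : 0 < k₀
  k_pos : ∀ r ∈ Ioo 0 b, 0 < k r
  K_pos : ∀ r ∈ Ioo 0 b, 0 < K r
  hasDerivAt : ∀ r ∈ Ioo 0 b, HasDerivAt k (-K r) r
  contDiffOn : ContDiffOn ℝ 1 K (Ioo 0 b)
  tendsto : Tendsto k (𝓝[>] 0) (𝓝 k₀)

namespace Profile

variable {b k₀ : ℝ} {k K : ℝ → ℝ}

lemma mono (h : Profile b k₀ k K) {c : ℝ} (hc : c ≤ b) : Profile c k₀ k K where
  k₀_pos := h.k₀_pos
  k_pos r hr := h.k_pos r ⟨hr.1, hr.2.trans_le hc⟩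
  K_pos r hr := h.K_pos r ⟨hr.1, hr.2.trans_le hc⟩
  hasDerivAt r hr := h.hasDerivAt r ⟨hr.1, hr.2.trans_le hc⟩
  contDiffOn := h.contDiffOn.mono (Ioo_subset_Ioo_right hc)
  tendsto := h.tendsto

lemma continuousOn (h : Profile b k₀ k K) : ContinuousOn k (Ioo 0 b) := fun r hr =>
  (h.hasDerivAt r hr).continuousAt.continuousWithinAt

lemma strictAntiOn (h : Profile b k₀ k K) : StrictAntiOn k (Ioo 0 b) := by
  refine strictAntiOn_of_hasDerivWithinAt_neg (convex_Ioo _ _) h.continuousOn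
    (f' := fun r => -K r) ?_ ?_
  · rw [interior_Ioo]; exact fun r hr => (h.hasDerivAt r hr).hasDerivWithinAt
  · rw [interior_Ioo]; exact fun r hr => neg_neg_of_pos (h.K_pos r hr)

lemma k_lt (h : Profile b k₀ k K) {r : ℝ} (hr : r ∈ Ioo 0 b) : k r < k₀ := by
  have h2 : r / 2 ∈ Ioo 0 b := ⟨by linarith [hr.1], by linarith [hr.1, hr.2]⟩
  refine (h.strictAntiOn h2 hr (by linarith [hr.1])).trans_le ?_
  refine ge_of_tendsto h.tendsto ?_
  filter_upwards [Ioo_mem_nhdsGT h2.1] with x hx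
  exact (h.strictAntiOn ⟨hx.1, hx.2.trans h2.2⟩ h2 hx.2).le

end Profile

section Taylor

/-- The Taylor polynomial of `μ` at the centre, and what it says about the mean density
`m / r³`. -/
lemma exists_taylor {b : ℝ} {μ : ℝ → ℝ} (hb : 0 < b) (hμ : ContDiffOn ℝ 3 μ (Icc 0 b)) :
    ∃ c₁ c₂ c₃ : ℝ,
      Tendsto (fun r => (μ r - (μ 0 + c₁ * r + c₂ * r ^ 2 + c₃ * r ^ 3)) / r ^ 3) (𝓝[>] 0) (𝓝 0) ∧
      Tendsto (fun r => (mass μ r / r ^ 3 -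
        (μ 0 / 3 + c₁ / 4 * r + c₂ / 5 * r ^ 2 + c₃ / 6 * r ^ 3)) / r ^ 3) (𝓝[>] 0) (𝓝 0) := by
  have h0 : (0 : ℝ) ∈ Icc 0 b := left_mem_Icc.2 hb.le
  have ht := Real.taylor_tendsto (n := 3) (convex_Icc 0 b) h0 (by exact_mod_cast hμ)
  obtain ⟨c₁, c₂, c₃, hc⟩ : ∃ c₁ c₂ c₃ : ℝ, ∀ x,
      taylorWithinEval μ 3 (Icc 0 b) 0 x = μ 0 + c₁ * x + c₂ * x ^ 2 + c₃ * x ^ 3 := by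
    refine ⟨iteratedDerivWithin 1 μ (Icc 0 b) 0, iteratedDerivWithin 2 μ (Icc 0 b) 0 / 2,
      iteratedDerivWithin 3 μ (Icc 0 b) 0 / 6, fun x => ?_⟩
    rw [taylor_within_apply]
    simp [Finset.sum_range_succ, Nat.factorial]
    ring
  have hle : 𝓝[>] (0 : ℝ) ≤ 𝓝[Icc 0 b] 0 := by
    rw [← nhdsWithin_Ioo_eq_nhdsGT hb]
    exact nhdsWithin_mono _ Ioo_subset_Icc_self
  have h1 : Tendsto (fun r => (μ r - (μ 0 + c₁ * r + c₂ * r ^ 2 + c₃ * r ^ 3)) / r ^ 3)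
      (𝓝[>] 0) (𝓝 0) := by
    refine (ht.mono_left hle).congr fun x => ?_
    rw [hc]; simp
  refine ⟨c₁, c₂, c₃, h1, ?_⟩
  rw [Metric.tendsto_nhdsWithin_nhds] at h1 ⊢
  intro δ hδ
  obtain ⟨η, hη, h⟩ := h1 δ hδ
  refine ⟨min η b, lt_min hη hb, fun {r} hr hrη => ?_⟩
  have hr : 0 < r := hr
  rw [Real.dist_eq, sub_zero, abs_of_pos hr] at hrη
  have hrb := hrη.trans_le (min_le_right _ _)
  have hrη := hrη.trans_le (min_le_left _ _)
  set P : ℝ → ℝ := fun x => μ 0 + c₁ * x + c₂ * x ^ 2 + c₃ * x ^ 3 with hP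
  have hbd : ∀ x ∈ Ioc 0 r, |x ^ 2 * μ x - x ^ 2 * P x| ≤ δ * x ^ 5 := fun x hx => by
    have := h (x := x) hx.1 (by rw [Real.dist_eq, sub_zero, abs_of_pos hx.1]; linarith [hx.2])
    rw [Real.dist_eq, sub_zero, abs_div, abs_of_pos (pow_pos hx.1 3),
      div_lt_iff₀ (pow_pos hx.1 3)] at this
    rw [← mul_sub, abs_mul, abs_of_pos (pow_pos hx.1 2)]
    calc x ^ 2 * |μ x - P x| ≤ x ^ 2 * (δ * x ^ 3) := by gcongr
      _ = δ * x ^ 5 := by ring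
  have hcμ : ContinuousOn (fun x => x ^ 2 * μ x) (uIcc 0 r) := by
    rw [uIcc_of_le hr.le]
    exact (continuousOn_pow 2).mul (hμ.continuousOn.mono (Icc_subset_Icc_right hrb.le))
  have hcP : Continuous (fun x => x ^ 2 * P x) := by simp only [hP]; fun_prop
  have hPint : ∫ x in (0 : ℝ)..r, x ^ 2 * P x
      = r ^ 3 * (μ 0 / 3 + c₁ / 4 * r + c₂ / 5 * r ^ 2 + c₃ / 6 * r ^ 3) := by
    have hd : ∀ x ∈ uIcc 0 r, HasDerivAt
        (fun x => μ 0 / 3 * x ^ 3 + c₁ / 4 * x ^ 4 + c₂ / 5 * x ^ 5 + c₃ / 6 * x ^ 6)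
        (x ^ 2 * P x) x := fun x _ => by
      refine ((((hasDerivAt_pow 3 x).const_mul (μ 0 / 3)).add
        ((hasDerivAt_pow 4 x).const_mul (c₁ / 4))).add
        ((hasDerivAt_pow 5 x).const_mul (c₂ / 5))).add
        ((hasDerivAt_pow 6 x).const_mul (c₃ / 6)) |>.congr_deriv ?_
      simp only [hP]; push_cast; ring
    rw [intervalIntegral.integral_eq_sub_of_hasDerivAt hd (hcP.intervalIntegrable _ _)]
    ring
  have hdiff : |mass μ r - ∫ x in (0 : ℝ)..r, x ^ 2 * P x| ≤ δ * (r ^ 6 / 6) := by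
    rw [mass, ← intervalIntegral.integral_sub hcμ.intervalIntegrable (hcP.intervalIntegrable _ _)]
    refine (intervalIntegral.norm_integral_le_of_norm_le
      (f := fun x => x ^ 2 * μ x - x ^ 2 * P x) (g := fun x => δ * x ^ 5) hr.le
      (Eventually.of_forall fun x hx => hbd x hx)
      (Continuous.intervalIntegrable (by fun_prop) _ _)).trans ?_
    rw [intervalIntegral.integral_const_mul, integral_pow]
    norm_num
  rw [hPint] at hdiff
  rw [Real.dist_eq, sub_zero]
  have e : (mass μ r / r ^ 3 - (μ 0 / 3 + c₁ / 4 * r + c₂ / 5 * r ^ 2 + c₃ / 6 * r ^ 3)) / r ^ 3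
      = (mass μ r - r ^ 3 * (μ 0 / 3 + c₁ / 4 * r + c₂ / 5 * r ^ 2 + c₃ / 6 * r ^ 3)) / r ^ 6 := by
    field_simp
  rw [e, abs_div, abs_of_pos (pow_pos hr 6), div_lt_iff₀ (pow_pos hr 6)]
  have := mul_pos hδ (pow_pos hr 6)
  linarith

/-- The alternative for functions `D > 0` and `A` with the expansions
`D = d₁ r + d₂ r² + d₃ r³ + o(r³)` and `A = d₁ r + d₂ r² / 2 + d₃ r³ / 3 + o(r³)`. -/
lemma expansion_cases {D A : ℝ → ℝ} {d₁ d₂ d₃ : ℝ} (hD : ∀ᶠ r in 𝓝[>] 0, 0 < D r)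
    (h1 : Tendsto (fun r => (D r - (d₁ * r + d₂ * r ^ 2 + d₃ * r ^ 3)) / r ^ 3) (𝓝[>] 0) (𝓝 0))
    (h2 : Tendsto (fun r => (A r - (d₁ * r + d₂ / 2 * r ^ 2 + d₃ / 3 * r ^ 3)) / r ^ 3)
      (𝓝[>] 0) (𝓝 0)) :
    ((∀ᶠ r in 𝓝[>] 0, A r ≤ 6 / 5 * D r) ∧
      (Tendsto (fun r => D r / r ^ 3) (𝓝[>] 0) atTop ∨ ∃ C, ∀ᶠ r in 𝓝[>] 0, D r ≤ C * r ^ 3)) ∨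
    ∀ δ > 0, ∀ᶠ r in 𝓝[>] 0, A r ≤ δ * r ^ 3 := by
  have hid : Tendsto (fun r : ℝ => r) (𝓝[>] 0) (𝓝 0) :=
    tendsto_nhdsWithin_of_tendsto_nhds tendsto_id
  have hpos : ∀ᶠ r : ℝ in 𝓝[>] 0, 0 < r := self_mem_nhdsWithin
  have hinv : Tendsto (fun r : ℝ => r⁻¹) (𝓝[>] 0) atTop := tendsto_inv_nhdsGT_zero
  -- expansions of `D` and of `6/5 D - A`, divided by `r`
  have g1 : Tendsto (fun r => D r / r) (𝓝[>] 0) (𝓝 d₁) := by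
    have := ((tendsto_const_nhds (x := d₁)).add ((hid.const_mul d₂).add
      ((hid.pow 2).const_mul d₃))).add ((hid.pow 2).mul h1)
    simp only [mul_zero, add_zero, ne_eq, OfNat.ofNat_ne_zero, not_false_eq_true, zero_pow] at this
    refine this.congr' ?_
    filter_upwards [hpos] with r hr
    field_simp; ring
  have hd1 : 0 ≤ d₁ := by
    refine ge_of_tendsto g1 ?_
    filter_upwards [hD, hpos] with r h h' using (div_pos h h').le
  rcases hd1.lt_or_eq with hd1 | hd1
  · left
    have e : Tendsto (fun r => (6 / 5 * D r - A r) / r) (𝓝[>] 0) (𝓝 (6 / 5 * d₁ - d₁)) := by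
      have g2 : Tendsto (fun r => A r / r) (𝓝[>] 0) (𝓝 d₁) := by
        have := ((tendsto_const_nhds (x := d₁)).add ((hid.const_mul (d₂ / 2)).add
          ((hid.pow 2).const_mul (d₃ / 3)))).add ((hid.pow 2).mul h2)
        simp only [mul_zero, add_zero, ne_eq, OfNat.ofNat_ne_zero, not_false_eq_true, zero_pow]
          at this
        refine this.congr' ?_
        filter_upwards [hpos] with r hr
        field_simp; ring
      refine ((g1.const_mul (6 / 5)).sub g2).congr fun r => by ring
    refine ⟨?_, Or.inl ?_⟩
    · filter_upwards [e.eventually_const_lt (show 0 < 6 / 5 * d₁ - d₁ by linarith), hpos]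
        with r h h'
      have := (div_pos_iff_of_pos_right h').1 h
      linarith
    · have hinv2 : Tendsto (fun r : ℝ => r⁻¹ ^ 2) (𝓝[>] 0) atTop :=
        (tendsto_pow_atTop two_ne_zero).comp hinv
      refine (g1.pos_mul_atTop hd1 hinv2).congr' ?_
      filter_upwards [hpos] with r hr
      field_simp
  · subst hd1
    have g1 : Tendsto (fun r => D r / r ^ 2) (𝓝[>] 0) (𝓝 d₂) := by
      have := ((tendsto_const_nhds (x := d₂)).add (hid.const_mul d₃)).add (hid.mul h1)
      simp only [mul_zero, add_zero] at this
      refine this.congr' ?_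
      filter_upwards [hpos] with r hr
      field_simp; ring
    have hd2 : 0 ≤ d₂ := by
      refine ge_of_tendsto g1 ?_
      filter_upwards [hD, hpos] with r h h' using (div_pos h (pow_pos h' 2)).le
    rcases hd2.lt_or_eq with hd2 | hd2
    · left
      have e : Tendsto (fun r => (6 / 5 * D r - A r) / r ^ 2) (𝓝[>] 0)
          (𝓝 (6 / 5 * d₂ - d₂ / 2)) := by
        have g2 : Tendsto (fun r => A r / r ^ 2) (𝓝[>] 0) (𝓝 (d₂ / 2)) := by
          have := ((tendsto_const_nhds (x := d₂ / 2)).add (hid.const_mul (d₃ / 3))).add (hid.mul h2)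
          simp only [mul_zero, add_zero] at this
          refine this.congr' ?_
          filter_upwards [hpos] with r hr
          field_simp; ring
        refine ((g1.const_mul (6 / 5)).sub g2).congr fun r => by ring
      refine ⟨?_, Or.inl ?_⟩
      · filter_upwards [e.eventually_const_lt (show 0 < 6 / 5 * d₂ - d₂ / 2 by linarith), hpos]
          with r h h'
        have := (div_pos_iff_of_pos_right (pow_pos h' 2)).1 h
        linarith
      · refine (g1.pos_mul_atTop hd2 hinv).congr' ?_
        filter_upwards [hpos] with r hr
        field_simp
    · subst hd2
      have g1 : Tendsto (fun r => D r / r ^ 3) (𝓝[>] 0) (𝓝 d₃) := by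
        have := (tendsto_const_nhds (x := d₃)).add h1
        simp only [add_zero] at this
        refine this.congr' ?_
        filter_upwards [hpos] with r hr
        field_simp; ring
      have g2 : Tendsto (fun r => A r / r ^ 3) (𝓝[>] 0) (𝓝 (d₃ / 3)) := by
        have := (tendsto_const_nhds (x := d₃ / 3)).add h2
        simp only [add_zero] at this
        refine this.congr' ?_
        filter_upwards [hpos] with r hr
        field_simp; ring
      have hd3 : 0 ≤ d₃ := by
        refine ge_of_tendsto g1 ?_
        filter_upwards [hD, hpos] with r h h' using (div_pos h (pow_pos h' 3)).le
      rcases hd3.lt_or_eq with hd3 | hd3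
      · left
        have e : Tendsto (fun r => (6 / 5 * D r - A r) / r ^ 3) (𝓝[>] 0)
            (𝓝 (6 / 5 * d₃ - d₃ / 3)) :=
          ((g1.const_mul (6 / 5)).sub g2).congr fun r => by ring
        refine ⟨?_, Or.inr ⟨d₃ + 1, ?_⟩⟩
        · filter_upwards [e.eventually_const_lt (show 0 < 6 / 5 * d₃ - d₃ / 3 by linarith), hpos]
            with r h h'
          have := (div_pos_iff_of_pos_right (pow_pos h' 3)).1 h
          linarith
        · filter_upwards [g1.eventually_lt_const (show d₃ < d₃ + 1 by linarith), hpos] with r h h'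
          exact ((div_lt_iff₀ (pow_pos h' 3)).1 h).le
      · subst hd3
        right
        intro δ hδ
        rw [zero_div] at g2
        filter_upwards [g2.eventually_lt_const hδ, hpos] with r h h'
        exact ((div_lt_iff₀ (pow_pos h' 3)).1 h).le

end Taylor

namespace RegularData

variable {b : ℝ} {μ : ℝ → ℝ}

lemma mass_zero (μ : ℝ → ℝ) : mass μ 0 = 0 := by simp [mass]

lemma mass_pos (h : RegularData b μ) {r : ℝ} (hr : r ∈ Ioc 0 b) : 0 < mass μ r := by
  have := h.mass_strictMono ⟨le_rfl, h.radius_pos.le⟩ ⟨hr.1.le, hr.2⟩ hr.1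
  rwa [mass_zero] at this

lemma hasDerivAt_mass (h : RegularData b μ) {r : ℝ} (hr : r ∈ Ioo 0 b) :
    HasDerivAt (mass μ) (r ^ 2 * μ r) r := by
  have hc : ContinuousOn (fun x => x ^ 2 * μ x) (Icc 0 b) :=
    (continuousOn_pow 2).mul h.density_smooth.continuousOn
  have hc' : ContinuousOn (fun x => x ^ 2 * μ x) (Ioo 0 b) := hc.mono Ioo_subset_Icc_self
  refine intervalIntegral.integral_hasDerivAt_right (f := fun x => x ^ 2 * μ x) ?_
    (hc'.stronglyMeasurableAtFilter isOpen_Ioo r hr) (hc'.continuousAt (Ioo_mem_nhds hr.1 hr.2))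
  refine ContinuousOn.intervalIntegrable ?_
  rw [uIcc_of_le hr.1.le]
  exact hc.mono (Icc_subset_Icc_right hr.2.le)

lemma shape_pos (h : RegularData b μ) {r : ℝ} (hr : r ∈ Ioo 0 b) : 0 < shape μ r :=
  Real.sqrt_pos.2 (div_pos (h.mass_pos ⟨hr.1, hr.2.le⟩) (pow_pos hr.1 3))

lemma shape_sq (h : RegularData b μ) {r : ℝ} (hr : r ∈ Ioo 0 b) :
    shape μ r ^ 2 = mass μ r / r ^ 3 :=
  Real.sq_sqrt (div_pos (h.mass_pos ⟨hr.1, hr.2.le⟩) (pow_pos hr.1 3)).le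

lemma collapseTime_eq (h : RegularData b μ) {r : ℝ} (hr : r ∈ Ioo 0 b) :
    collapseTime μ r = 2 / (3 * shape μ r) := by
  have hk := h.shape_pos hr
  have e : r ^ 3 / mass μ r = ((shape μ r)⁻¹) ^ 2 := by
    rw [inv_pow, h.shape_sq hr, inv_div]
  rw [collapseTime, e, Real.sqrt_sq (by positivity)]
  field_simp

lemma density_gap_pos (h : RegularData b μ) {r : ℝ} (hr : r ∈ Ioo 0 b) :
    0 < 3 * (mass μ r / r ^ 3) - μ r := by
  have := h.no_shell_crossing r ⟨hr.1, hr.2.le⟩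
  have hr0 := hr.1
  have e : 3 * (mass μ r / r ^ 3) - μ r = (3 * mass μ r / r - r ^ 2 * μ r) / r ^ 2 := by
    field_simp
  rw [e]
  exact div_pos (by linarith) (by positivity)

lemma hasDerivAt_shape (h : RegularData b μ) {r : ℝ} (hr : r ∈ Ioo 0 b) :
    HasDerivAt (shape μ) (-shapeSlope μ r) r := by
  have hr0 := hr.1
  have hk := h.shape_pos hr
  have hd : HasDerivAt (fun x => mass μ x / x ^ 3) _ r :=
    (h.hasDerivAt_mass hr).div (hasDerivAt_pow 3 r) (pow_pos hr.1 3).ne'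
  refine (hd.sqrt (by rw [← h.shape_sq hr]; positivity)).congr_deriv ?_
  change _ / (2 * shape μ r) = _
  rw [shapeSlope]
  push_cast
  field_simp
  ring

lemma contDiffOn_shapeSlope (h : RegularData b μ) : ContDiffOn ℝ 1 (shapeSlope μ) (Ioo 0 b) := by
  have hμ : ContDiffOn ℝ 1 μ (Ioo 0 b) :=
    (h.density_smooth.mono Ioo_subset_Icc_self).of_le (by norm_num)
  have hm : ContDiffOn ℝ 1 (mass μ) (Ioo 0 b) := by
    rw [show (1 : WithTop ℕ∞) = 0 + 1 from rfl, contDiffOn_succ_iff_deriv_of_isOpen isOpen_Ioo]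
    refine ⟨fun r hr => (h.hasDerivAt_mass hr).differentiableAt.differentiableWithinAt,
      by simp, ?_⟩
    rw [contDiffOn_zero]
    refine ((continuousOn_pow 2).mul hμ.continuousOn).congr fun r hr => ?_
    exact (h.hasDerivAt_mass hr).deriv
  have hid : ContDiffOn ℝ 1 (fun r : ℝ => r) (Ioo 0 b) := contDiffOn_id
  have hh : ContDiffOn ℝ 1 (fun r => mass μ r / r ^ 3) (Ioo 0 b) :=
    hm.div (hid.pow 3) fun r hr => (pow_pos hr.1 3).ne'
  have hk : ContDiffOn ℝ 1 (shape μ) (Ioo 0 b) := hh.sqrt fun r hr =>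
    (div_pos (h.mass_pos ⟨hr.1, hr.2.le⟩) (pow_pos hr.1 3)).ne'
  refine ((contDiffOn_const.mul hh).sub hμ).div ((contDiffOn_const.mul hid).mul hk) fun r hr => ?_
  have := hr.1
  have := h.shape_pos hr
  positivity

lemma density_center_pos_and_tendsto (h : RegularData b μ) :
    0 < μ 0 ∧ Tendsto (fun r => mass μ r / r ^ 3) (𝓝[>] 0) (𝓝 (μ 0 / 3)) := by
  obtain ⟨c₁, c₂, c₃, -, h2⟩ := exists_taylor h.radius_pos h.density_smooth
  have hid : Tendsto (fun r : ℝ => r) (𝓝[>] 0) (𝓝 0) :=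
    tendsto_nhdsWithin_of_tendsto_nhds tendsto_id
  have ht : Tendsto (fun r => mass μ r / r ^ 3) (𝓝[>] 0) (𝓝 (μ 0 / 3)) := by
    have := ((((tendsto_const_nhds (x := μ 0 / 3)).add (hid.const_mul (c₁ / 4))).add
      ((hid.pow 2).const_mul (c₂ / 5))).add ((hid.pow 3).const_mul (c₃ / 6))).add
      ((hid.pow 3).mul h2)
    simp only [mul_zero, add_zero, ne_eq, OfNat.ofNat_ne_zero, not_false_eq_true, zero_pow] at this
    refine this.congr' ?_
    filter_upwards [self_mem_nhdsWithin] with r hr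
    have hr : 0 < r := hr
    field_simp; ring
  refine ⟨lt_of_le_of_ne ?_ h.density_center.symm, ht⟩
  have : 0 ≤ μ 0 / 3 := by
    refine ge_of_tendsto ht ?_
    filter_upwards [Ioo_mem_nhdsGT h.radius_pos] with r hr
    exact (div_pos (h.mass_pos ⟨hr.1, hr.2.le⟩) (pow_pos hr.1 3)).le
  linarith

lemma profile (h : RegularData b μ) :
    Profile b (√(μ 0 / 3)) (shape μ) (shapeSlope μ) where
  k₀_pos := Real.sqrt_pos.2 (by linarith [h.density_center_pos_and_tendsto.1])
  k_pos _ hr := h.shape_pos hr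
  K_pos r hr := by
    have := h.density_gap_pos hr
    have := h.shape_pos hr
    have := hr.1
    unfold shapeSlope
    positivity
  hasDerivAt _ hr := h.hasDerivAt_shape hr
  contDiffOn := h.contDiffOn_shapeSlope
  tendsto := h.density_center_pos_and_tendsto.2.sqrt

end RegularData

/-- A `Profile` near the centre. For a density `μ` of class `C³` with
`3 m / r³ - μ = d rⁿ (1 + o(1))`, `d > 0`, the three alternatives are `n ≤ 2`, `n = 3`, and that no
such `n ≤ 3` exists. -/
theorem RegularData.near_centre {b : ℝ} {μ : ℝ → ℝ} (h : RegularData b μ) :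
    (∃ κ, ∀ᶠ r in 𝓝[>] 0, shapeSlope μ r ≤ κ) ∧
    (((∀ᶠ r in 𝓝[>] 0, √(μ 0 / 3) - shape μ r ≤ 6 / 5 * (r * shapeSlope μ r)) ∧
      (Tendsto (fun r => shapeSlope μ r / r ^ 2) (𝓝[>] 0) atTop ∨
        ∃ C, ∀ᶠ r in 𝓝[>] 0, shapeSlope μ r ≤ C * r ^ 2)) ∨
    ∀ δ > 0, ∀ᶠ r in 𝓝[>] 0, √(μ 0 / 3) - shape μ r ≤ δ * r ^ 3) := by
  have hp := h.profile
  obtain ⟨c₁, c₂, c₃, h1, h2⟩ := exists_taylor h.radius_pos h.density_smooth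
  set k₀ := √(μ 0 / 3) with hk₀
  set k := shape μ with hk
  set K := shapeSlope μ with hK
  set D : ℝ → ℝ := fun r => 3 * (mass μ r / r ^ 3) - μ r with hD
  set A : ℝ → ℝ := fun r => μ 0 / 3 - mass μ r / r ^ 3 with hA
  have hk0 := hp.k₀_pos
  have hμ0 : k₀ ^ 2 = μ 0 / 3 := Real.sq_sqrt (by linarith [h.density_center_pos_and_tendsto.1])
  have hev : ∀ᶠ r in 𝓝[>] (0 : ℝ), r ∈ Ioo 0 b := Ioo_mem_nhdsGT h.radius_pos
  have hhalf : ∀ᶠ r in 𝓝[>] (0 : ℝ), k₀ / 2 < k r :=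
    hp.tendsto.eventually_const_lt (by linarith)
  have hid : Tendsto (fun r : ℝ => r) (𝓝[>] 0) (𝓝 0) :=
    tendsto_nhdsWithin_of_tendsto_nhds tendsto_id
  have e1 : Tendsto (fun r => (D r - (-c₁ / 4 * r + -2 * c₂ / 5 * r ^ 2 + -c₃ / 2 * r ^ 3)) / r ^ 3)
      (𝓝[>] 0) (𝓝 0) := by
    have := (h2.const_mul 3).sub h1
    rw [mul_zero, sub_zero] at this
    refine this.congr fun r => ?_
    simp only [hD]; ring
  have e2 : Tendsto (fun r => (A r - (-c₁ / 4 * r + -2 * c₂ / 5 / 2 * r ^ 2 + -c₃ / 2 / 3 * r ^ 3))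
      / r ^ 3) (𝓝[>] 0) (𝓝 0) := by
    have := h2.neg
    rw [neg_zero] at this
    refine this.congr fun r => ?_
    simp only [hA]; ring
  have hDpos : ∀ᶠ r in 𝓝[>] 0, 0 < D r := by
    filter_upwards [hev] with r hr using h.density_gap_pos hr
  have hKD : ∀ r, r ∈ Ioo 0 b → K r = D r / (2 * r * k r) := fun r _ => rfl
  have hAk : ∀ r ∈ Ioo 0 b, A r = (k₀ - k r) * (k₀ + k r) := fun r hr => by
    have := h.shape_sq hr
    simp only [hA, ← hμ0, ← this]; ring
  refine ⟨?_, ?_⟩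
  · have g : Tendsto (fun r => D r / r) (𝓝[>] 0) (𝓝 (-c₁ / 4)) := by
      have := ((tendsto_const_nhds (x := -c₁ / 4)).add ((hid.const_mul (-2 * c₂ / 5)).add
        ((hid.pow 2).const_mul (-c₃ / 2)))).add ((hid.pow 2).mul e1)
      simp only [mul_zero, add_zero, ne_eq, OfNat.ofNat_ne_zero, not_false_eq_true, zero_pow]
        at this
      refine this.congr' ?_
      filter_upwards [self_mem_nhdsWithin] with r hr
      have hr : 0 < r := hr
      field_simp; ring
    refine ⟨(-c₁ / 4 + 1) / k₀, ?_⟩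
    filter_upwards [hev, hhalf, g.eventually_lt_const (show -c₁ / 4 < -c₁ / 4 + 1 by linarith),
      hDpos] with r hr hk2 hg hd
    have hr0 := hr.1
    rw [hKD r hr]
    have e : D r / (2 * r * k r) = D r / r / (2 * k r) := by field_simp
    rw [e]
    have hq : 0 < D r / r := div_pos hd hr0
    exact div_le_div₀ (by linarith) hg.le hk0 (by linarith)
  · rcases expansion_cases hDpos e1 e2 with ⟨hle, hcase⟩ | hflat
    · left
      refine ⟨?_, ?_⟩
      · filter_upwards [hev, hle] with r hr hAD
        have hr0 := hr.1
        have hkp := hp.k_pos r hr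
        have hlt := hp.k_lt hr
        have e : 6 / 5 * (r * K r) = 6 / 5 * D r / (2 * k r) := by
          rw [hKD r hr]; field_simp
        rw [e, le_div_iff₀ (by positivity)]
        rw [hAk r hr] at hAD
        nlinarith
      · refine hcase.imp (fun hc => ?_) fun ⟨C, hC⟩ => ⟨C / k₀, ?_⟩
        · refine tendsto_atTop_mono' _ ?_ (hc.atTop_div_const (show 0 < 2 * k₀ by positivity))
          filter_upwards [hev] with r hr
          have hr0 := hr.1
          have hkp := hp.k_pos r hr
          have hd := h.density_gap_pos hr
          have e : K r / r ^ 2 = D r / r ^ 3 / (2 * k r) := by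
            rw [hKD r hr]; field_simp
          rw [e]
          have hlt := hp.k_lt hr
          have : 0 ≤ D r / r ^ 3 := div_nonneg hd.le (by positivity)
          gcongr
        · filter_upwards [hev, hhalf, hC, hDpos] with r hr hk2 hc hd
          have hr0 := hr.1
          rw [hKD r hr, div_le_iff₀ (by have := hp.k_pos r hr; positivity)]
          have hC0 : 0 < C * r ^ 3 := hd.trans_le hc
          have e : C / k₀ * r ^ 2 * (2 * r * k r) = C * r ^ 3 * (2 * k r / k₀) := by field_simp
          rw [e]
          refine hc.trans (le_mul_of_one_le_right hC0.le ?_)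
          rw [one_le_div hk0]; linarith
    · right
      intro δ hδ
      filter_upwards [hev, hflat (δ * k₀) (by positivity)] with r hr hle
      rw [hAk r hr] at hle
      have := hp.k_lt hr
      have := hp.k_pos r hr
      have h3 : (k₀ - k r) * k₀ ≤ (k₀ - k r) * (k₀ + k r) := by
        apply mul_le_mul_of_nonneg_left <;> linarith
      have h4 : (k₀ - k r) * k₀ ≤ (δ * r ^ 3) * k₀ := by linarith
      exact le_of_mul_le_mul_right h4 hk0

/-! ### The area radius and its derivatives in closed form -/

/-- `√(R / r) = (1 - t / t_c)^{1/3}`, where `t_c = 2 / (3 k)`. All derivatives of the area radius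
are rational functions of this root and of `r`, `t`, `k`, `K`. -/
noncomputable def root (k : ℝ → ℝ) (r t : ℝ) : ℝ := (1 - 3 / 2 * k r * t) ^ (1 / 3 : ℝ)

/-- The area radius `R`. -/
noncomputable def area (k : ℝ → ℝ) (r t : ℝ) : ℝ := r * root k r t ^ 2

/-- `∂R/∂r`. -/
noncomputable def areaR (k K : ℝ → ℝ) (r t : ℝ) : ℝ := root k r t ^ 2 + r * K r * t / root k r t

/-- `∂R/∂t`. -/
noncomputable def areaT (k : ℝ → ℝ) (r t : ℝ) : ℝ := -(k r * r / root k r t)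

/-- `∂²R/∂r∂t`. -/
noncomputable def areaRT (k K : ℝ → ℝ) (r t : ℝ) : ℝ :=
  -(k r - r * K r) / root k r t + r * k r * K r * t / (2 * root k r t ^ 4)

/-- `∂²R/∂r²`. -/
noncomputable def areaRR (k K : ℝ → ℝ) (r t : ℝ) : ℝ :=
  2 * K r * t / root k r t + r * deriv K r * t / root k r t
    - r * K r ^ 2 * t ^ 2 / (2 * root k r t ^ 4)

/-- `∂³R/∂r∂t²`. -/
noncomputable def areaRTT (k K : ℝ → ℝ) (r t : ℝ) : ℝ :=
  (r * k r ^ 2 * K r * t - k r ^ 2 * root k r t ^ 3 / 2 + r * k r * K r * root k r t ^ 3)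
    / root k r t ^ 7

section Root

variable {k : ℝ → ℝ} {r t : ℝ}

lemma root_pos (h : 0 < 1 - 3 / 2 * k r * t) : 0 < root k r t := Real.rpow_pos_of_pos h _

lemma root_cube (h : 0 < 1 - 3 / 2 * k r * t) : root k r t ^ 3 = 1 - 3 / 2 * k r * t := by
  rw [root, ← Real.rpow_natCast, ← Real.rpow_mul h.le]
  norm_num

lemma lt_iff_pos (hk : 0 < k r) : t < 2 / (3 * k r) ↔ 0 < 1 - 3 / 2 * k r * t := by
  rw [lt_div_iff₀ (by positivity)]
  constructor <;> intro h <;> linarith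

end Root

namespace Profile

variable {b k₀ : ℝ} {k K : ℝ → ℝ}

lemma hasDerivAt_root (hp : Profile b k₀ k K) {ρ τ : ℝ → ℝ} {ρ' τ' s : ℝ} (hρ : HasDerivAt ρ ρ' s)
    (hτ : HasDerivAt τ τ' s) (hr : ρ s ∈ Ioo 0 b) (h : 0 < 1 - 3 / 2 * k (ρ s) * τ s) :
    HasDerivAt (fun s => root k (ρ s) (τ s))
      ((K (ρ s) * τ s * ρ' - k (ρ s) * τ') / (2 * root k (ρ s) (τ s) ^ 2)) s := by
  have hk := ((hp.hasDerivAt _ hr).comp s hρ)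
  have hU : HasDerivAt (fun s => 1 - 3 / 2 * k (ρ s) * τ s)
      (-(3 / 2 * (-K (ρ s) * ρ') * τ s + 3 / 2 * k (ρ s) * τ')) s :=
    (((hk.const_mul (3 / 2)).mul hτ).const_sub 1)
  refine (hU.rpow_const (p := 1 / 3) (Or.inl h.ne')).congr_deriv ?_
  have hw := root_pos h
  have e : (1 - 3 / 2 * k (ρ s) * τ s) ^ ((1 : ℝ) / 3 - 1) = (root k (ρ s) (τ s) ^ 2)⁻¹ := by
    rw [root, ← Real.rpow_natCast, ← Real.rpow_mul h.le, ← Real.rpow_neg h.le]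
    norm_num
  rw [e]
  field_simp
  ring

lemma hasDerivAt_area (hp : Profile b k₀ k K) {ρ τ : ℝ → ℝ} {ρ' τ' s : ℝ} (hρ : HasDerivAt ρ ρ' s)
    (hτ : HasDerivAt τ τ' s) (hr : ρ s ∈ Ioo 0 b) (h : 0 < 1 - 3 / 2 * k (ρ s) * τ s) :
    HasDerivAt (fun s => area k (ρ s) (τ s))
      (areaR k K (ρ s) (τ s) * ρ' + areaT k (ρ s) (τ s) * τ') s := by
  have hw := root_pos h
  refine (hρ.mul ((hp.hasDerivAt_root hρ hτ hr h).pow 2)).congr_deriv ?_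
  simp only [areaR, areaT, Pi.pow_apply]
  field_simp
  ring

lemma hasDerivAt_areaR (hp : Profile b k₀ k K) {ρ τ : ℝ → ℝ} {ρ' τ' s : ℝ} (hρ : HasDerivAt ρ ρ' s)
    (hτ : HasDerivAt τ τ' s) (hr : ρ s ∈ Ioo 0 b) (h : 0 < 1 - 3 / 2 * k (ρ s) * τ s) :
    HasDerivAt (fun s => areaR k K (ρ s) (τ s))
      (areaRR k K (ρ s) (τ s) * ρ' + areaRT k K (ρ s) (τ s) * τ') s := by
  have hw := root_pos h
  have hw' := hp.hasDerivAt_root hρ hτ hr h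
  have hK : HasDerivAt K (deriv K (ρ s)) (ρ s) :=
    ((hp.contDiffOn.differentiableOn one_ne_zero).differentiableAt
      (Ioo_mem_nhds hr.1 hr.2)).hasDerivAt
  have hK' : HasDerivAt (fun s => K (ρ s)) (deriv K (ρ s) * ρ') s := hK.comp s hρ
  refine ((hw'.pow 2).add (((hρ.mul hK').mul hτ).div hw' hw.ne')).congr_deriv ?_
  simp only [areaRR, areaRT, Pi.mul_apply]
  field_simp
  ring

lemma hasDerivAt_areaRT (hp : Profile b k₀ k K) {r t : ℝ} (hr : r ∈ Ioo 0 b)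
    (h : 0 < 1 - 3 / 2 * k r * t) :
    HasDerivAt (fun t => areaRT k K r t) (areaRTT k K r t) t := by
  have hw := root_pos h
  have hw' := hp.hasDerivAt_root (hasDerivAt_const t r) (hasDerivAt_id t) hr h
  refine (((hasDerivAt_const t (-(k r - r * K r))).div hw' hw.ne').add
    (((hasDerivAt_id t).const_mul (r * k r * K r)).div ((hw'.pow 4).const_mul 2)
      (by simp only [Pi.pow_apply, id]; positivity))).congr_deriv ?_
  simp only [areaRTT, id, Pi.pow_apply]
  field_simp
  ring

lemma continuousOn_comp_root (hp : Profile b k₀ k K) {S : Set ℝ} {ρ τ : ℝ → ℝ}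
    (hρ : ContinuousOn ρ S)
    (hτ : ContinuousOn τ S) (hr : ∀ s ∈ S, ρ s ∈ Ioo 0 b)
    (h : ∀ s ∈ S, 0 < 1 - 3 / 2 * k (ρ s) * τ s) :
    ContinuousOn (fun s => root k (ρ s) (τ s)) S := by
  have hk : ContinuousOn (fun s => k (ρ s)) S := hp.continuousOn.comp hρ hr
  exact (continuousOn_const.sub ((continuousOn_const.mul hk).mul hτ)).rpow_const
    fun s hs => Or.inl (h s hs).ne'

lemma continuousOn_comp_derivs (hp : Profile b k₀ k K) {S : Set ℝ} {ρ τ : ℝ → ℝ}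
    (hρ : ContinuousOn ρ S)
    (hτ : ContinuousOn τ S) (hr : ∀ s ∈ S, ρ s ∈ Ioo 0 b)
    (h : ∀ s ∈ S, 0 < 1 - 3 / 2 * k (ρ s) * τ s) :
    ContinuousOn (fun s => areaT k (ρ s) (τ s)) S ∧
    ContinuousOn (fun s => areaR k K (ρ s) (τ s)) S ∧
    ContinuousOn (fun s => areaRT k K (ρ s) (τ s)) S ∧
    ContinuousOn (fun s => areaRR k K (ρ s) (τ s)) S := by
  have hk : ContinuousOn (fun s => k (ρ s)) S := hp.continuousOn.comp hρ hr
  have hK : ContinuousOn (fun s => K (ρ s)) S := hp.contDiffOn.continuousOn.comp hρ hr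
  have hK' : ContinuousOn (fun s => deriv K (ρ s)) S :=
    (hp.contDiffOn.continuousOn_deriv_of_isOpen isOpen_Ioo le_rfl).comp hρ hr
  have hw := hp.continuousOn_comp_root hρ hτ hr h
  have hw0 : ∀ s ∈ S, root k (ρ s) (τ s) ≠ 0 := fun s hs => (root_pos (h s hs)).ne'
  have hw4 : ∀ s ∈ S, 2 * root k (ρ s) (τ s) ^ 4 ≠ 0 := fun s hs =>
    mul_ne_zero two_ne_zero (pow_ne_zero _ (hw0 s hs))
  have c4 := continuousOn_const (c := (2 : ℝ)).mul (hw.pow 4)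
  refine ⟨((hk.mul hρ).div hw hw0).neg, (hw.pow 2).add (((hρ.mul hK).mul hτ).div hw hw0),
    ((hk.sub (hρ.mul hK)).neg.div hw hw0).add ((((hρ.mul hk).mul hK).mul hτ).div c4 hw4), ?_⟩
  exact ((((continuousOn_const.mul hK).mul hτ).div hw hw0).add
    (((hρ.mul hK').mul hτ).div hw hw0)).sub
    (((hρ.mul (hK.pow 2)).mul (hτ.pow 2)).div c4 hw4)

end Profile

namespace RegularData

variable {b : ℝ} {μ : ℝ → ℝ}

lemma before_iff (h : RegularData b μ) {r t : ℝ} (hr : r ∈ Ioo 0 b) :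
    t < collapseTime μ r ↔ 0 < 1 - 3 / 2 * shape μ r * t := by
  rw [h.collapseTime_eq hr, lt_iff_pos (h.shape_pos hr)]

lemma R_eq (h : RegularData b μ) {r t : ℝ} (hr : r ∈ Ioo 0 b)
    (ht : 0 < 1 - 3 / 2 * shape μ r * t) : R μ r t = area (shape μ) r t := by
  have hw := root_pos ht
  have hk := h.shape_pos hr
  have hr0 := hr.1
  have hm : mass μ r = shape μ r ^ 2 * r ^ 3 := by rw [h.shape_sq hr]; field_simp
  have e : 9 / 4 * mass μ r * (collapseTime μ r - t) ^ 2 = area (shape μ) r t ^ 3 := by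
    have e2 : area (shape μ) r t ^ 3 = r ^ 3 * (root (shape μ) r t ^ 3) ^ 2 := by
      rw [area]; ring
    rw [e2, root_cube ht, hm, h.collapseTime_eq hr]
    field_simp
    ring
  have ha : 0 < area (shape μ) r t := mul_pos hr0 (pow_pos hw 2)
  rw [R, e, ← Real.rpow_natCast, ← Real.rpow_mul ha.le]
  norm_num

lemma eventually_inside (h : RegularData b μ) {r t : ℝ} (hr : r ∈ Ioo 0 b)
    (ht : 0 < 1 - 3 / 2 * shape μ r * t) :
    (∀ᶠ x in 𝓝 r, x ∈ Ioo 0 b ∧ 0 < 1 - 3 / 2 * shape μ x * t) ∧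
      ∀ᶠ τ in 𝓝 t, 0 < 1 - 3 / 2 * shape μ r * τ := by
  have hc : ContinuousAt (fun x => 1 - 3 / 2 * shape μ x * t) r := by
    have := (h.hasDerivAt_shape hr).continuousAt
    fun_prop
  have hc' : ContinuousAt (fun τ => 1 - 3 / 2 * shape μ r * τ) t := by fun_prop
  have hev : ∀ᶠ x in 𝓝 r, x ∈ Ioo 0 b := Ioo_mem_nhds hr.1 hr.2
  exact ⟨hev.and (hc.eventually_const_lt ht),
    hc'.eventually_const_lt ht⟩

lemma Rr_eq (h : RegularData b μ) {r t : ℝ} (hr : r ∈ Ioo 0 b)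
    (ht : 0 < 1 - 3 / 2 * shape μ r * t) : Rr μ r t = areaR (shape μ) (shapeSlope μ) r t := by
  have hd := h.profile.hasDerivAt_area (hasDerivAt_id r) (hasDerivAt_const r t) hr ht
  simp only [id, mul_one, mul_zero, add_zero] at hd
  refine HasDerivAt.deriv (hd.congr_of_eventuallyEq ?_)
  filter_upwards [(h.eventually_inside hr ht).1] with x hx using h.R_eq hx.1 hx.2

lemma Rt_eq (h : RegularData b μ) {r t : ℝ} (hr : r ∈ Ioo 0 b)
    (ht : 0 < 1 - 3 / 2 * shape μ r * t) : Rt μ r t = areaT (shape μ) r t := by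
  have hd := h.profile.hasDerivAt_area (hasDerivAt_const t r) (hasDerivAt_id t) hr ht
  simp only [id, mul_one, mul_zero, zero_add] at hd
  refine HasDerivAt.deriv (hd.congr_of_eventuallyEq ?_)
  filter_upwards [(h.eventually_inside hr ht).2] with x hx using h.R_eq hr hx

lemma Rrr_eq (h : RegularData b μ) {r t : ℝ} (hr : r ∈ Ioo 0 b)
    (ht : 0 < 1 - 3 / 2 * shape μ r * t) :
    Rrr μ r t = areaRR (shape μ) (shapeSlope μ) r t := by
  have hd := h.profile.hasDerivAt_areaR (hasDerivAt_id r) (hasDerivAt_const r t) hr ht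
  simp only [id, mul_one, mul_zero, add_zero] at hd
  refine HasDerivAt.deriv (hd.congr_of_eventuallyEq ?_)
  filter_upwards [(h.eventually_inside hr ht).1] with x hx using h.Rr_eq hx.1 hx.2

lemma Rrt_eq (h : RegularData b μ) {r t : ℝ} (hr : r ∈ Ioo 0 b)
    (ht : 0 < 1 - 3 / 2 * shape μ r * t) :
    Rrt μ r t = areaRT (shape μ) (shapeSlope μ) r t := by
  have hd := h.profile.hasDerivAt_areaR (hasDerivAt_const t r) (hasDerivAt_id t) hr ht
  simp only [id, mul_one, mul_zero, zero_add] at hd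
  refine HasDerivAt.deriv (hd.congr_of_eventuallyEq ?_)
  filter_upwards [(h.eventually_inside hr ht).2] with x hx using h.Rr_eq hr hx

end RegularData

/-! ### From solutions of the geodesic system in `r` to geodesics -/

lemma contDiffOn_two_of_hasDerivAt {f g g' : ℝ → ℝ} {ε : ℝ}
    (hf : ∀ s ∈ Ioo 0 ε, HasDerivAt f (g s) s) (hg : ∀ s ∈ Ioo 0 ε, HasDerivAt g (g' s) s)
    (hg' : ContinuousOn g' (Ioo 0 ε)) :
    ContDiffOn ℝ 2 f (Ioo 0 ε) ∧ (∀ s ∈ Ioo 0 ε, deriv f s = g s) ∧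
      ∀ s ∈ Ioo 0 ε, deriv (deriv f) s = g' s := by
  have h1 : ∀ s ∈ Ioo 0 ε, deriv f s = g s := fun s hs => (hf s hs).deriv
  have h2 : ∀ s ∈ Ioo 0 ε, HasDerivAt (deriv f) (g' s) s := fun s hs => by
    refine (hg s hs).congr_of_eventuallyEq ?_
    filter_upwards [Ioo_mem_nhds hs.1 hs.2] with z hz using h1 z hz
  have h3 : ∀ s ∈ Ioo 0 ε, deriv (deriv f) s = g' s := fun s hs => (h2 s hs).deriv
  refine ⟨?_, h1, h3⟩
  rw [show (2 : WithTop ℕ∞) = 1 + 1 by norm_num, contDiffOn_succ_iff_deriv_of_isOpen isOpen_Ioo]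
  refine ⟨fun s hs => (hf s hs).differentiableAt.differentiableWithinAt, by simp, ?_⟩
  rw [show (1 : WithTop ℕ∞) = 0 + 1 by norm_num, contDiffOn_succ_iff_deriv_of_isOpen isOpen_Ioo]
  refine ⟨fun s hs => (h2 s hs).differentiableAt.differentiableWithinAt, by simp, ?_⟩
  rw [contDiffOn_zero]
  exact hg'.congr h3

lemma integrableOn_deriv_of_tendsto {f : ℝ → ℝ} {ε ε' l : ℝ} (hε : ε < ε')
    (hf : ∀ s ∈ Ioo 0 ε', DifferentiableAt ℝ f s) (h0 : ∀ s ∈ Ioo 0 ε', 0 ≤ deriv f s)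
    (hl : Tendsto f (𝓝[>] 0) (𝓝 l)) : IntegrableOn (deriv f) (Ioo 0 ε) := by
  rw [← integrableOn_Ioc_iff_integrableOn_Ioo]
  refine intervalIntegral.integrableOn_deriv_of_nonneg (g := Function.update f 0 l) ?_ ?_
    (fun s hs => h0 s ⟨hs.1, hs.2.trans hε⟩)
  · intro s hs
    rcases hs.1.eq_or_lt with rfl | hs0
    · rw [continuousWithinAt_update_same]
      refine hl.mono_left (nhdsWithin_mono _ fun x hx => ?_)
      exact lt_of_le_of_ne hx.1.1 (Ne.symm hx.2)
    · have hd := (hf s ⟨hs0, hs.2.trans_lt hε⟩).continuousAt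
      refine (hd.congr ?_).continuousWithinAt
      filter_upwards [Ioi_mem_nhds hs0] with x hx
      rw [Function.update_of_ne (ne_of_gt hx)]
  · intro s hs
    refine (hf s ⟨hs.1, hs.2.trans hε⟩).hasDerivAt.congr_of_eventuallyEq ?_
    filter_upwards [Ioi_mem_nhds hs.1] with x hx
    rw [Function.update_of_ne (ne_of_gt hx)]

/-- The square `L² / (R q)²` of the ratio of angular to radial velocity of a null geodesic with
angular momentum `L` and radial momentum `q = R_r dr/ds = exp Q`. -/
noncomputable def angular (k : ℝ → ℝ) (L r t Q : ℝ) : ℝ :=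
  L ^ 2 * Real.exp (-2 * Q) / area k r t ^ 2

/-- A solution `t = x(r)`, `q = exp Q(r)` on `(0, r₁)` of the null geodesic equations, with `r` as
parameter and `q = R_r dr/ds`, is an emanating null geodesic when reparametrized by `s`, provided
that `ds/dr = R_r / q` is bounded. -/
theorem RegularData.existsEmanating_of_solution {b : ℝ} {μ : ℝ → ℝ} (h : RegularData b μ)
    {L r₁ C : ℝ} {x Q : ℝ → ℝ} (hr₁ : 0 < r₁) (hr₁b : r₁ ≤ b)
    (hx : ∀ r ∈ Ioo 0 r₁, HasDerivAt x (areaR (shape μ) (shapeSlope μ) r (x r) *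
      √(1 + angular (shape μ) L r (x r) (Q r))) r)
    (hQ : ∀ r ∈ Ioo 0 r₁, HasDerivAt Q (angular (shape μ) L r (x r) (Q r) *
      areaR (shape μ) (shapeSlope μ) r (x r) / area (shape μ) r (x r) -
      areaRT (shape μ) (shapeSlope μ) r (x r) * √(1 + angular (shape μ) L r (x r) (Q r))) r)
    (ht : ∀ r ∈ Ioo 0 r₁, singularTime μ ≤ x r ∧ x r < collapseTime μ r)
    (hC : ∀ r ∈ Ioo 0 r₁, areaR (shape μ) (shapeSlope μ) r (x r) * Real.exp (-Q r) ≤ C) :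
    ExistsEmanating b μ L := by
  have hp := h.profile
  set k := shape μ with hk
  set K := shapeSlope μ with hK
  have hsub : ∀ r ∈ Ioo 0 r₁, r ∈ Ioo 0 b := fun r hr => ⟨hr.1, hr.2.trans_le hr₁b⟩
  have hU : ∀ r ∈ Ioo 0 r₁, 0 < 1 - 3 / 2 * k r * x r := fun r hr =>
    (h.before_iff (hsub r hr)).1 (ht r hr).2
  have ht₀ : 0 < singularTime μ := by
    have := hp.k₀_pos
    unfold singularTime; positivity
  have hA : ∀ r ∈ Ioo 0 r₁, 0 < areaR k K r (x r) := fun r hr => by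
    have := root_pos (hU r hr)
    have := hp.K_pos r (hsub r hr)
    have := hr.1
    have := ht₀.trans_le (ht r hr).1
    unfold areaR; positivity
  have hB : ∀ r ∈ Ioo 0 r₁, 0 < area k r (x r) := fun r hr =>
    mul_pos hr.1 (pow_pos (root_pos (hU r hr)) 2)
  have hxc : ContinuousOn x (Ioo 0 r₁) := fun r hr => (hx r hr).continuousAt.continuousWithinAt
  have hQc : ContinuousOn Q (Ioo 0 r₁) := fun r hr => (hQ r hr).continuousAt.continuousWithinAt
  have hAc := (hp.continuousOn_comp_derivs continuousOn_id hxc hsub hU).2.1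
  obtain ⟨ε', hε', ρ, hρ, hρ0⟩ := exists_reparametrization
    (f := fun r => areaR k K r (x r) * Real.exp (-Q r)) hr₁
    (hAc.mul (Real.continuous_exp.comp_continuousOn hQc.neg))
    (fun r hr => mul_pos (hA r hr) (Real.exp_pos _)) hC
  set τ : ℝ → ℝ := fun s => x (ρ s) with hτ
  set q : ℝ → ℝ := fun s => Real.exp (Q (ρ s)) with hq
  set A : ℝ → ℝ := fun s => areaR k K (ρ s) (τ s) with hAdef
  set B : ℝ → ℝ := fun s => area k (ρ s) (τ s) with hBdef
  set T : ℝ → ℝ := fun s => areaT k (ρ s) (τ s) with hTdef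
  set RT : ℝ → ℝ := fun s => areaRT k K (ρ s) (τ s) with hRTdef
  set RR : ℝ → ℝ := fun s => areaRR k K (ρ s) (τ s) with hRRdef
  set p : ℝ → ℝ := fun s => √(q s ^ 2 + L ^ 2 / B s ^ 2) with hpdef
  have hρm : ∀ s ∈ Ioo 0 ε', ρ s ∈ Ioo 0 r₁ := fun s hs => (hρ s hs).1
  have hρb : ∀ s ∈ Ioo 0 ε', ρ s ∈ Ioo 0 b := fun s hs => hsub _ (hρm s hs)
  have hUs : ∀ s ∈ Ioo 0 ε', 0 < 1 - 3 / 2 * k (ρ s) * τ s := fun s hs => hU _ (hρm s hs)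
  have hA0 : ∀ s ∈ Ioo 0 ε', 0 < A s := fun s hs => hA _ (hρm s hs)
  have hB0 : ∀ s ∈ Ioo 0 ε', 0 < B s := fun s hs => hB _ (hρm s hs)
  have hq0 : ∀ s, 0 < q s := fun s => Real.exp_pos _
  have hp0 : ∀ s, 0 < p s := fun s => Real.sqrt_pos.2 (by have := hq0 s; positivity)
  have hp2 : ∀ s, p s ^ 2 = q s ^ 2 + L ^ 2 / B s ^ 2 := fun s =>
    Real.sq_sqrt (by have := hq0 s; positivity)
  -- the derivatives with respect to `s`
  have hdρ : ∀ s ∈ Ioo 0 ε', HasDerivAt ρ (q s / A s) s := fun s hs =>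
    (hρ s hs).2.congr_deriv (by
      simp only [hq, hAdef, hτ, Real.exp_neg]; rw [mul_inv, inv_inv, div_eq_mul_inv, mul_comm])
  have hangE : ∀ s, q s ^ 2 * angular k L (ρ s) (τ s) (Q (ρ s)) = L ^ 2 / B s ^ 2 := fun s => by
    simp only [hq, angular, hBdef]
    rw [show -2 * Q (ρ s) = -(Q (ρ s) + Q (ρ s)) by ring, Real.exp_neg, Real.exp_add]
    have := Real.exp_pos (Q (ρ s))
    field_simp
  have hpE : ∀ s, q s * √(1 + angular k L (ρ s) (τ s) (Q (ρ s))) = p s := fun s => by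
    simp only [hpdef]
    rw [← hangE s, ← Real.sqrt_sq (hq0 s).le, ← Real.sqrt_mul (sq_nonneg _),
      Real.sqrt_sq (hq0 s).le]
    congr 1; ring
  have hdτ : ∀ s ∈ Ioo 0 ε', HasDerivAt τ (p s) s := fun s hs => by
    refine ((hx _ (hρm s hs)).comp s (hdρ s hs)).congr_deriv ?_
    have := (hA0 s hs).ne'
    rw [← hpE s]
    change A s * _ * (q s / A s) = _
    field_simp
    exact mul_comm _ _
  have hdB : ∀ s ∈ Ioo 0 ε', HasDerivAt B (q s + T s * p s) s := fun s hs => by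
    refine (hp.hasDerivAt_area (hdρ s hs) (hdτ s hs) (hρb s hs) (hUs s hs)).congr_deriv ?_
    change A s * (q s / A s) + T s * p s = _
    have := (hA0 s hs).ne'
    field_simp
  have hdA : ∀ s ∈ Ioo 0 ε', HasDerivAt A (RR s * (q s / A s) + RT s * p s) s := fun s hs =>
    hp.hasDerivAt_areaR (hdρ s hs) (hdτ s hs) (hρb s hs) (hUs s hs)
  have hdq : ∀ s ∈ Ioo 0 ε', HasDerivAt q (L ^ 2 / B s ^ 3 - RT s * p s * (q s / A s)) s :=
    fun s hs => by
    refine ((hQ _ (hρm s hs)).comp s (hdρ s hs)).exp.congr_deriv ?_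
    have ha := (hA0 s hs).ne'
    have hb := (hB0 s hs).ne'
    have e1 := hangE s
    have e2 := hpE s
    simp only [Function.comp_apply]
    change q s * ((angular k L (ρ s) (τ s) (Q (ρ s)) * A s / B s -
      RT s * √(1 + angular k L (ρ s) (τ s) (Q (ρ s)))) * (q s / A s)) = _
    rw [← e2, show L ^ 2 / B s ^ 3 = L ^ 2 / B s ^ 2 / B s by field_simp, ← e1]
    field_simp
  have hdp : ∀ s ∈ Ioo 0 ε', HasDerivAt p
      (-(RT s / A s * q s ^ 2) - L ^ 2 / B s ^ 2 * (T s / B s)) s := fun s hs => by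
    have ha := (hA0 s hs).ne'
    have hb := (hB0 s hs).ne'
    have hpp := (hp0 s).ne'
    have hL : HasDerivAt (fun s => L ^ 2 / B s ^ 2)
        (-(2 * L ^ 2 * (q s + T s * p s)) / B s ^ 3) s := by
      refine ((hasDerivAt_const s (L ^ 2)).div ((hdB s hs).pow 2)
        (pow_ne_zero _ hb)).congr_deriv ?_
      simp only [Pi.pow_apply]
      field_simp
      ring
    refine ((((hdq s hs).pow 2).add hL).sqrt
      (by simp only [Pi.pow_apply, Pi.add_apply]; have := hq0 s; positivity)).congr_deriv ?_
    change _ / (2 * p s) = _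
    rw [div_eq_iff (by positivity)]
    field_simp
    ring
  have hdρ2 : ∀ s ∈ Ioo 0 ε', HasDerivAt (fun s => q s / A s)
      (((L ^ 2 / B s ^ 3 - RT s * p s * (q s / A s)) * A s -
        q s * (RR s * (q s / A s) + RT s * p s)) / A s ^ 2) s := fun s hs =>
    (hdq s hs).div (hdA s hs) (hA0 s hs).ne'
  -- everything is continuous
  have cont : ∀ {f g : ℝ → ℝ}, (∀ s ∈ Ioo 0 ε', HasDerivAt f (g s) s) →
      ContinuousOn f (Ioo 0 ε') := fun hf s hs => (hf s hs).continuousAt.continuousWithinAt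
  have cρ := cont hdρ
  have cτ := cont hdτ
  have cq := cont hdq
  have cA := cont hdA
  have cB := cont hdB
  have cp := cont hdp
  obtain ⟨cT, -, cRT, cRR⟩ := hp.continuousOn_comp_derivs cρ cτ hρb hUs
  have hAne : ∀ s ∈ Ioo 0 ε', A s ≠ 0 := fun s hs => (hA0 s hs).ne'
  have hBne : ∀ s ∈ Ioo 0 ε', B s ≠ 0 := fun s hs => (hB0 s hs).ne'
  have cqA := cq.div cA hAne
  have cLB : ∀ n, ContinuousOn (fun s => L ^ 2 / B s ^ n) (Ioo 0 ε') := fun n =>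
    continuousOn_const.div (cB.pow n) fun s hs => pow_ne_zero _ (hBne s hs)
  -- the azimuth
  set φ : ℝ → ℝ := fun s => ∫ z in (ε' / 2)..s, L / B z ^ 2 with hφ
  have cφ : ContinuousOn (fun s => L / B s ^ 2) (Ioo 0 ε') :=
    continuousOn_const.div (cB.pow 2) fun s hs => pow_ne_zero _ (hBne s hs)
  have hdφ : ∀ s ∈ Ioo 0 ε', HasDerivAt φ (L / B s ^ 2) s := fun s hs => by
    refine intervalIntegral.integral_hasDerivAt_right (f := fun s => L / B s ^ 2) ?_
      (cφ.stronglyMeasurableAtFilter isOpen_Ioo s hs) (cφ.continuousAt (Ioo_mem_nhds hs.1 hs.2))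
    refine (cφ.mono ?_).intervalIntegrable
    exact ordConnected_Ioo.uIcc_subset ⟨by linarith, by linarith⟩ hs
  have hdφ2 : ∀ s ∈ Ioo 0 ε', HasDerivAt (fun s => L / B s ^ 2)
      (-(2 * L * (q s + T s * p s)) / B s ^ 3) s := fun s hs => by
    have hb := hBne s hs
    refine ((hasDerivAt_const s L).div ((hdB s hs).pow 2) (pow_ne_zero _ hb)).congr_deriv ?_
    simp only [Pi.pow_apply]
    field_simp
    ring
  obtain ⟨sρ, dρ, ddρ⟩ := contDiffOn_two_of_hasDerivAt hdρ hdρ2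
    ((((cLB 3).sub ((cRT.mul cp).mul cqA)).mul cA).sub (cq.mul ((cRR.mul cqA).add (cRT.mul cp)))
      |>.div (cA.pow 2) fun s hs => pow_ne_zero _ (hAne s hs))
  obtain ⟨sτ, dτ, ddτ⟩ := contDiffOn_two_of_hasDerivAt hdτ hdp
    (((cRT.div cA hAne).mul (cq.pow 2)).neg.sub ((cLB 2).mul (cT.div cB hBne)))
  obtain ⟨sφ, dφ, -⟩ := contDiffOn_two_of_hasDerivAt hdφ hdφ2
    ((continuousOn_const.mul (cq.add (cT.mul cp))).neg.div (cB.pow 3)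
      fun s hs => pow_ne_zero _ (hBne s hs))
  have hρ0' : Tendsto ρ (𝓝[>] 0) (𝓝[>] 0) := by
    refine tendsto_nhdsWithin_iff.2 ⟨hρ0, ?_⟩
    filter_upwards [Ioo_mem_nhdsGT hε'] with s hs using (hρm s hs).1
  have hx0 : Tendsto x (𝓝[>] 0) (𝓝 (singularTime μ)) := by
    have hc : Tendsto (fun r => 2 / 3 * (k r)⁻¹) (𝓝[>] 0) (𝓝 (singularTime μ)) :=
      (hp.tendsto.inv₀ hp.k₀_pos.ne').const_mul _
    refine tendsto_of_tendsto_of_tendsto_of_le_of_le' tendsto_const_nhds hc ?_ ?_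
    · filter_upwards [Ioo_mem_nhdsGT hr₁] with r hr using (ht r hr).1
    · filter_upwards [Ioo_mem_nhdsGT hr₁] with r hr
      refine (ht r hr).2.le.trans_eq ?_
      have hkp := hp.k_pos r (hsub r hr)
      rw [h.collapseTime_eq (hsub r hr)]
      change 2 / (3 * k r) = _
      field_simp
  have hτ0 : Tendsto τ (𝓝[>] 0) (𝓝 (singularTime μ)) := hx0.comp hρ0'
  have hin : Ioo 0 (ε' / 2) ⊆ Ioo 0 ε' := Ioo_subset_Ioo_right (by linarith)
  refine ⟨ε' / 2, τ, ρ, φ, ?_⟩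
  exact
    { eps_pos := by linarith
      smooth_t := sτ.mono hin
      smooth_r := sρ.mono hin
      smooth_φ := sφ.mono hin
      inside := fun s hs => ⟨(hρb s (hin hs)).1, (hρb s (hin hs)).2,
        ht₀.le.trans (ht _ (hρm s (hin hs))).1, (ht _ (hρm s (hin hs))).2⟩
      angular_momentum := fun s hs => by
        have hb := hBne s (hin hs)
        rw [h.R_eq (hρb s (hin hs)) (hUs s (hin hs)), dφ s (hin hs)]
        change B s ^ 2 * _ = _
        field_simp
      geodesic_t := fun s hs => by
        have ha := hAne s (hin hs)
        have hb := hBne s (hin hs)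
        rw [h.R_eq (hρb s (hin hs)) (hUs s (hin hs)), h.Rr_eq (hρb s (hin hs)) (hUs s (hin hs)),
          h.Rt_eq (hρb s (hin hs)) (hUs s (hin hs)), h.Rrt_eq (hρb s (hin hs)) (hUs s (hin hs)),
          ddτ s (hin hs), dτ s (hin hs), hp2 s]
        change -(RT s / A s * q s ^ 2) - L ^ 2 / B s ^ 2 * (T s / B s) +
          RT s / A s * (q s ^ 2 + L ^ 2 / B s ^ 2) +
          L ^ 2 / B s ^ 2 * (T s / B s - RT s / A s) = 0
        ring
      geodesic_r := fun s hs => by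
        have ha := hAne s (hin hs)
        have hb := hBne s (hin hs)
        rw [h.R_eq (hρb s (hin hs)) (hUs s (hin hs)), h.Rr_eq (hρb s (hin hs)) (hUs s (hin hs)),
          h.Rrr_eq (hρb s (hin hs)) (hUs s (hin hs)), h.Rrt_eq (hρb s (hin hs)) (hUs s (hin hs)),
          ddρ s (hin hs), dρ s (hin hs), dτ s (hin hs)]
        change A s * (((L ^ 2 / B s ^ 3 - RT s * p s * (q s / A s)) * A s -
          q s * (RR s * (q s / A s) + RT s * p s)) / A s ^ 2) + RR s * (q s / A s) ^ 2 +
          2 * RT s * (q s / A s) * p s - L ^ 2 / B s ^ 3 = 0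
        field_simp
        ring
      null := fun s hs => by
        have ha := hAne s (hin hs)
        rw [h.R_eq (hρb s (hin hs)) (hUs s (hin hs)), h.Rr_eq (hρb s (hin hs)) (hUs s (hin hs)),
          dρ s (hin hs), dτ s (hin hs), hp2 s]
        change -(q s ^ 2 + L ^ 2 / B s ^ 2) + (A s * (q s / A s)) ^ 2 + L ^ 2 / B s ^ 2 = 0
        rw [mul_div_cancel₀ _ ha]
        ring
      future := fun s hs => by rw [dτ s (hin hs)]; exact (hp0 s).le
      integrable_t := integrableOn_deriv_of_tendsto (show ε' / 2 < ε' by linarith)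
        (fun s hs => (hdτ s hs).differentiableAt)
        (fun s hs => by rw [dτ s hs]; exact (hp0 s).le) hτ0
      integrable_r := integrableOn_deriv_of_tendsto (show ε' / 2 < ε' by linarith)
        (fun s hs => (hdρ s hs).differentiableAt)
        (fun s hs => by rw [dρ s hs]; exact (div_pos (hq0 s) (hA0 s hs)).le) hρ0
      tendsto_r := hρ0
      tendsto_t := hτ0 }

/-! ### Radial rays -/

/-- The time at which `√(R / r) = η r` on the shell `r`. -/
noncomputable def level (k : ℝ → ℝ) (η r : ℝ) : ℝ := 2 / (3 * k r) * (1 - η ^ 3 * r ^ 3)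

section Level

variable {k : ℝ → ℝ} {η r t : ℝ}

lemma le_level_iff (hk : 0 < k r) : t ≤ level k η r ↔ (η * r) ^ 3 ≤ 1 - 3 / 2 * k r * t := by
  rw [level, div_mul_eq_mul_div, le_div_iff₀ (by positivity), mul_pow]
  constructor <;> intro h <;> linarith

lemma lt_level_iff (hk : 0 < k r) : t < level k η r ↔ (η * r) ^ 3 < 1 - 3 / 2 * k r * t := by
  rw [level, div_mul_eq_mul_div, lt_div_iff₀ (by positivity), mul_pow]
  constructor <;> intro h <;> linarith

lemma pos_of_le_level (hk : 0 < k r) (hη : 0 < η) (hr : 0 < r) (h : t ≤ level k η r) :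
    0 < 1 - 3 / 2 * k r * t :=
  (by positivity : 0 < (η * r) ^ 3).trans_le ((le_level_iff hk).1 h)

lemma le_root (hk : 0 < k r) (hη : 0 < η) (hr : 0 < r) (h : t ≤ level k η r) :
    η * r ≤ root k r t := by
  have hU := pos_of_le_level hk hη hr h
  refine le_of_pow_le_pow_left₀ three_ne_zero (root_pos hU).le ?_
  rw [root_cube hU]
  exact (le_level_iff hk).1 h

lemma root_level (hk : 0 < k r) (hη : 0 < η) (hr : 0 < r) : root k r (level k η r) = η * r := by
  have hU := pos_of_le_level hk hη hr le_rfl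
  refine (pow_left_inj₀ (root_pos hU).le (by positivity) three_ne_zero).1 ?_
  rw [root_cube hU, level]
  field_simp
  ring

lemma root_le_root {t' : ℝ} (hk : 0 < k r) (h : 0 < 1 - 3 / 2 * k r * t') (ht : t ≤ t') :
    root k r t' ≤ root k r t := by
  refine Real.rpow_le_rpow h.le ?_ (by norm_num)
  have : k r * t ≤ k r * t' := by gcongr
  linarith

end Level

namespace Profile

variable {b k₀ : ℝ} {k K : ℝ → ℝ}

lemma hasDerivAt_level (hp : Profile b k₀ k K) (η : ℝ) {r : ℝ} (hr : r ∈ Ioo 0 b) :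
    HasDerivAt (level k η) ((K r * level k η r - 2 * η ^ 3 * r ^ 2) / k r) r := by
  have hk := (hp.k_pos r hr).ne'
  have h1 : HasDerivAt (fun r => 2 / 3 * (k r)⁻¹ * (1 - η ^ 3 * r ^ 3)) _ r :=
    (((hp.hasDerivAt r hr).inv hk).const_mul (2 / 3)).mul
      (((hasDerivAt_pow 3 r).const_mul (η ^ 3)).const_sub 1)
  have e : level k η = fun r => 2 / 3 * (k r)⁻¹ * (1 - η ^ 3 * r ^ 3) := by
    funext r
    rw [level, ← div_div, div_eq_mul_inv (2 / 3)]
  rw [e]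
  refine h1.congr_deriv ?_
  rw [Pi.inv_apply]
  push_cast
  field_simp
  ring

lemma continuousOn_level (hp : Profile b k₀ k K) (η : ℝ) : ContinuousOn (level k η) (Ioo 0 b) :=
  fun _ hr => (hp.hasDerivAt_level η hr).continuousAt.continuousWithinAt

lemma tendsto_level (hp : Profile b k₀ k K) (η : ℝ) :
    Tendsto (level k η) (𝓝[>] 0) (𝓝 (2 / (3 * k₀))) := by
  have hid : Tendsto (fun r : ℝ => r) (𝓝[>] 0) (𝓝 0) :=
    tendsto_nhdsWithin_of_tendsto_nhds tendsto_id
  have := ((tendsto_const_nhds (x := (2 : ℝ))).div (hp.tendsto.const_mul 3)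
    (by have := hp.k₀_pos; positivity)).mul
    ((tendsto_const_nhds (x := (1 : ℝ))).sub ((hid.pow 3).const_mul (η ^ 3)))
  change Tendsto (fun r => 2 / (3 * k r) * (1 - η ^ 3 * r ^ 3)) _ _
  simpa using this

lemma areaR_pos (hp : Profile b k₀ k K) {r t : ℝ} (hr : r ∈ Ioo 0 b) (ht : 0 ≤ t)
    (hU : 0 < 1 - 3 / 2 * k r * t) : 0 < areaR k K r t := by
  have := root_pos hU
  have := hp.K_pos r hr
  have := hr.1
  unfold areaR; positivity

/-- The radial rays are steeper than `level k η` where they meet it, if `η ≤ k r`: with increasing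
`r` a ray can leave the region before `level k η` but not enter it. -/
lemma deriv_level_lt (hp : Profile b k₀ k K) {η r : ℝ} (hr : r ∈ Ioo 0 b) (hη : 0 < η)
    (hηk : η ≤ k r) (ht : 0 ≤ level k η r) :
    (K r * level k η r - 2 * η ^ 3 * r ^ 2) / k r < areaR k K r (level k η r) := by
  have hr0 := hr.1
  have hk := hp.k_pos r hr
  have hK := hp.K_pos r hr
  rw [areaR, root_level hk hη hr0, div_lt_iff₀ hk]
  have e : r * K r * level k η r / (η * r) = K r * level k η r / η := by field_simp
  rw [e, add_mul]
  have h1 : K r * level k η r ≤ K r * level k η r / η * k r := by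
    rw [div_mul_eq_mul_div, le_div_iff₀ hη]
    gcongr
  have h2 : 0 < 2 * η ^ 3 * r ^ 2 := by positivity
  have h3 : 0 ≤ (η * r) ^ 2 * k r := by positivity
  linarith

/-! Restricted to times between `lo` and `level k η`, the metric functions are tame. -/

/-- The retraction to times between `lo r` and `level k η r`. -/
noncomputable def _root_.DustCollapse.cut (k lo : ℝ → ℝ) (η r x : ℝ) : ℝ :=
  min (level k η r) (max (lo r) x)

lemma tame_root (hp : Profile b k₀ k K) {η : ℝ} (hη : 0 < η) {lo : ℝ → ℝ}
    (hlo : ContinuousOn lo (Ioo 0 b)) : IsTame b (fun r x => root k r (cut k lo η r x)) := by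
  have h1 : IsTame b (cut k lo η) := IsTame.clamp hlo (hp.continuousOn_level η)
  have h2 : IsTame b (fun r x => 1 - 3 / 2 * k r * cut k lo η r x) :=
    (IsTame.of_continuousOn continuousOn_const).sub
      (IsTame.const_mul (continuousOn_const.mul hp.continuousOn) h1)
  refine h2.comp (δ := fun r => (η * r) ^ 3) (by fun_prop)
    (fun r hr => by have := hr.1; positivity) (fun r hr x => ?_) (φ := fun u => u ^ (1 / 3 : ℝ)) ?_
  · exact (le_level_iff (hp.k_pos r hr)).1 (min_le_left _ _)
  · exact contDiffOn_id.rpow_const_of_ne fun u hu => (ne_of_gt hu)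

lemma tame_inv_root (hp : Profile b k₀ k K) {η : ℝ} (hη : 0 < η) {lo : ℝ → ℝ}
    (hlo : ContinuousOn lo (Ioo 0 b)) : IsTame b (fun r x => (root k r (cut k lo η r x))⁻¹) :=
  (hp.tame_root hη hlo).comp (δ := fun r => η * r) (by fun_prop)
    (fun r hr => mul_pos hη hr.1)
    (fun r hr _ => le_root (hp.k_pos r hr) hη hr.1 (min_le_left _ _))
    (contDiffOn_inv ℝ |>.mono fun u hu => ne_of_gt hu)

lemma tame_areaR (hp : Profile b k₀ k K) {η : ℝ} (hη : 0 < η) {lo : ℝ → ℝ}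
    (hlo : ContinuousOn lo (Ioo 0 b)) : IsTame b (fun r x => areaR k K r (cut k lo η r x)) := by
  have hw := hp.tame_root hη hlo
  have h1 : IsTame b (cut k lo η) := IsTame.clamp hlo (hp.continuousOn_level η)
  have h2 := (hw.mul hw).add ((IsTame.const_mul (continuousOn_id.mul hp.contDiffOn.continuousOn)
    h1).mul (hp.tame_inv_root hη hlo))
  refine cast (congrArg (IsTame b) ?_) h2
  funext r x
  simp only [areaR, div_eq_mul_inv, sq, Pi.mul_apply, id]

/-- The radial null rays through the points before `level k η`, for the equation in which `t` is
kept above `lo`. -/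
lemma exists_cut_ray (hp : Profile b k₀ k K) {η : ℝ} (hη : 0 < η) (hηk : ∀ r ∈ Ioo 0 b, η ≤ k r)
    (hlev : ∀ r ∈ Ioo 0 b, 0 ≤ level k η r)
    {lo : ℝ → ℝ} (hlo : ContinuousOn lo (Ioo 0 b)) {r₁ x₁ : ℝ} (hr₁ : r₁ ∈ Ioo 0 b)
    (hx₁ : x₁ < level k η r₁) :
    ∃ u : ℝ → ℝ, u r₁ = x₁ ∧
      (∀ r ∈ Ioo 0 b, HasDerivAt u (areaR k K r (cut k lo η r (u r))) r) ∧
      ∀ r ∈ Ioc 0 r₁, u r < level k η r := by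
  obtain ⟨u, hu₁, hu⟩ := (hp.tame_areaR hη hlo).exists_solution hr₁ x₁
  refine ⟨u, hu₁, hu, fun r hr => ?_⟩
  have hmem : ∀ z ∈ Ioc 0 r₁, z ∈ Ioo 0 b := fun z hz => ⟨hz.1, hz.2.trans_lt hr₁.2⟩
  refine sub_pos.1 (pos_of_deriv_neg_at_zeros (Y := fun r => level k η r - u r)
    (fun z hz => (hp.hasDerivAt_level η (hmem z hz)).sub (hu z (hmem z hz))) ?_ ?_ r hr)
  · simpa [hu₁] using hx₁
  · intro z hz h0
    have hzb := hmem z ⟨hz.1, hz.2.le⟩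
    have e : cut k lo η z (u z) = level k η z := by
      rw [← sub_eq_zero.1 h0]
      exact min_eq_left (by rw [sub_eq_zero.1 h0]; exact le_max_right _ _)
    rw [e]
    linarith [hp.deriv_level_lt hzb hη (hηk z hzb) (hlev z hzb)]

end Profile

/-- An outgoing radial null ray `t = T(r)`, `0 < r ≤ r₁`, which emanates from the central
singularity: `T' = R_r`, not before the time `t₀` of the singularity, and before `level k η`. -/
structure IsRay (k K : ℝ → ℝ) (t₀ η r₁ : ℝ) (T : ℝ → ℝ) : Prop where
  hasDerivAt : ∀ r ∈ Ioc 0 r₁, HasDerivAt T (areaR k K r (T r)) r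
  ge : ∀ r ∈ Ioc 0 r₁, t₀ ≤ T r
  lt_level : ∀ r ∈ Ioc 0 r₁, T r < level k η r

lemma singularTime_eq (μ : ℝ → ℝ) : singularTime μ = 2 / (3 * √(μ 0 / 3)) := by
  rw [singularTime]
  rcases eq_or_ne (√(μ 0 / 3)) 0 with h | h
  · simp [h]
  · field_simp

/-! ### A radial ray from an emanating geodesic -/

/-- A function `D` with `D' ≥ -C D` which starts positive cannot reach zero. -/
lemma pos_of_neg_mul_le_deriv {D D' : ℝ → ℝ} {p q C : ℝ} (hpq : p ≤ q)
    (hD : ∀ s ∈ Icc p q, HasDerivAt D (D' s) s) (hp : 0 < D p)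
    (hge : ∀ s ∈ Ioo p q, -C * D s ≤ D' s) : 0 < D q := by
  have hmono : MonotoneOn (fun s => Real.exp (C * s) * D s) (Icc p q) := by
    have hd : ∀ s ∈ Icc p q, HasDerivAt (fun s => Real.exp (C * s) * D s)
        (Real.exp (C * s) * C * D s + Real.exp (C * s) * D' s) s := fun s hs => by
      have h1 : HasDerivAt (fun s : ℝ => Real.exp (C * s)) (Real.exp (C * s) * C) s := by
        simpa using ((hasDerivAt_id s).const_mul C).exp
      exact h1.mul (hD s hs)
    refine monotoneOn_of_hasDerivWithinAt_nonneg (convex_Icc p q)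
      (fun s hs => (hd s hs).continuousAt.continuousWithinAt)
      (fun s hs => (hd s (interior_subset hs)).hasDerivWithinAt) fun s hs => ?_
    rw [interior_Icc] at hs
    have := hge s hs
    have h0 := Real.exp_pos (C * s)
    have : 0 ≤ Real.exp (C * s) * (C * D s + D' s) := mul_nonneg h0.le (by linarith)
    linarith
  have h := hmono ⟨le_rfl, hpq⟩ ⟨hpq, le_rfl⟩ hpq
  have h1 : 0 < Real.exp (C * p) * D p := mul_pos (Real.exp_pos _) hp
  exact (mul_pos_iff_of_pos_left (Real.exp_pos _)).1 (h1.trans_le h)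

/-- Every emanating null geodesic, radial or not, gives rise to an emanating radial ray: the
outgoing radial null ray `t = u(r)` through a point of the geodesic. In the past of that point the
geodesic is not later than the ray, as `dt ≥ R_r |dr|` along it, so the ray does not reach the
centre before the time `t₀`. -/
theorem RegularData.exists_ray_of_existsEmanating {b : ℝ} {μ : ℝ → ℝ} (h : RegularData b μ) {L : ℝ}
    (hL : ExistsEmanating b μ L) {c : ℝ} (hc0 : 0 < c) (hcb : c ≤ b)
    (hck : ∀ r ∈ Ioo 0 c, √(μ 0 / 3) / 2 < shape μ r) (hc1 : √(μ 0 / 3) * c ≤ 1) :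
    ∃ η r₁ T, 0 < η ∧ η ≤ √(μ 0 / 3) / 2 ∧ r₁ ∈ Ioo 0 c ∧
      IsRay (shape μ) (shapeSlope μ) (singularTime μ) η r₁ T := by
  obtain ⟨ε, τ, ρ, φ, hg⟩ := hL
  have hp := h.profile.mono hcb
  set k := shape μ with hk
  set K := shapeSlope μ with hK
  set k₀ := √(μ 0 / 3) with hk₀
  have hk0 : 0 < k₀ := hp.k₀_pos
  have hdτ : ∀ s ∈ Ioo 0 ε, HasDerivAt τ (deriv τ s) s := fun s hs =>
    ((hg.smooth_t.differentiableOn two_ne_zero).differentiableAt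
      (Ioo_mem_nhds hs.1 hs.2)).hasDerivAt
  have hdρ : ∀ s ∈ Ioo 0 ε, HasDerivAt ρ (deriv ρ s) s := fun s hs =>
    ((hg.smooth_r.differentiableOn two_ne_zero).differentiableAt
      (Ioo_mem_nhds hs.1 hs.2)).hasDerivAt
  have hτmono : MonotoneOn τ (Ioo 0 ε) := by
    refine monotoneOn_of_hasDerivWithinAt_nonneg (convex_Ioo _ _) (f' := deriv τ)
      (fun s hs => (hdτ s hs).continuousAt.continuousWithinAt) ?_ ?_
    · rw [interior_Ioo]; exact fun s hs => (hdτ s hs).hasDerivWithinAt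
    · rw [interior_Ioo]; exact hg.future
  have hτ0 : ∀ s ∈ Ioo 0 ε, singularTime μ ≤ τ s := fun s hs => by
    refine le_of_tendsto hg.tendsto_t ?_
    filter_upwards [Ioo_mem_nhdsGT hs.1] with z hz
    exact hτmono ⟨hz.1, hz.2.trans hs.2⟩ hs hz.2.le
  have hρcont : ContinuousOn ρ (Ioo 0 ε) := fun s hs => (hdρ s hs).continuousAt.continuousWithinAt
  -- a point of the geodesic at which `r` is maximal so far
  obtain ⟨s₁, hs₁, hr₁c, hmax⟩ : ∃ s₁ ∈ Ioo 0 ε, ρ s₁ < c ∧ ∀ s ∈ Ioc 0 s₁, ρ s ≤ ρ s₁ := by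
    have hev : ∀ a > 0, ∃ u > 0, u < ε ∧ ∀ s ∈ Ioc 0 u, ρ s < a := fun a ha => by
      obtain ⟨u, hu, hsub⟩ := mem_nhdsGT_iff_exists_Ioo_subset.1
        (hg.tendsto_r.eventually_lt_const ha)
      have hu : 0 < u := hu
      have hm : 0 < min u ε := lt_min hu hg.eps_pos
      refine ⟨min u ε / 2, by linarith, by linarith [min_le_right u ε], fun s hs => hsub ⟨hs.1, ?_⟩⟩
      linarith [min_le_left u ε, hs.2]
    obtain ⟨s', hs', hs'ε, hs'c⟩ := hev c hc0
    have hm' : s' ∈ Ioo 0 ε := ⟨hs', hs'ε⟩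
    obtain ⟨δ, hδ, -, hδlt⟩ := hev (ρ s') (hg.inside s' hm').1
    have hδs : δ < s' := by
      by_contra! hle
      exact lt_irrefl _ (hδlt s' ⟨hs', hle⟩)
    have hsub : Icc δ s' ⊆ Ioo 0 ε := fun s hs => ⟨hδ.trans_le hs.1, hs.2.trans_lt hs'ε⟩
    obtain ⟨s₁, hs₁, hmax⟩ := isCompact_Icc.exists_isMaxOn (nonempty_Icc.2 hδs.le)
      (hρcont.mono hsub)
    refine ⟨s₁, hsub hs₁, hs'c s₁ ⟨(hsub hs₁).1, hs₁.2⟩, fun s hs => ?_⟩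
    rcases le_total s δ with hsδ | hsδ
    · exact ((hδlt s ⟨hs.1, hsδ⟩).trans_le (hmax ⟨hδs.le, le_rfl⟩)).le
    · exact hmax ⟨hsδ, hs.2.trans hs₁.2⟩
  set r₁ := ρ s₁ with hr₁
  have hr₁m : r₁ ∈ Ioo 0 c := ⟨(hg.inside s₁ hs₁).1, hr₁c⟩
  have hU₁ : 0 < 1 - 3 / 2 * k r₁ * τ s₁ :=
    (h.before_iff ⟨hr₁m.1, hr₁m.2.trans_le hcb⟩).1 (hg.inside s₁ hs₁).2.2.2
  -- the ray through this point
  set η := min (k₀ / 2) (root k r₁ (τ s₁) / (2 * r₁)) with hηdef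
  have hr₁0 := hr₁m.1
  have hη : 0 < η := lt_min (by linarith) (by have := root_pos hU₁; positivity)
  have hηk₀ : η ≤ k₀ / 2 := min_le_left _ _
  have hηk : ∀ r ∈ Ioo 0 c, η ≤ k r := fun r hr => hηk₀.trans (hck r hr).le
  have hlev : ∀ r ∈ Ioo 0 c, 0 ≤ level k η r := fun r hr => by
    have hkr := hp.k_pos r hr
    have h1 : η * r ≤ 1 := by
      have : η * r ≤ k₀ * c := mul_le_mul (by linarith) hr.2.le hr.1.le hk0.le
      linarith
    have h2 : (η * r) ^ 3 ≤ 1 := pow_le_one₀ (mul_nonneg hη.le hr.1.le) h1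
    rw [mul_pow] at h2
    exact mul_nonneg (by positivity) (by linarith)
  have hlev₁ : τ s₁ < level k η r₁ := by
    rw [lt_level_iff (hp.k_pos r₁ hr₁m), ← root_cube hU₁]
    refine pow_lt_pow_left₀ ?_ (by positivity) three_ne_zero
    have h1 : η * r₁ ≤ root k r₁ (τ s₁) / (2 * r₁) * r₁ := by gcongr; exact min_le_right _ _
    have h2 : root k r₁ (τ s₁) / (2 * r₁) * r₁ = root k r₁ (τ s₁) / 2 := by field_simp
    have := root_pos hU₁
    linarith
  obtain ⟨u, hu₁, hu, hult⟩ := hp.exists_cut_ray hη hηk hlev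
    (continuousOn_const (c := singularTime μ)) hr₁m hlev₁
  have hmem : ∀ s ∈ Ioc 0 s₁, s ∈ Ioo 0 ε := fun s hs => ⟨hs.1, hs.2.trans_lt hs₁.2⟩
  have hρm : ∀ s ∈ Ioc 0 s₁, ρ s ∈ Ioc 0 r₁ := fun s hs =>
    ⟨(hg.inside s (hmem s hs)).1, hmax s hs⟩
  have hρc : ∀ s ∈ Ioc 0 s₁, ρ s ∈ Ioo 0 c := fun s hs =>
    ⟨(hρm s hs).1, (hρm s hs).2.trans_lt hr₁m.2⟩
  -- the geodesic is not later than the ray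
  have hle : ∀ s ∈ Ioc 0 s₁, τ s ≤ u (ρ s) := by
    intro s₂ hs₂
    by_contra! hlt
    set D : ℝ → ℝ := fun s => τ s - u (ρ s) with hDdef
    set D' : ℝ → ℝ := fun s =>
      deriv τ s - areaR k K (ρ s) (cut k (fun _ => singularTime μ) η (ρ s) (u (ρ s))) * deriv ρ s
      with hD'def
    have hDd : ∀ s ∈ Ioc 0 s₁, HasDerivAt D (D' s) s := fun s hs =>
      (hdτ s (hmem s hs)).sub ((hu _ (hρc s hs)).comp s (hdρ s (hmem s hs)))
    -- the first point after `s₂` where the two meet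
    obtain ⟨s₃, hs₃, hD₃, hpos⟩ : ∃ s₃ ∈ Ioc s₂ s₁, D s₃ = 0 ∧ ∀ s ∈ Ico s₂ s₃, 0 < D s := by
      have hDc : ContinuousOn D (Icc s₂ s₁) := fun s hs =>
        (hDd s ⟨hs₂.1.trans_le hs.1, hs.2⟩).continuousAt.continuousWithinAt
      have hmaps : MapsTo (fun z => s₁ + s₂ - z) (Icc s₂ s₁) (Icc s₂ s₁) := fun z hz =>
        ⟨by linarith [hz.2], by linarith [hz.1]⟩
      obtain ⟨z, hz, hz0, hzpos⟩ := exists_last_zero (Y := fun z => D (s₁ + s₂ - z))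
        (p := s₂) (q := s₁) (hDc.comp (by fun_prop) hmaps)
        (by simpa [hDdef] using hlt) hs₂.2 (by simp [hDdef, hu₁, ← hr₁])
      refine ⟨s₁ + s₂ - z, ⟨by linarith [hz.2], by linarith [hz.1]⟩, hz0, fun s hs => ?_⟩
      have := hzpos (s₁ + s₂ - s) ⟨by linarith [hs.2], by linarith [hs.1]⟩
      simpa using this
    have hs₃m : s₃ ∈ Ioc 0 s₁ := ⟨hs₂.1.trans hs₃.1, hs₃.2⟩
    -- shortly before this point, the geodesic is before `level k η`
    have hnear : ∀ᶠ s in 𝓝 s₃, τ s < level k η (ρ s) := by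
      have h1 : τ s₃ < level k η (ρ s₃) := by
        have := hult _ (hρm s₃ hs₃m)
        have : τ s₃ = u (ρ s₃) := sub_eq_zero.1 hD₃
        linarith
      have hcl : ContinuousAt (fun s => level k η (ρ s)) s₃ :=
        ((hp.hasDerivAt_level η (hρc s₃ hs₃m)).comp s₃ (hdρ s₃ (hmem s₃ hs₃m))).continuousAt
      exact (hdτ s₃ (hmem s₃ hs₃m)).continuousAt.eventually_lt hcl h1
    obtain ⟨s₄, hs₄, hlt₄⟩ : ∃ s₄ ∈ Ico s₂ s₃, ∀ s ∈ Icc s₄ s₃, τ s < level k η (ρ s) := by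
      obtain ⟨l, hl, hsub⟩ := exists_Ioc_subset_of_mem_nhds hnear ⟨s₂, hs₃.1⟩
      have hl : l < s₃ := hl
      have hs23 := hs₃.1
      refine ⟨(max l s₂ + s₃) / 2, ⟨?_, ?_⟩, fun s hs => hsub ⟨?_, hs.2⟩⟩
      · linarith [le_max_right l s₂]
      · linarith [max_lt hl hs₃.1]
      · linarith [le_max_left l s₂, hs.1, max_lt hl hs₃.1]
    have hsub : Icc s₄ s₃ ⊆ Ioc 0 s₁ := fun s hs =>
      ⟨hs₂.1.trans_le (hs₄.1.trans hs.1), hs.2.trans hs₃.2⟩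
    -- Lipschitz bounds along the geodesic
    obtain ⟨M, hM⟩ : ∃ M, ∀ s ∈ Icc s₄ s₃, ‖deriv ρ s‖ ≤ M :=
      isCompact_Icc.exists_bound_of_continuousOn
        ((hg.smooth_r.continuousOn_deriv_of_isOpen isOpen_Ioo (by norm_num)).mono
          fun s hs => hmem s (hsub hs))
    have hρS : ContinuousOn ρ (Icc s₄ s₃) := hρcont.mono fun s hs => hmem s (hsub hs)
    obtain ⟨z, hz, hzmin⟩ := isCompact_Icc.exists_isMinOn (nonempty_Icc.2 hs₄.2.le) hρS
    obtain ⟨C, hC0, hC⟩ := (hp.tame_areaR hη (continuousOn_const (c := singularTime μ))).bound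
      (ρ z) r₁ (hρm z (hsub hz)).1 hr₁m.2
    have hcutτ : ∀ s ∈ Icc s₄ s₃, cut k (fun _ => singularTime μ) η (ρ s) (τ s) = τ s :=
      fun s hs => by
        rw [cut, max_eq_right (hτ0 s (hmem s (hsub hs))), min_eq_right (hlt₄ s hs).le]
    refine (pos_of_neg_mul_le_deriv (D := D) (D' := D') (C := C * M) hs₄.2.le
      (fun s hs => hDd s (hsub hs)) (hpos s₄ hs₄) fun s hs => ?_).ne' hD₃
    have hs' : s ∈ Icc s₄ s₃ := Ioo_subset_Icc_self hs
    have hsε := hmem s (hsub hs')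
    have hDs : 0 < D s := hpos s ⟨hs₄.1.trans hs.1.le, hs.2⟩
    have hρb : ρ s ∈ Ioo 0 b := ⟨(hρc s (hsub hs')).1, (hρc s (hsub hs')).2.trans_le hcb⟩
    have hUs : 0 < 1 - 3 / 2 * k (ρ s) * τ s :=
      (h.before_iff hρb).1 (hg.inside s hsε).2.2.2
    have hlip := (hC (ρ s) ⟨hzmin hs', (hρm s (hsub hs')).2⟩).2 (τ s) (u (ρ s))
    rw [hcutτ s hs'] at hlip
    set a := areaR k K (ρ s) (τ s) with ha
    set a' := areaR k K (ρ s) (cut k (fun _ => singularTime μ) η (ρ s) (u (ρ s))) with ha'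
    -- `dt ≥ R_r |dr|` along a null geodesic
    have hcausal : a * deriv ρ s ≤ deriv τ s := by
      have hn := hg.null s hsε
      rw [h.Rr_eq hρb hUs, ← hK, ← hk, ← ha] at hn
      have hq : 0 ≤ L ^ 2 / R μ (ρ s) (τ s) ^ 2 := by positivity
      exact le_of_abs_le (abs_le_of_sq_le_sq (by linarith) (hg.future s hsε))
    have h1 : |(a - a') * deriv ρ s| ≤ C * D s * M := by
      rw [abs_mul]
      refine mul_le_mul (hlip.trans_eq ?_) (hM s hs') (abs_nonneg _) (by positivity)
      rw [Real.norm_eq_abs, abs_of_pos hDs]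
    have h2 := (abs_le.1 h1).1
    simp only [hD'def]
    linarith
  -- hence the ray does not reach the centre before `t₀`
  have hge : ∀ r ∈ Ioc 0 r₁, singularTime μ ≤ u r := by
    intro r hr
    obtain ⟨s, hs, hsr⟩ : ∃ s ∈ Ioc 0 s₁, ρ s = r := by
      obtain ⟨s, hs1, hs2⟩ := ((hg.tendsto_r.eventually_lt_const hr.1).and
        (mem_of_superset (Ioo_mem_nhdsGT hs₁.1) fun _ => id :
          ∀ᶠ s in 𝓝[>] (0 : ℝ), s ∈ Ioo 0 s₁)).exists
      obtain ⟨z, hz, hzr⟩ := intermediate_value_Icc hs2.2.le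
        (hρcont.mono fun z hz => ⟨hs2.1.trans_le hz.1, hz.2.trans_lt hs₁.2⟩) ⟨hs1.le, hr.2⟩
      exact ⟨z, ⟨hs2.1.trans_le hz.1, hz.2⟩, hzr⟩
    rw [← hsr]
    exact (hτ0 s (hmem s hs)).trans (hle s hs)
  refine ⟨η, r₁, u, hη, hηk₀, hr₁m, fun r hr => ?_, hge, hult⟩
  have := hu r ⟨hr.1, hr.2.trans_lt hr₁m.2⟩
  rwa [cut, max_eq_right (hge r hr), min_eq_right (hult r hr).le] at this

/-! ### A ray along which `R = O(r³)` -/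

/-- Bounds near the centre for the functions of a `Profile`. In `gap_le`, the factor `6 / 5` could
be any number strictly between `1` and `4 / 3`: for `k₀ - k ~ rⁿ` the quotient of `k₀ - k` and `r K`
tends to `1 / n ≤ 1`, and the convexity of `R_r` in `t` after the time `t₀` needs less than
`4 / 3`. -/
structure NearCentre (c k₀ κ : ℝ) (k K : ℝ → ℝ) : Prop extends Profile c k₀ k K where
  le_one : c ≤ 1
  mul_le_one : k₀ * c ≤ 1
  half_lt : ∀ r ∈ Ioo 0 c, k₀ / 2 < k r
  gap_le : ∀ r ∈ Ioo 0 c, k₀ - k r ≤ 6 / 5 * (r * K r)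
  slope_le : ∀ r ∈ Ioo 0 c, K r ≤ κ

lemma Profile.one_sub_le {c k₀ : ℝ} {k K : ℝ → ℝ} (hp : Profile c k₀ k K) {r t : ℝ}
    (hr : r ∈ Ioo 0 c) (ht : 2 / (3 * k₀) ≤ t) :
    1 - 3 / 2 * k r * t ≤ (k₀ - k r) / k₀ := by
  have hk := hp.k_pos r hr
  have hk0 := hp.k₀_pos
  have h1 : k r * (2 / (3 * k₀)) ≤ k r * t := by gcongr
  have h2 : (k₀ - k r) / k₀ = 1 - 3 / 2 * (k r * (2 / (3 * k₀))) := by field_simp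
  linarith

lemma NearCentre.level_nonneg {c k₀ κ : ℝ} {k K : ℝ → ℝ} (hn : NearCentre c k₀ κ k K) {η r : ℝ}
    (hr : r ∈ Ioo 0 c) (hη : 0 < η) (hηk : η ≤ k₀) : 0 ≤ level k η r := by
  have hkr := hn.k_pos r hr
  have hk0 := hn.k₀_pos
  have h1 : η * r ≤ 1 := by
    have : η * r ≤ k₀ * c := mul_le_mul hηk hr.2.le hr.1.le hk0.le
    linarith [hn.mul_le_one]
  have h2 : (η * r) ^ 3 ≤ 1 := pow_le_one₀ (mul_nonneg hη.le hr.1.le) h1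
  rw [mul_pow] at h2
  exact mul_nonneg (by positivity) (by linarith)

/-- If `K / r² → ∞`, there is an emanating ray along which `√(R / r) ≤ 2 k₀ r`, that is,
`R ≤ 4 k₀² r³`: towards the centre, rays that start between `level k (2 k₀)` and `level k (k₀ / 2)`
stay between them. -/
lemma NearCentre.exists_ray_of_atTop {c k₀ κ : ℝ} {k K : ℝ → ℝ} (hn : NearCentre c k₀ κ k K)
    (hc : 0 < c) (hK : Tendsto (fun r => K r / r ^ 2) (𝓝[>] 0) atTop) :
    ∃ r₁ ∈ Ioo 0 c, ∃ T, IsRay k K (2 / (3 * k₀)) (k₀ / 2) r₁ T ∧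
      ∀ r ∈ Ioc 0 r₁, root k r (T r) ≤ 2 * k₀ * r := by
  have hp := hn.toProfile
  have hk0 := hn.k₀_pos
  set Y := 2 * k₀ with hY
  -- the bound on `K` below makes `level k Y` steeper than the rays meeting it
  set B := 6 * k₀ * (k₀ * Y ^ 2 + 2 * Y ^ 3) with hB
  obtain ⟨c', hc', hsub⟩ := mem_nhdsGT_iff_exists_Ioo_subset.1 (hK.eventually_gt_atTop B)
  have hc' : 0 < c' := hc'
  set r₁ := min (min c c') (1 / (4 * k₀)) / 2 with hr₁
  have hm : 0 < min (min c c') (1 / (4 * k₀)) := lt_min (lt_min hc hc') (by positivity)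
  have h1 : r₁ < c := by linarith [min_le_left (min c c') (1 / (4 * k₀)), min_le_left c c']
  have h2 : r₁ < c' := by linarith [min_le_left (min c c') (1 / (4 * k₀)), min_le_right c c']
  have h3 : r₁ < 1 / (4 * k₀) := by linarith [min_le_right (min c c') (1 / (4 * k₀))]
  have hr₁0 : 0 < r₁ := by linarith
  have hr₁c : r₁ ∈ Ioo 0 c := ⟨hr₁0, h1⟩
  have hmem : ∀ r ∈ Ioc 0 r₁, r ∈ Ioo 0 c := fun r hr => ⟨hr.1, hr.2.trans_lt h1⟩
  have hYr : ∀ r ∈ Ioc 0 r₁, (Y * r) ^ 3 ≤ 1 / 2 := fun r hr => by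
    have h4 : Y * r ≤ 1 / 2 := by
      have : Y * r ≤ Y * (1 / (4 * k₀)) := by gcongr; exact hr.2.trans h3.le
      have e : Y * (1 / (4 * k₀)) = 1 / 2 := by rw [hY]; field_simp; norm_num
      linarith
    have h5 := pow_le_pow_left₀ (mul_nonneg (by positivity) hr.1.le : 0 ≤ Y * r) h4 3
    linarith [h5, show ((1 : ℝ) / 2) ^ 3 ≤ 1 / 2 by norm_num]
  have hlow : ∀ r ∈ Ioc 0 r₁, 1 / (3 * k₀) ≤ level k Y r := fun r hr => by
    have hkr := hn.k_pos r (hmem r hr)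
    have hlt := hp.k_lt (hmem r hr)
    have h4 := hYr r hr
    rw [mul_pow] at h4
    have h5 : 2 / (3 * k₀) ≤ 2 / (3 * k r) := by gcongr
    have e : 1 / (3 * k₀) = 2 / (3 * k₀) * (1 / 2) := by field_simp
    rw [e, level]
    exact mul_le_mul h5 (by linarith) (by norm_num) (by positivity)
  have hstart : level k Y r₁ < level k (k₀ / 2) r₁ ∧
      level k k₀ r₁ < level k (k₀ / 2) r₁ ∧ level k Y r₁ < level k k₀ r₁ := by
    have hkr := hn.k_pos r₁ hr₁c
    have hlt : ∀ a b : ℝ, 0 < a → a < b → level k b r₁ < level k a r₁ := fun a b ha hab => by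
      have : a ^ 3 * r₁ ^ 3 < b ^ 3 * r₁ ^ 3 := by gcongr
      exact mul_lt_mul_of_pos_left (by linarith) (by positivity)
    exact ⟨hlt _ _ (by linarith) (by linarith), hlt _ _ (by linarith) (by linarith),
      hlt _ _ (by linarith) (by linarith)⟩
  obtain ⟨u, hu₁, hu, hult⟩ := hp.exists_cut_ray (η := k₀ / 2) (by linarith)
    (fun r hr => (hn.half_lt r hr).le)
    (fun r hr => hn.level_nonneg hr (by linarith) (by linarith)) (hp.continuousOn_level Y) hr₁c
    hstart.2.1
  have hgt : ∀ r ∈ Ioc 0 r₁, level k Y r < u r := by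
    intro r hr
    refine sub_pos.1 (pos_of_deriv_neg_at_zeros (Y := fun r => u r - level k Y r)
      (fun z hz => (hu z (hmem z hz)).sub (hp.hasDerivAt_level Y (hmem z hz))) ?_ ?_ r hr)
    · simpa [hu₁] using hstart.2.2
    · intro z hz h0
      have hz' : z ∈ Ioc 0 r₁ := Ioo_subset_Ioc_self hz
      have hzc := hmem z hz'
      have hkz := hn.k_pos z hzc
      have hz0 := hz.1
      have e : cut k (level k Y) (k₀ / 2) z (u z) = level k Y z := by
        rw [cut, sub_eq_zero.1 h0, max_self]
        rw [← sub_eq_zero.1 h0]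
        exact min_eq_right (hult z hz').le
      rw [e, sub_neg, areaR, root_level hkz (by positivity) hz0, lt_div_iff₀ hkz]
      have hKz : B < K z / z ^ 2 := hsub ⟨hz0, hz.2.trans h2⟩
      rw [lt_div_iff₀ (by positivity)] at hKz
      have hlt := hp.k_lt hzc
      have hK0 := hn.K_pos z hzc
      have hl := hlow z hz'
      set t := level k Y z with ht
      have hKt : K z * (1 / (3 * k₀)) ≤ K z * t := by gcongr
      have h6 : B * z ^ 2 * (1 / (3 * k₀)) < K z * (1 / (3 * k₀)) := by gcongr
      have e6 : B * z ^ 2 * (1 / (3 * k₀)) = 2 * ((k₀ * Y ^ 2 + 2 * Y ^ 3) * z ^ 2) := by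
        rw [hB]; field_simp; ring
      have e7 : ((Y * z) ^ 2 + z * K z * t / (Y * z)) * k z
          = k z * (Y ^ 2 * z ^ 2) + K z * t * (k z / Y) := by field_simp
      have h8 : k z / Y ≤ 1 / 2 := by rw [div_le_iff₀ (by positivity)]; linarith
      have hKt0 : 0 ≤ K z * t := le_trans (by positivity) hKt
      have h9 : K z * t * (k z / Y) ≤ K z * t * (1 / 2) := by gcongr
      have h10 : k z * (Y ^ 2 * z ^ 2) ≤ k₀ * (Y ^ 2 * z ^ 2) := by gcongr
      rw [e7]
      nlinarith
  have hray : ∀ r ∈ Ioc 0 r₁, HasDerivAt u (areaR k K r (u r)) r := fun r hr => by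
    have := hu r (hmem r hr)
    rwa [cut, max_eq_right (hgt r hr).le, min_eq_right (hult r hr).le] at this
  have hU : ∀ r ∈ Ioc 0 r₁, 0 < 1 - 3 / 2 * k r * u r := fun r hr =>
    pos_of_le_level (hn.k_pos r (hmem r hr)) (by linarith : 0 < k₀ / 2) hr.1 (hult r hr).le
  have hu0 : ∀ r ∈ Ioc 0 r₁, 0 ≤ u r := fun r hr =>
    (by positivity : 0 ≤ 1 / (3 * k₀)).trans ((hlow r hr).trans (hgt r hr).le)
  have hmono : MonotoneOn u (Ioc 0 r₁) := by
    refine monotoneOn_of_hasDerivWithinAt_nonneg (convex_Ioc _ _)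
      (f' := fun r => areaR k K r (u r))
      (fun r hr => (hray r hr).continuousAt.continuousWithinAt)
      (fun r hr => (hray r (interior_subset hr)).hasDerivWithinAt) fun r hr => ?_
    have hr := interior_subset hr
    exact (hp.areaR_pos (hmem r hr) (hu0 r hr) (hU r hr)).le
  refine ⟨r₁, hr₁c, u, ⟨hray, fun r hr => ?_, hult⟩, fun r hr => ?_⟩
  · refine le_of_tendsto (hp.tendsto_level Y) ?_
    filter_upwards [Ioo_mem_nhdsGT hr.1] with z hz
    have hz' : z ∈ Ioc 0 r₁ := ⟨hz.1, hz.2.le.trans hr.2⟩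
    exact (hgt z hz').le.trans (hmono hz' hr hz.2.le)
  · have hkr := hn.k_pos r (hmem r hr)
    rw [← root_level (η := Y) hkr (by positivity) hr.1]
    exact root_le_root hkr (hU r hr) (hgt r hr).le

/-- If some null geodesic emanates, there is an emanating radial ray along which `R = O(r³)`. When
`K / r² → ∞` such a ray exists in any case; when `K = O(r²)`, every emanating ray satisfies the
bound, as it is not before `t₀`; and when `k₀ - k = o(r³)`, nothing emanates. -/
theorem RegularData.exists_controlled_ray {b : ℝ} {μ : ℝ → ℝ} (h : RegularData b μ) {L : ℝ}
    (hL : ExistsEmanating b μ L) :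
    ∃ c κ η r₁ T Y, c ≤ b ∧ NearCentre c (√(μ 0 / 3)) κ (shape μ) (shapeSlope μ) ∧ 0 < η ∧
      η ≤ √(μ 0 / 3) / 2 ∧ r₁ ∈ Ioo 0 c ∧
      IsRay (shape μ) (shapeSlope μ) (singularTime μ) η r₁ T ∧ 0 < Y ∧
      ∀ r ∈ Ioc 0 r₁, root (shape μ) r (T r) ≤ Y * r := by
  have hp := h.profile
  set k := shape μ with hk
  set K := shapeSlope μ with hKdef
  set k₀ := √(μ 0 / 3) with hk₀
  have hk0 : 0 < k₀ := hp.k₀_pos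
  have ht0 : singularTime μ = 2 / (3 * k₀) := singularTime_eq μ
  obtain ⟨⟨κ, hκ⟩, hcases⟩ := h.near_centre
  have hhalf : ∀ᶠ r in 𝓝[>] (0 : ℝ), k₀ / 2 < k r :=
    hp.tendsto.eventually_const_lt (by linarith)
  have choose_c : ∀ {P : ℝ → Prop}, (∀ᶠ r in 𝓝[>] (0 : ℝ), P r) →
      ∃ c, 0 < c ∧ c ≤ b ∧ c ≤ 1 ∧ k₀ * c ≤ 1 ∧ ∀ r ∈ Ioo 0 c, P r := fun hP => by
    obtain ⟨u, hu, hsub⟩ := mem_nhdsGT_iff_exists_Ioo_subset.1 hP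
    have hu : 0 < u := hu
    refine ⟨min (min u b) (min 1 (1 / k₀)),
      lt_min (lt_min hu h.radius_pos) (lt_min one_pos (by positivity)),
      (min_le_left _ _).trans (min_le_right _ _), (min_le_right _ _).trans (min_le_left _ _), ?_,
      fun r hr => hsub ⟨hr.1, hr.2.trans_le ((min_le_left _ _).trans (min_le_left _ _))⟩⟩
    have : min (min u b) (min 1 (1 / k₀)) ≤ 1 / k₀ := (min_le_right _ _).trans (min_le_right _ _)
    calc k₀ * min (min u b) (min 1 (1 / k₀)) ≤ k₀ * (1 / k₀) := by gcongr
      _ = 1 := by field_simp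
  rcases hcases with ⟨hgap, hcase⟩ | hflat
  · rcases hcase with htop | ⟨C, hC⟩
    · obtain ⟨c, hc, hcb, hc1, hkc, hP⟩ := choose_c (hhalf.and (hgap.and hκ))
      have hn : NearCentre c k₀ κ k K :=
        { hp.mono hcb with
          le_one := hc1
          mul_le_one := hkc
          half_lt := fun r hr => (hP r hr).1
          gap_le := fun r hr => (hP r hr).2.1
          slope_le := fun r hr => (hP r hr).2.2 }
      obtain ⟨r₁, hr₁, T, hT, hroot⟩ := hn.exists_ray_of_atTop hc htop
      exact ⟨c, κ, k₀ / 2, r₁, T, 2 * k₀, hcb, hn, by linarith, le_rfl, hr₁, by rwa [ht0],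
        by linarith, hroot⟩
    · obtain ⟨c, hc, hcb, hc1, hkc, hP⟩ := choose_c (hhalf.and (hgap.and (hκ.and hC)))
      have hn : NearCentre c k₀ κ k K :=
        { hp.mono hcb with
          le_one := hc1
          mul_le_one := hkc
          half_lt := fun r hr => (hP r hr).1
          gap_le := fun r hr => (hP r hr).2.1
          slope_le := fun r hr => (hP r hr).2.2.1 }
      obtain ⟨η, r₁, T, hη, hηk, hr₁, hT⟩ := h.exists_ray_of_existsEmanating hL hc hcb
        (fun r hr => (hP r hr).1) hkc
      set Y := max 1 (6 / 5 * C / k₀) with hY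
      refine ⟨c, κ, η, r₁, T, Y, hcb, hn, hη, hηk, hr₁, hT, by positivity, fun r hr => ?_⟩
      have hrc : r ∈ Ioo 0 c := ⟨hr.1, hr.2.trans_lt hr₁.2⟩
      have hr0 := hr.1
      have hU := pos_of_le_level (hn.k_pos r hrc) hη hr.1 (hT.lt_level r hr).le
      refine le_of_pow_le_pow_left₀ three_ne_zero (by positivity) ?_
      rw [root_cube hU]
      have h1 := hn.toProfile.one_sub_le hrc (ht0 ▸ hT.ge r hr)
      have h2 := hn.gap_le r hrc
      have h3 := (hP r hrc).2.2.2
      have hY1 : 1 ≤ Y := le_max_left _ _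
      have hY3 : Y ≤ Y ^ 3 := le_self_pow₀ hY1 three_ne_zero
      calc 1 - 3 / 2 * k r * T r ≤ (k₀ - k r) / k₀ := h1
        _ ≤ (6 / 5 * (r * (C * r ^ 2))) / k₀ := by
            gcongr; exact h2.trans (by gcongr)
        _ = 6 / 5 * C / k₀ * r ^ 3 := by ring
        _ ≤ Y ^ 3 * r ^ 3 := by gcongr; exact (le_max_right _ _).trans hY3
        _ = (Y * r) ^ 3 := by ring
  · -- if `k₀ - k = o(r³)`, no ray can have `√(R / r) ≥ η r` all the way to the centre
    exfalso
    obtain ⟨c, hc, hcb, hc1, hkc, hP⟩ := choose_c hhalf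
    obtain ⟨η, r₁, T, hη, hηk, hr₁, hT⟩ := h.exists_ray_of_existsEmanating hL hc hcb hP hkc
    have hev : ∀ᶠ r in 𝓝[>] (0 : ℝ), r ∈ Ioo 0 r₁ := Ioo_mem_nhdsGT hr₁.1
    obtain ⟨r, hr, hle⟩ := (hev.and (hflat (k₀ * η ^ 3) (by positivity))).exists
    have hrb : r ∈ Ioo 0 b := ⟨hr.1, hr.2.trans (hr₁.2.trans_le hcb)⟩
    have h1 := hp.one_sub_le hrb (ht0 ▸ hT.ge r ⟨hr.1, hr.2.le⟩)
    have h2 := (lt_level_iff (hp.k_pos r hrb)).1 (hT.lt_level r ⟨hr.1, hr.2.le⟩)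
    have h3 : (k₀ - k r) / k₀ ≤ (η * r) ^ 3 := by
      rw [div_le_iff₀ hk0]
      linarith
    linarith

/-! ### Bounds in the region where `R` is comparable to `r³` -/

/-- The region of the `(r, t)` plane after the time `t₀ = 2 / (3 k₀)` in which
`η r ≤ √(R / r) ≤ Y r`. -/
structure InRegion (c k₀ η Y : ℝ) (k : ℝ → ℝ) (r t : ℝ) : Prop where
  mem : r ∈ Ioo 0 c
  ge : 2 / (3 * k₀) ≤ t
  le_level : t ≤ level k η r
  root_le : root k r t ≤ Y * r

namespace NearCentre

variable {c k₀ κ η Y : ℝ} {k K : ℝ → ℝ}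

lemma inRegion_of_ge (hn : NearCentre c k₀ κ k K) (hη : 0 < η) {r t t' : ℝ}
    (h : InRegion c k₀ η Y k r t) (htt' : t ≤ t') (ht' : t' ≤ level k η r) :
    InRegion c k₀ η Y k r t' where
  mem := h.mem
  ge := h.ge.trans htt'
  le_level := ht'
  root_le := (root_le_root (hn.k_pos r h.mem)
    (pos_of_le_level (hn.k_pos r h.mem) hη h.mem.1 ht') htt').trans h.root_le

lemma region_facts (hn : NearCentre c k₀ κ k K) (hη : 0 < η) {r t : ℝ}
    (h : InRegion c k₀ η Y k r t) :
    0 < 1 - 3 / 2 * k r * t ∧ η * r ≤ root k r t ∧ root k r t ^ 3 ≤ 6 / 5 * (r * K r) / k₀ ∧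
      0 < t ∧ t ≤ 4 / (3 * k₀) := by
  have hk := hn.k_pos r h.mem
  have hk0 := hn.k₀_pos
  have hU := pos_of_le_level hk hη h.mem.1 h.le_level
  refine ⟨hU, le_root hk hη h.mem.1 h.le_level, ?_,
    (by positivity : 0 < 2 / (3 * k₀)).trans_le h.ge, ?_⟩
  · rw [root_cube hU]
    refine (hn.toProfile.one_sub_le h.mem h.ge).trans ?_
    gcongr
    exact hn.gap_le r h.mem
  · refine ((lt_iff_pos hk).2 hU).le.trans ?_
    rw [div_le_div_iff₀ (by positivity) (by positivity)]
    linarith [hn.half_lt r h.mem]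

/-- `R_r = O(K)` in the region. -/
lemma areaR_le (hn : NearCentre c k₀ κ k K) (hη : 0 < η) {r t : ℝ}
    (h : InRegion c k₀ η Y k r t) : areaR k K r t ≤ 3 / (k₀ * η) * K r := by
  obtain ⟨hU, hw, hw3, ht0, ht⟩ := hn.region_facts hη h
  have hr := h.mem.1
  have hk0 := hn.k₀_pos
  have hK := hn.K_pos r h.mem
  have hw0 := root_pos hU
  have e : areaR k K r t = (root k r t ^ 3 + r * K r * t) / root k r t := by
    rw [areaR]; field_simp
  rw [e, div_le_iff₀ hw0]
  have h1 : r * K r * t ≤ r * K r * (4 / (3 * k₀)) := by gcongr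
  have h2 : 3 / (k₀ * η) * K r * (η * r) ≤ 3 / (k₀ * η) * K r * root k r t := by gcongr
  have e2 : 3 / (k₀ * η) * K r * (η * r) = 3 * (r * K r / k₀) := by field_simp
  have e3 : 6 / 5 * (r * K r) / k₀ = 6 / 5 * (r * K r / k₀) := by ring
  have e4 : r * K r * (4 / (3 * k₀)) = 4 / 3 * (r * K r / k₀) := by field_simp
  have h3 : 0 < r * K r / k₀ := by positivity
  linarith

/-- `R_rt = O(K / r³)` in the region. -/
lemma abs_areaRT_le (hn : NearCentre c k₀ κ k K) (hη : 0 < η) {r t : ℝ}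
    (h : InRegion c k₀ η Y k r t) :
    |areaRT k K r t| ≤ ((k₀ + κ) * (6 / 5) / k₀ + 2 / 3) / η ^ 4 * (K r / r ^ 3) := by
  obtain ⟨hU, hw, hw3, ht0, ht⟩ := hn.region_facts hη h
  have hr := h.mem.1
  have hk0 := hn.k₀_pos
  have hk := hn.k_pos r h.mem
  have hlt := hn.toProfile.k_lt h.mem
  have hK := hn.K_pos r h.mem
  have hκ := hn.slope_le r h.mem
  have hr1 : r ≤ 1 := h.mem.2.le.trans hn.le_one
  have hw0 := root_pos hU
  have e : areaRT k K r t
      = (-(k r - r * K r) * root k r t ^ 3 + r * k r * K r * t / 2) / root k r t ^ 4 := by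
    rw [areaRT]; field_simp
  have hrK : r * K r ≤ κ := by
    have : r * K r ≤ 1 * K r := by gcongr
    linarith
  have hnum : |-(k r - r * K r) * root k r t ^ 3 + r * k r * K r * t / 2|
      ≤ ((k₀ + κ) * (6 / 5) / k₀ + 2 / 3) * (r * K r) := by
    have h1 : |-(k r - r * K r)| ≤ k₀ + κ := by
      have : 0 < r * K r := by positivity
      rw [abs_neg, abs_le]; constructor <;> linarith
    have h2 : |-(k r - r * K r) * root k r t ^ 3| ≤ (k₀ + κ) * (6 / 5 * (r * K r) / k₀) := by
      rw [abs_mul, abs_of_pos (pow_pos hw0 3)]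
      exact mul_le_mul h1 hw3 (by positivity) ((abs_nonneg _).trans h1)
    have h3 : |r * k r * K r * t / 2| ≤ r * k₀ * K r * (4 / (3 * k₀)) / 2 := by
      rw [abs_of_pos (by positivity)]; gcongr
    have e3 : r * k₀ * K r * (4 / (3 * k₀)) / 2 = 2 / 3 * (r * K r) := by field_simp; norm_num
    have e2 : (k₀ + κ) * (6 / 5 * (r * K r) / k₀) = (k₀ + κ) * (6 / 5) / k₀ * (r * K r) := by ring
    rw [e2] at h2
    rw [e3] at h3
    rw [add_mul]
    exact (abs_add_le _ _).trans (add_le_add h2 h3)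
  rw [e, abs_div, abs_of_pos (pow_pos hw0 4), div_le_iff₀ (pow_pos hw0 4)]
  refine hnum.trans ?_
  have hκ0 : 0 < κ := hK.trans_le hκ
  have h4 : (η * r) ^ 4 ≤ root k r t ^ 4 := by gcongr
  calc ((k₀ + κ) * (6 / 5) / k₀ + 2 / 3) * (r * K r)
      = ((k₀ + κ) * (6 / 5) / k₀ + 2 / 3) / η ^ 4 * (K r / r ^ 3) * (η * r) ^ 4 := by
        field_simp
    _ ≤ _ := by gcongr

/-- `R_r` is a convex function of `t` in the region; this is where `t ≥ t₀` matters. -/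
lemma le_areaRTT (hn : NearCentre c k₀ κ k K) (hη : 0 < η) (hY : 0 < Y) {r t : ℝ}
    (h : InRegion c k₀ η Y k r t) : k₀ / (60 * Y ^ 7) * (K r / r ^ 6) ≤ areaRTT k K r t := by
  obtain ⟨hU, hw, hw3, ht0, ht⟩ := hn.region_facts hη h
  have hr := h.mem.1
  have hk0 := hn.k₀_pos
  have hk := hn.k_pos r h.mem
  have hhalf := hn.half_lt r h.mem
  have hK := hn.K_pos r h.mem
  have hw0 := root_pos hU
  have hw7 : root k r t ^ 7 ≤ (Y * r) ^ 7 := by gcongr; exact h.root_le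
  have h1 : k r ^ 2 * (r * K r / (15 * k₀)) ≤
      r * k r ^ 2 * K r * t - k r ^ 2 * root k r t ^ 3 / 2 + r * k r * K r * root k r t ^ 3 := by
    have h2 : 0 ≤ r * k r * K r * root k r t ^ 3 := by positivity
    have h3 : r * K r * (2 / (3 * k₀)) ≤ r * K r * t := by gcongr; exact h.ge
    have e1 : r * K r / (15 * k₀) = r * K r * (2 / (3 * k₀)) - 6 / 5 * (r * K r) / k₀ / 2 := by
      field_simp; norm_num
    have h4 : r * K r / (15 * k₀) ≤ r * K r * t - root k r t ^ 3 / 2 := by rw [e1]; linarith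
    have h5 := mul_le_mul_of_nonneg_left h4 (sq_nonneg (k r))
    linarith
  have h6 : (k₀ / 2) ^ 2 * (r * K r / (15 * k₀)) ≤ k r ^ 2 * (r * K r / (15 * k₀)) := by gcongr
  rw [areaRTT, le_div_iff₀ (pow_pos hw0 7)]
  refine le_trans ?_ (h6.trans h1)
  calc k₀ / (60 * Y ^ 7) * (K r / r ^ 6) * root k r t ^ 7
      ≤ k₀ / (60 * Y ^ 7) * (K r / r ^ 6) * (Y * r) ^ 7 := by gcongr
    _ = (k₀ / 2) ^ 2 * (r * K r / (15 * k₀)) := by field_simp; norm_num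

lemma le_area (hn : NearCentre c k₀ κ k K) (hη : 0 < η) {r t : ℝ}
    (h : InRegion c k₀ η Y k r t) : η ^ 2 * r ^ 3 ≤ area k r t := by
  obtain ⟨hU, hw, -⟩ := hn.region_facts hη h
  have hr := h.mem.1
  calc η ^ 2 * r ^ 3 = r * (η * r) ^ 2 := by ring
    _ ≤ r * root k r t ^ 2 := by gcongr

lemma sub_le (hn : NearCentre c k₀ κ k K) (hη : 0 < η) (hY : 0 < Y) {r t t' : ℝ}
    (h : InRegion c k₀ η Y k r t) (h' : InRegion c k₀ η Y k r t') :
    t' - t ≤ 4 / (3 * k₀) * Y ^ 3 * r ^ 3 := by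
  obtain ⟨hU, -⟩ := hn.region_facts hη h
  obtain ⟨hU', -⟩ := hn.region_facts hη h'
  have hr := h.mem.1
  have hk0 := hn.k₀_pos
  have hk := hn.k_pos r h.mem
  have h1 : root k r t ^ 3 ≤ (Y * r) ^ 3 := by
    have := (root_pos hU).le
    gcongr; exact h.root_le
  rw [root_cube hU] at h1
  have h2 : t' - t ≤ 2 / (3 * k r) * (Y * r) ^ 3 := by
    rw [div_mul_eq_mul_div, le_div_iff₀ (by positivity)]
    linarith
  refine h2.trans ?_
  rw [mul_pow, ← mul_assoc]
  have : 2 / (3 * k r) ≤ 4 / (3 * k₀) := by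
    rw [div_le_div_iff₀ (by positivity) (by positivity)]
    linarith [hn.half_lt r h.mem]
  gcongr

lemma hasDerivAt_areaR_time (hn : NearCentre c k₀ κ k K) (hη : 0 < η) {r t : ℝ}
    (h : InRegion c k₀ η Y k r t) : HasDerivAt (fun t => areaR k K r t) (areaRT k K r t) t := by
  have := hn.toProfile.hasDerivAt_areaR (hasDerivAt_const t r) (hasDerivAt_id t) h.mem
    (hn.region_facts hη h).1
  simpa using this

/-- The convexity of `R_r` in `t`, in terms of secants. -/
lemma areaR_convex (hn : NearCentre c k₀ κ k K) (hη : 0 < η) (hY : 0 < Y) {r t t' : ℝ}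
    (h : InRegion c k₀ η Y k r t) (htt' : t ≤ t') (ht' : t' ≤ level k η r) :
    areaR k K r t' - areaR k K r t ≤ areaRT k K r t' * (t' - t) ∧
      areaRT k K r t ≤ areaRT k K r t' := by
  have hreg : ∀ z ∈ Icc t t', InRegion c k₀ η Y k r z := fun z hz =>
    hn.inRegion_of_ge hη h hz.1 (hz.2.trans ht')
  have hd : ∀ z ∈ Icc t t', HasDerivAt (fun t => areaRT k K r t) (areaRTT k K r z) z :=
    fun z hz => hn.toProfile.hasDerivAt_areaRT h.mem (hn.region_facts hη (hreg z hz)).1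
  have h0 : ∀ z ∈ Icc t t', 0 ≤ areaRTT k K r z := fun z hz => by
    refine le_trans ?_ (hn.le_areaRTT hη hY (hreg z hz))
    have := hn.K_pos r h.mem
    have := hn.k₀_pos
    have := h.mem.1
    positivity
  refine ⟨sub_le_deriv_right_mul htt' (fun z hz => hn.hasDerivAt_areaR_time hη (hreg z hz)) hd h0,
    ?_⟩
  exact monotoneOn_of_hasDerivWithinAt_nonneg (convex_Icc t t')
    (fun z hz => (hd z hz).continuousAt.continuousWithinAt)
    (fun z hz => (hd z (interior_subset hz)).hasDerivWithinAt)
    (fun z hz => h0 z (interior_subset hz)) ⟨le_rfl, htt'⟩ ⟨htt', le_rfl⟩ htt'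

end NearCentre

/-! ### Rays above a given one -/

namespace IsRay

variable {c k₀ κ η Y r₁ : ℝ} {k K T : ℝ → ℝ}

lemma continuousOn {t₀ : ℝ} (hT : IsRay k K t₀ η r₁ T) : ContinuousOn T (Ioo 0 r₁) := fun r hr =>
  (hT.hasDerivAt r ⟨hr.1, hr.2.le⟩).continuousAt.continuousWithinAt

lemma inRegion (hT : IsRay k K (2 / (3 * k₀)) η r₁ T) (hr₁ : r₁ ∈ Ioo 0 c)
    (hroot : ∀ r ∈ Ioc 0 r₁, root k r (T r) ≤ Y * r) {r : ℝ} (hr : r ∈ Ioc 0 r₁) :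
    InRegion c k₀ η Y k r (T r) :=
  ⟨⟨hr.1, hr.2.trans_lt hr₁.2⟩, hT.ge r hr, (hT.lt_level r hr).le, hroot r hr⟩

/-- Through every point above an emanating ray and before `level k η` there is an emanating ray. -/
lemma exists_above {t₀ : ℝ} (hn : NearCentre c k₀ κ k K) (hη : 0 < η) (hηk : η ≤ k₀ / 2)
    (hT : IsRay k K t₀ η r₁ T) (hr₁ : r₁ ∈ Ioo 0 c) {x₁ : ℝ} (hx₁ : T r₁ < x₁)
    (hx₁' : x₁ < level k η r₁) :
    ∃ T', IsRay k K t₀ η r₁ T' ∧ T' r₁ = x₁ ∧ ∀ r ∈ Ioc 0 r₁, T r < T' r := by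
  have hp := hn.toProfile
  have hk0 := hn.k₀_pos
  have hmem : ∀ r ∈ Ioc 0 r₁, r ∈ Ioo 0 c := fun r hr => ⟨hr.1, hr.2.trans_lt hr₁.2⟩
  obtain ⟨u, hu₁, hu, hult⟩ := hp.exists_cut_ray hη (fun r hr => hηk.trans (hn.half_lt r hr).le)
    (fun r hr => hn.level_nonneg hr hη (by linarith)) (continuousOn_const (c := t₀)) hr₁ hx₁'
  have hlt : ∀ r ∈ Ioc 0 r₁, T r < u r := by
    refine (hp.tame_areaR hη (continuousOn_const (c := t₀))).lt_of_lt hr₁.2 (fun r hr => ?_)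
      (fun r hr => hu r (hmem r hr)) (by rwa [hu₁])
    rw [cut, max_eq_right (hT.ge r hr), min_eq_right (hT.lt_level r hr).le]
    exact hT.hasDerivAt r hr
  have hge : ∀ r ∈ Ioc 0 r₁, t₀ ≤ u r := fun r hr => (hT.ge r hr).trans (hlt r hr).le
  refine ⟨u, ⟨fun r hr => ?_, hge, hult⟩, hu₁, hlt⟩
  have := hu r (hmem r hr)
  rwa [cut, max_eq_right (hge r hr), min_eq_right (hult r hr).le] at this

/-- For three emanating rays `T < T₀ < T₁`, the convexity of `R_r` in `t` makes
`(T₁ - T) / (T₀ - T)` an increasing function of `r`, at a rate which controls `T₁ - T₀`. As this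
ratio is at least `1`, the quantity `K (T₁ - T₀) / r⁶` is integrable at the centre; it has an upper
bound with a positive primitive `Φ`. -/
lemma exists_potential (hn : NearCentre c k₀ κ k K) (hη : 0 < η) (hY : 0 < Y)
    {T₀ T₁ : ℝ → ℝ} (hr₁ : r₁ ∈ Ioo 0 c) (hT : IsRay k K (2 / (3 * k₀)) η r₁ T)
    (hroot : ∀ r ∈ Ioc 0 r₁, root k r (T r) ≤ Y * r)
    (hT₀ : IsRay k K (2 / (3 * k₀)) η r₁ T₀) (hT₁ : IsRay k K (2 / (3 * k₀)) η r₁ T₁)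
    (h0 : ∀ r ∈ Ioc 0 r₁, T r < T₀ r) (h1 : ∀ r ∈ Ioc 0 r₁, T₀ r < T₁ r) :
    ∃ Φ Φ' : ℝ → ℝ, ∀ r ∈ Ioc 0 r₁, 0 < Φ r ∧ HasDerivAt Φ (Φ' r) r ∧
      K r * (T₁ r - T₀ r) / r ^ 6 ≤ Φ' r := by
  have hk0 := hn.k₀_pos
  set d := k₀ / (60 * Y ^ 7) / 2 with hd
  have hd0 : 0 < d := by positivity
  refine ⟨fun r => (Real.log (T₁ r - T r) - Real.log (T₀ r - T r)) / d,
    fun r => ((areaR k K r (T₁ r) - areaR k K r (T r)) / (T₁ r - T r) -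
      (areaR k K r (T₀ r) - areaR k K r (T r)) / (T₀ r - T r)) / d, fun r hr => ?_⟩
  have ha := h0 r hr
  have hb := h1 r hr
  refine ⟨?_, ?_, ?_⟩
  · refine div_pos (sub_pos.2 (Real.log_lt_log (by linarith) (by linarith))) hd0
  · exact ((((hT₁.hasDerivAt r hr).sub (hT.hasDerivAt r hr)).log
      (by simp only [Pi.sub_apply]; linarith)).sub
      (((hT₀.hasDerivAt r hr).sub (hT.hasDerivAt r hr)).log
      (by simp only [Pi.sub_apply]; linarith))).div_const d
  · have hin := hT.inRegion hr₁ hroot hr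
    have hreg : ∀ z ∈ Icc (T r) (T₁ r), InRegion c k₀ η Y k r z := fun z hz =>
      hn.inRegion_of_ge hη hin hz.1 (hz.2.trans (hT₁.lt_level r hr).le)
    have hsec := secant_sub_secant_ge ha hb
      (fun z hz => hn.hasDerivAt_areaR_time hη (hreg z hz))
      (fun z hz => hn.toProfile.hasDerivAt_areaRT hin.mem (hn.region_facts hη (hreg z hz)).1)
      (fun z hz => hn.le_areaRTT hη hY (hreg z hz))
    rw [le_div_iff₀ hd0]
    refine le_trans (le_of_eq ?_) hsec
    rw [hd]; ring

end IsRay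

/-! ### Null geodesics with small angular momentum -/

namespace Profile

variable {b k₀ : ℝ} {k K : ℝ → ℝ}

lemma tame_areaRT (hp : Profile b k₀ k K) {η : ℝ} (hη : 0 < η) {lo : ℝ → ℝ}
    (hlo : ContinuousOn lo (Ioo 0 b)) : IsTame b (fun r x => areaRT k K r (cut k lo η r x)) := by
  have hw := hp.tame_inv_root hη hlo
  have h1 : IsTame b (cut k lo η) := IsTame.clamp hlo (hp.continuousOn_level η)
  have hKc := hp.contDiffOn.continuousOn
  have hkc := hp.continuousOn
  have hw2 := hw.mul hw
  have h2 := (IsTame.const_mul (c := fun r => -(k r - r * K r))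
    (hkc.sub (continuousOn_id.mul hKc)).neg hw).add
    ((IsTame.const_mul (c := fun r => r * k r * K r / 2)
      (((continuousOn_id.mul hkc).mul hKc).div_const 2) h1).mul (hw2.mul hw2))
  refine cast (congrArg (IsTame b) ?_) h2
  funext r x
  simp only [areaRT, div_eq_mul_inv, mul_inv]
  ring

lemma tame_inv_area (hp : Profile b k₀ k K) {η : ℝ} (hη : 0 < η) {lo : ℝ → ℝ}
    (hlo : ContinuousOn lo (Ioo 0 b)) :
    IsTame b (fun r x => (area k r (cut k lo η r x))⁻¹) := by
  have hw := hp.tame_inv_root hη hlo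
  have h2 := IsTame.const_mul (c := fun r : ℝ => r⁻¹)
    (continuousOn_id.inv₀ fun r hr => (ne_of_gt hr.1)) (hw.mul hw)
  refine cast (congrArg (IsTame b) ?_) h2
  funext r x
  simp only [area, mul_inv]
  ring

/-- The null geodesic equations have global solutions when `t` is kept between `lo` and
`level k η`, and `Q` above `l`. -/
lemma exists_cut_solution (hp : Profile b k₀ k K) {η : ℝ} (hη : 0 < η) {lo l : ℝ → ℝ}
    (hlo : ContinuousOn lo (Ioo 0 b)) (hl : ContinuousOn l (Ioo 0 b)) (L : ℝ) {r₂ : ℝ}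
    (hr₂ : r₂ ∈ Ioo 0 b) (x₂ Q₂ : ℝ) :
    ∃ x Q : ℝ → ℝ, x r₂ = x₂ ∧ Q r₂ = Q₂ ∧ ∀ r ∈ Ioo 0 b,
      HasDerivAt x (areaR k K r (cut k lo η r (x r)) *
        √(1 + angular k L r (cut k lo η r (x r)) (max (l r) (Q r)))) r ∧
      HasDerivAt Q (angular k L r (cut k lo η r (x r)) (max (l r) (Q r)) *
        areaR k K r (cut k lo η r (x r)) / area k r (cut k lo η r (x r)) -
        areaRT k K r (cut k lo η r (x r)) *
        √(1 + angular k L r (cut k lo η r (x r)) (max (l r) (Q r)))) r := by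
  have hfst : ∀ x y : ℝ × ℝ, ‖x.1 - y.1‖ ≤ ‖x - y‖ := fun x y => norm_fst_le (x - y)
  have hsnd : ∀ x y : ℝ × ℝ, ‖x.2 - y.2‖ ≤ ‖x - y‖ := fun x y => norm_snd_le (x - y)
  have hR := (hp.tame_areaR hη hlo).comp_right hfst
  have hRT := (hp.tame_areaRT hη hlo).comp_right hfst
  have hinv := (hp.tame_inv_area hη hlo).comp_right hfst
  have hexp := (IsTame.exp_neg_max hl).comp_right hsnd
  have hang : IsTame b (fun r (z : ℝ × ℝ) => angular k L r (cut k lo η r z.1) (max (l r) z.2)) := by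
    have h2 := (IsTame.const_mul (c := fun _ => L ^ 2) continuousOn_const hexp).mul
      (hinv.mul hinv)
    refine cast (congrArg (IsTame b) ?_) h2
    funext r z
    simp only [angular, div_eq_mul_inv]
    ring
  have hsq : IsTame b (fun r (z : ℝ × ℝ) =>
      √(1 + angular k L r (cut k lo η r z.1) (max (l r) z.2))) := by
    refine ((IsTame.of_continuousOn (c := fun _ => 1) continuousOn_const).add hang).comp
      (δ := fun _ => 1) continuousOn_const (fun _ _ => one_pos) (fun r _ z => ?_)
      (φ := Real.sqrt) (fun u hu => (Real.contDiffAt_sqrt (ne_of_gt hu)).contDiffWithinAt)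
    have : 0 ≤ angular k L r (cut k lo η r z.1) (max (l r) z.2) := by
      unfold angular; positivity
    simpa using this
  have hfield := (hR.mul hsq).prodMk (((hang.mul hR).mul hinv).sub (hRT.mul hsq))
  obtain ⟨u, hu₂, hu⟩ := hfield.exists_solution hr₂ (x₂, Q₂)
  refine ⟨fun r => (u r).1, fun r => (u r).2, by simp [hu₂], by simp [hu₂], fun r hr => ?_⟩
  exact ⟨(hu r hr).fst, (hu r hr).snd⟩

end Profile

lemma angular_nonneg (k : ℝ → ℝ) (L r t Q : ℝ) : 0 ≤ angular k L r t Q := by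
  unfold angular; positivity

namespace NearCentre

variable {c k₀ κ η Y : ℝ} {k K : ℝ → ℝ}

lemma angular_mul_exp_le (hn : NearCentre c k₀ κ k K) (hη : 0 < η) {r t : ℝ}
    (h : InRegion c k₀ η Y k r t) (L Q : ℝ) :
    angular k L r t Q * Real.exp Q ≤ L ^ 2 * (Real.exp (-Q) / (η ^ 4 * r ^ 6)) := by
  have hr := h.mem.1
  have hA := hn.le_area hη h
  have e : angular k L r t Q * Real.exp Q = L ^ 2 * (Real.exp (-Q) / area k r t ^ 2) := by
    rw [angular, div_mul_eq_mul_div, mul_assoc, ← Real.exp_add, mul_div_assoc]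
    congr 3
    ring
  rw [e]
  have h2 : η ^ 4 * r ^ 6 ≤ area k r t ^ 2 := by
    calc η ^ 4 * r ^ 6 = (η ^ 2 * r ^ 3) ^ 2 := by ring
      _ ≤ _ := by gcongr
  gcongr

/-- Bounds for the angular velocity when `exp (-Q)` is at most the gap `a = O(r³)` between two
rays, in terms of a bound `P` for the integrable quantity `K a / r⁶`. -/
lemma angular_le (hn : NearCentre c k₀ κ k K) (hη : 0 < η) {r t a B P Q : ℝ}
    (h : InRegion c k₀ η Y k r t) (hQ : Real.exp (-Q) ≤ a) (ha : a ≤ B * r ^ 3)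
    (hP : K r * a / r ^ 6 ≤ P) (L : ℝ) :
    angular k L r t Q * Real.exp Q * K r ≤ L ^ 2 / η ^ 4 * P ∧
      angular k L r t Q * (K r / r ^ 3) ≤ B * (L ^ 2 / η ^ 4 * P) := by
  have hr := h.mem.1
  have hK := hn.K_pos r h.mem
  have hB : 0 < B := by
    have := (Real.exp_pos (-Q)).trans_le (hQ.trans ha)
    exact pos_of_mul_pos_left this (by positivity)
  have h1 : angular k L r t Q * Real.exp Q * K r ≤ L ^ 2 / η ^ 4 * P := by
    calc angular k L r t Q * Real.exp Q * K r
        ≤ L ^ 2 * (Real.exp (-Q) / (η ^ 4 * r ^ 6)) * K r :=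
          mul_le_mul_of_nonneg_right (hn.angular_mul_exp_le hη h L Q) hK.le
      _ ≤ L ^ 2 * (a / (η ^ 4 * r ^ 6)) * K r := by gcongr
      _ = L ^ 2 / η ^ 4 * (K r * a / r ^ 6) := by field_simp
      _ ≤ L ^ 2 / η ^ 4 * P := by gcongr
  refine ⟨h1, ?_⟩
  have h2 : 1 ≤ Real.exp Q * (B * r ^ 3) := by
    have h3 := hQ.trans ha
    rw [Real.exp_neg, inv_le_iff_one_le_mul₀ (Real.exp_pos _)] at h3
    linarith
  calc angular k L r t Q * (K r / r ^ 3)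
      ≤ angular k L r t Q * (K r / r ^ 3) * (Real.exp Q * (B * r ^ 3)) :=
        le_mul_of_one_le_right (mul_nonneg (angular_nonneg k L r t Q) (by positivity)) h2
    _ = B * (angular k L r t Q * Real.exp Q * K r) := by field_simp
    _ ≤ _ := mul_le_mul_of_nonneg_left h1 hB.le

/-- The angular momentum changes the equation for `Q` by at most `O(E K / r³)`. -/
lemma exists_velocity_le (hn : NearCentre c k₀ κ k K) (hη : 0 < η) (hκ : 0 < κ) :
    ∃ C, 0 < C ∧ ∀ r t E, InRegion c k₀ η Y k r t → 0 ≤ E →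
      E * areaR k K r t / area k r t - areaRT k K r t * √(1 + E) ≤
        -areaRT k K r t + C * (E * (K r / r ^ 3)) := by
  have hk0 := hn.k₀_pos
  refine ⟨3 / (k₀ * η) / η ^ 2 + ((k₀ + κ) * (6 / 5) / k₀ + 2 / 3) / η ^ 4, by positivity,
    fun r t E h hE => ?_⟩
  have hr := h.mem.1
  have hK := hn.K_pos r h.mem
  have h1 : E * areaR k K r t / area k r t ≤ E * (3 / (k₀ * η) * K r) / (η ^ 2 * r ^ 3) := by
    gcongr
    · exact hn.areaR_le hη h
    · exact hn.le_area hη h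
  have hs1 : 1 ≤ √(1 + E) := Real.one_le_sqrt.2 (by linarith)
  have hs2 : √(1 + E) ≤ 1 + E := Real.sqrt_le_iff.2 ⟨by linarith, by nlinarith⟩
  have h2 : -areaRT k K r t * (√(1 + E) - 1) ≤
      ((k₀ + κ) * (6 / 5) / k₀ + 2 / 3) / η ^ 4 * (K r / r ^ 3) * E :=
    mul_le_mul ((neg_le_abs _).trans (hn.abs_areaRT_le hη h)) (by linarith) (by linarith)
      ((abs_nonneg _).trans (hn.abs_areaRT_le hη h))
  have e : E * (3 / (k₀ * η) * K r) / (η ^ 2 * r ^ 3) =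
      3 / (k₀ * η) / η ^ 2 * (E * (K r / r ^ 3)) := by field_simp
  rw [e] at h1
  linarith

/-- Where `t` is not before the later of two rays `t₀ < t₁`, the sum of `Q` and the logarithm of the
gap between the rays decreases with `r`, up to the effect `δ` of the angular momentum. Here `v` is
the derivative of `Q`. -/
lemma velocity_add_log_le (hn : NearCentre c k₀ κ k K) (hη : 0 < η) (hY : 0 < Y)
    {r t₀ t₁ t v δ : ℝ} (h : InRegion c k₀ η Y k r t₀) (h01 : t₀ < t₁) (h1 : t₁ ≤ t)
    (ht : t ≤ level k η r) (hv : v ≤ -areaRT k K r t + δ) :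
    v + (areaR k K r t₁ - areaR k K r t₀) / (t₁ - t₀) ≤ δ := by
  have c1 := (hn.areaR_convex hη hY h h01.le (h1.trans ht)).1
  rw [← div_le_iff₀ (sub_pos.2 h01)] at c1
  have c2 := (hn.areaR_convex hη hY (hn.inRegion_of_ge hη h h01.le (h1.trans ht)) h1 ht).2
  linarith

/-- Where `t` is not before a ray `t₁`, the product of `exp Q` and the delay `t - t₁` decreases with
`r`, up to the effect of the angular momentum. Here `v` is the derivative of `Q`, and the left hand
side is the derivative of the product, divided by `exp Q`. -/
lemma velocity_mul_sub_le (hn : NearCentre c k₀ κ k K) (hη : 0 < η) (hY : 0 < Y)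
    {r t₁ t v C E : ℝ} (h : InRegion c k₀ η Y k r t₁) (h1 : t₁ ≤ t) (ht : t ≤ level k η r)
    (hC : 0 < C) (hE : 0 ≤ E) (hv : v ≤ -areaRT k K r t + C * (E * (K r / r ^ 3))) :
    v * (t - t₁) + (areaR k K r t * √(1 + E) - areaR k K r t₁) ≤
      (3 / (k₀ * η) + C * (4 / (3 * k₀) * Y ^ 3)) * (E * K r) := by
  have hr := h.mem.1
  have hK := hn.K_pos r h.mem
  have hg := hn.inRegion_of_ge hη h h1 ht
  obtain ⟨hU, -, -, ht0, -⟩ := hn.region_facts hη hg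
  have hR := (hn.toProfile.areaR_pos hg.mem ht0.le hU).le
  have c1 := (hn.areaR_convex hη hY h h1 ht).1
  have c2 := hn.sub_le hη hY h hg
  have hs : √(1 + E) ≤ 1 + E := Real.sqrt_le_iff.2 ⟨by linarith, by nlinarith⟩
  have e1 := mul_le_mul_of_nonneg_left hs hR
  have e2 := mul_le_mul_of_nonneg_right (hn.areaR_le hη hg) hE
  have e3 := mul_le_mul_of_nonneg_right hv (sub_nonneg.2 h1)
  have e4 : C * (E * (K r / r ^ 3)) * (t - t₁) ≤
      C * (E * (K r / r ^ 3)) * (4 / (3 * k₀) * Y ^ 3 * r ^ 3) :=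
    mul_le_mul_of_nonneg_left c2 (by positivity)
  have e5 : C * (E * (K r / r ^ 3)) * (4 / (3 * k₀) * Y ^ 3 * r ^ 3) =
      C * (4 / (3 * k₀) * Y ^ 3) * (E * K r) := by field_simp
  linarith

end NearCentre

namespace IsRay

variable {c k₀ κ η Y r₁ : ℝ} {k K T : ℝ → ℝ}

/-- If there is an emanating radial ray `T` along which `R = O(r³)`, then the null geodesic
equations with `r` as parameter have, for every sufficiently small angular momentum, a solution
with bounded `R_r exp (-Q)` which emanates from the singularity.

Take two further rays `T < T₀ < T₁`. The solution starts between `T₁` and `level k η` and is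
followed towards the centre, with `t` and `Q` cut off at `T₁`, `level k η` and at
`-log (T₁ - T₀)`. The cut-offs turn out to be inactive: up to errors of the size `L² Φ`,
both `Q + log (T₁ - T₀)` and
`exp Q (x - T₁)` grow towards the centre, and so they stay positive. -/
theorem exists_solution (hn : NearCentre c k₀ κ k K) (hη : 0 < η) (hηk : η ≤ k₀ / 2) (hY : 0 < Y)
    (hr₁ : r₁ ∈ Ioo 0 c) (hT : IsRay k K (2 / (3 * k₀)) η r₁ T)
    (hroot : ∀ r ∈ Ioc 0 r₁, root k r (T r) ≤ Y * r) :
    ∃ r₂ ∈ Ioo 0 c, ∃ lam, 0 < lam ∧ ∀ L : ℝ, L ^ 2 ≤ lam → ∃ (x Q : ℝ → ℝ) (C : ℝ),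
      ∀ r ∈ Ioo 0 r₂,
        HasDerivAt x (areaR k K r (x r) * √(1 + angular k L r (x r) (Q r))) r ∧
        HasDerivAt Q (angular k L r (x r) (Q r) * areaR k K r (x r) / area k r (x r) -
          areaRT k K r (x r) * √(1 + angular k L r (x r) (Q r))) r ∧
        2 / (3 * k₀) ≤ x r ∧ x r < level k η r ∧ areaR k K r (x r) * Real.exp (-Q r) ≤ C := by
  have hk0 := hn.k₀_pos
  have hp := hn.toProfile
  have hκ : 0 < κ := (hn.K_pos r₁ hr₁).trans_le (hn.slope_le r₁ hr₁)
  have hr₁' : r₁ ∈ Ioc 0 r₁ := ⟨hr₁.1, le_rfl⟩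
  -- two further rays `T < T₀ < T₁`
  obtain ⟨x₁, hx₁, hx₁'⟩ := exists_between (hT.lt_level r₁ hr₁')
  obtain ⟨T₀, hT₀, rfl, h0⟩ := hT.exists_above hn hη hηk hr₁ hx₁ hx₁'
  obtain ⟨x₁, hx₂, hx₂'⟩ := exists_between hx₁'
  obtain ⟨T₁, hT₁, rfl, h1⟩ := hT₀.exists_above hn hη hηk hr₁ hx₂ hx₂'
  obtain ⟨Φ, Φ', hΦ⟩ := hT.exists_potential hn hη hY hr₁ hroot hT₀ hT₁ h0 h1
  obtain ⟨C₃, hC₃, hvel⟩ := hn.exists_velocity_le (Y := Y) hη hκ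
  set C₁ := 3 / (k₀ * η) with hC₁
  set C₅ := 4 / (3 * k₀) * Y ^ 3 with hC₅
  have hC₁0 : 0 < C₁ := by positivity
  have hC₅0 : 0 < C₅ := by positivity
  -- the effect of the angular momentum on `Q + log (T₁ - T₀)` and on `exp Q (x - T₁)` is at most
  -- `C₆ L² Φ` and `C₇ L² Φ`, respectively
  set C₆ := C₃ * C₅ / η ^ 4 with hC₆
  set C₇ := (C₁ + C₃ * C₅) / η ^ 4 with hC₇
  have hC₆0 : 0 < C₆ := by positivity
  have hC₇0 : 0 < C₇ := by positivity
  set r₂ := r₁ / 2 with hr₂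
  have hr₁0 := hr₁.1
  have hr₂1 : r₂ ∈ Ioo 0 r₁ := ⟨by positivity, by linarith⟩
  have hr₂' : r₂ ∈ Ioc 0 r₁ := ⟨hr₂1.1, hr₂1.2.le⟩
  have hΦ₂ := (hΦ r₂ hr₂').1
  have ha : ∀ r ∈ Ioc 0 r₁, 0 < T₁ r - T₀ r := fun r hr => sub_pos.2 (h1 r hr)
  have hda : ∀ r ∈ Ioc 0 r₁, HasDerivAt (fun r => T₁ r - T₀ r)
      (areaR k K r (T₁ r) - areaR k K r (T₀ r)) r := fun r hr =>
    (hT₁.hasDerivAt r hr).sub (hT₀.hasDerivAt r hr)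
  have hreg : ∀ r ∈ Ioc 0 r₁, ∀ t, T r ≤ t → t ≤ level k η r → InRegion c k₀ η Y k r t :=
    fun r hr t => hn.inRegion_of_ge hη (hT.inRegion hr₁ hroot hr)
  have hreg₀ : ∀ r ∈ Ioc 0 r₁, InRegion c k₀ η Y k r (T₀ r) := fun r hr =>
    hreg r hr _ (h0 r hr).le (hT₀.lt_level r hr).le
  have hreg₁ : ∀ r ∈ Ioc 0 r₁, InRegion c k₀ η Y k r (T₁ r) := fun r hr =>
    hreg r hr _ ((h0 r hr).trans (h1 r hr)).le (hT₁.lt_level r hr).le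
  have hgap : ∀ r ∈ Ioc 0 r₁, T₁ r - T₀ r ≤ C₅ * r ^ 3 := fun r hr =>
    hn.sub_le hη hY (hreg₀ r hr) (hreg₁ r hr)
  -- the point at which the initial data are given
  set a₂ := T₁ r₂ - T₀ r₂ with ha₂
  have ha₂0 : 0 < a₂ := ha r₂ hr₂'
  set X₂ := (level k η r₂ - T₁ r₂) / 2 with hX₂
  have hX₂0 : 0 < X₂ := by have := hT₁.lt_level r₂ hr₂'; linarith
  refine ⟨r₂, ⟨hr₂1.1, hr₂1.2.trans hr₁.2⟩,
    min (1 / (C₆ * Φ r₂)) (X₂ / a₂ / (C₇ * Φ r₂)), by positivity, fun L hL => ?_⟩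
  -- these bounds on `L` make both quantities exceed the effect of `L` at `r₂`, hence up to the
  -- centre
  have hL₆ : C₆ * L ^ 2 * Φ r₂ ≤ 1 := by
    have := hL.trans (min_le_left _ _)
    rw [le_div_iff₀ (by positivity)] at this
    linarith
  have hL₇ : C₇ * L ^ 2 * Φ r₂ ≤ X₂ / a₂ := by
    have := hL.trans (min_le_right _ _)
    rw [le_div_iff₀ (by positivity)] at this
    linarith
  have hp₁ : Profile r₁ k₀ k K := hp.mono hr₁.2.le
  obtain ⟨x, Q, hx₂, hQ₂, hxQ⟩ := hp₁.exists_cut_solution hη (lo := T₁)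
    (l := fun r => -Real.log (T₁ r - T₀ r)) hT₁.continuousOn
    ((hT₁.continuousOn.sub hT₀.continuousOn).log fun r hr => (ha r ⟨hr.1, hr.2.le⟩).ne').neg
    L hr₂1 (T₁ r₂ + X₂) (1 - Real.log a₂)
  have hsub : ∀ r ∈ Ioc 0 r₂, r ∈ Ioo 0 r₁ := fun r hr => ⟨hr.1, hr.2.trans_lt hr₂1.2⟩
  have hsub' : ∀ r ∈ Ioc 0 r₂, r ∈ Ioc 0 r₁ := fun r hr => ⟨hr.1, hr.2.trans hr₂1.2.le⟩
  set X := fun r => cut k T₁ η r (x r) with hXdef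
  set E := fun r => angular k L r (X r) (max (-Real.log (T₁ r - T₀ r)) (Q r)) with hEdef
  have hE0 : ∀ r, 0 ≤ E r := fun r => angular_nonneg _ _ _ _ _
  have hcut : ∀ r ∈ Ioc 0 r₁, T₁ r ≤ X r ∧ X r ≤ level k η r := fun r hr =>
    ⟨le_min (hT₁.lt_level r hr).le (le_max_left _ _), min_le_left _ _⟩
  have hregX : ∀ r ∈ Ioc 0 r₁, InRegion c k₀ η Y k r (X r) := fun r hr =>
    hn.inRegion_of_ge hη (hreg₁ r hr) (hcut r hr).1 (hcut r hr).2
  -- bounds for the angular velocity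
  have hexpl : ∀ r ∈ Ioc 0 r₁,
      Real.exp (-max (-Real.log (T₁ r - T₀ r)) (Q r)) ≤ T₁ r - T₀ r := fun r hr => by
    rw [← Real.le_log_iff_exp_le (ha r hr)]
    linarith [le_max_left (-Real.log (T₁ r - T₀ r)) (Q r)]
  have hE : ∀ r ∈ Ioc 0 r₁, E r * Real.exp (max (-Real.log (T₁ r - T₀ r)) (Q r)) * K r ≤
      L ^ 2 / η ^ 4 * Φ' r ∧ E r * (K r / r ^ 3) ≤ C₅ * (L ^ 2 / η ^ 4 * Φ' r) := fun r hr =>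
    hn.angular_le hη (hregX r hr) (hexpl r hr) (hgap r hr) (hΦ r hr).2.2 L
  have hQ' : ∀ r ∈ Ioc 0 r₁, E r * areaR k K r (X r) / area k r (X r) -
      areaRT k K r (X r) * √(1 + E r) ≤ -areaRT k K r (X r) + C₃ * (E r * (K r / r ^ 3)) :=
    fun r hr => hvel r _ _ (hregX r hr) (hE0 r)
  -- `Q` stays above the cut
  have hQcut : ∀ r ∈ Ioc 0 r₂, -Real.log (T₁ r - T₀ r) ≤ Q r := by
    have hd : ∀ r ∈ Ioc 0 r₂, HasDerivAt
        (fun r => Q r + Real.log (T₁ r - T₀ r) - C₆ * L ^ 2 * Φ r)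
        (E r * areaR k K r (X r) / area k r (X r) - areaRT k K r (X r) * √(1 + E r) +
          (areaR k K r (T₁ r) - areaR k K r (T₀ r)) / (T₁ r - T₀ r) - C₆ * L ^ 2 * Φ' r) r :=
      fun r hr => ((hxQ r (hsub r hr)).2.add ((hda r (hsub' r hr)).log (ha r (hsub' r hr)).ne')).sub
        ((hΦ r (hsub' r hr)).2.1.const_mul _)
    have hanti := antitoneOn_of_hasDerivWithinAt_nonpos (convex_Ioc 0 r₂)
      (fun r hr => (hd r hr).continuousAt.continuousWithinAt)
      (fun r hr => (hd r (interior_subset hr)).hasDerivWithinAt) (fun r hr => by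
        have hr := hsub' r (interior_subset hr)
        have c3 := mul_le_mul_of_nonneg_left (hE r hr).2 hC₃.le
        have e : C₆ * L ^ 2 * Φ' r = C₃ * (C₅ * (L ^ 2 / η ^ 4 * Φ' r)) := by rw [hC₆]; ring
        rw [e, sub_nonpos]
        exact (hn.velocity_add_log_le hη hY (hreg₀ r hr) (h1 r hr) (hcut r hr).1 (hcut r hr).2
          (hQ' r hr)).trans c3)
    intro r hr
    have h2 := hanti hr ⟨hr₂1.1, le_rfl⟩ hr.2
    simp only [hQ₂] at h2
    have h3 : 0 ≤ C₆ * L ^ 2 * Φ r := by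
      have := (hΦ r (hsub' r hr)).1
      positivity
    linarith
  -- `x` stays before `level k η`
  have hxlt : ∀ r ∈ Ioc 0 r₂, x r < level k η r := by
    intro r hr
    refine sub_pos.1 (pos_of_deriv_neg_at_zeros (Y := fun r => level k η r - x r)
      (fun z hz => (hp₁.hasDerivAt_level η (hsub z hz)).sub (hxQ z (hsub z hz)).1) ?_ ?_ r hr)
    · simp only [hx₂]; linarith
    · intro z hz hz0
      have hz2 : z ∈ Ioc 0 r₂ := ⟨hz.1, hz.2.le⟩
      have hzm := (hreg₁ z (hsub' z hz2)).mem
      have hlev := hn.level_nonneg hzm hη (by linarith)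
      have e : cut k T₁ η z (x z) = level k η z := by
        rw [← sub_eq_zero.1 hz0]
        exact min_eq_left (by rw [sub_eq_zero.1 hz0]; exact le_max_right _ _)
      rw [e]
      have h2 := hp.deriv_level_lt hzm hη (hηk.trans (hn.half_lt z hzm).le) hlev
      have h3 := hp.areaR_pos hzm hlev (pos_of_le_level (hn.k_pos z hzm) hη hz.1 le_rfl)
      have h4 : 1 ≤ √(1 + E z) := Real.one_le_sqrt.2 (by linarith [hE0 z])
      simp only [hEdef, hXdef, e] at h4
      have h5 := le_mul_of_one_le_right h3.le h4
      linarith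
  have hQmax : ∀ r ∈ Ioc 0 r₂, max (-Real.log (T₁ r - T₀ r)) (Q r) = Q r := fun r hr =>
    max_eq_right (hQcut r hr)
  -- `x` stays after `T₁`
  have hxgt : ∀ r ∈ Ioc 0 r₂, T₁ r < x r := by
    intro r hr
    by_contra! hle
    have hd : ∀ r ∈ Ioc 0 r₂, HasDerivAt (fun r => x r - T₁ r)
        (areaR k K r (X r) * √(1 + E r) - areaR k K r (T₁ r)) r := fun r hr =>
      (hxQ r (hsub r hr)).1.sub (hT₁.hasDerivAt r (hsub' r hr))
    have hmem : ∀ y ∈ Icc r r₂, y ∈ Ioc 0 r₂ := fun y hy => ⟨hr.1.trans_le hy.1, hy.2⟩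
    obtain ⟨z, hz, hz0, hzpos⟩ := exists_last_zero (Y := fun r => x r - T₁ r)
      (fun y hy => (hd y (hmem y hy)).continuousAt.continuousWithinAt)
      (by simp only [hx₂]; linarith) hr.2 (by linarith)
    have hmem : ∀ y ∈ Icc z r₂, y ∈ Ioc 0 r₂ := fun y hy => hmem y ⟨hz.1.trans hy.1, hy.2⟩
    have hd2 : ∀ y ∈ Icc z r₂, HasDerivAt
        (fun r => Real.exp (Q r) * (x r - T₁ r) - C₇ * L ^ 2 * Φ r)
        (Real.exp (Q y) * (E y * areaR k K y (X y) / area k y (X y) -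
          areaRT k K y (X y) * √(1 + E y)) * (x y - T₁ y) +
          Real.exp (Q y) * (areaR k K y (X y) * √(1 + E y) - areaR k K y (T₁ y)) -
          C₇ * L ^ 2 * Φ' y) y := fun y hy =>
      (((hxQ y (hsub y (hmem y hy))).2.exp).mul (hd y (hmem y hy))).sub
        ((hΦ y (hsub' y (hmem y hy))).2.1.const_mul _)
    have hanti := antitoneOn_of_hasDerivWithinAt_nonpos (convex_Icc z r₂)
      (fun r hr => (hd2 r hr).continuousAt.continuousWithinAt)
      (fun r hr => (hd2 r (interior_subset hr)).hasDerivWithinAt) (fun y hy => by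
        rw [interior_Icc] at hy
        have hy2 := hmem y ⟨hy.1.le, hy.2.le⟩
        have hy1 := hsub' y hy2
        have hy0 := hy1.1
        have hX0 : 0 < x y - T₁ y := hzpos y ⟨hy.1, hy.2.le⟩
        have eX : X y = x y := by
          simp only [hXdef, cut]
          rw [max_eq_right (by linarith), min_eq_right (hxlt y hy2).le]
        have d1 := hn.velocity_mul_sub_le hη hY (hreg₁ y hy1) (hcut y hy1).1 (hcut y hy1).2 hC₃
          (hE0 y) (hQ' y hy1)
        have d2 := mul_le_mul_of_nonneg_left d1 (Real.exp_pos (Q y)).le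
        have d3 := (hE y hy1).1
        rw [hQmax y hy2] at d3
        have d4 := mul_le_mul_of_nonneg_left d3 (by positivity : 0 ≤ C₁ + C₃ * C₅)
        rw [eX] at d2 ⊢
        have e7 : C₇ * L ^ 2 * Φ' y = (C₁ + C₃ * C₅) * (L ^ 2 / η ^ 4 * Φ' y) := by
          rw [hC₇]; ring
        rw [e7]
        linarith)
    have h2 := hanti ⟨le_rfl, hz.2.le⟩ ⟨hz.2.le, le_rfl⟩ hz.2.le
    simp only [hz0, mul_zero, zero_sub, hx₂, hQ₂, add_sub_cancel_left] at h2
    have h3 : 0 < C₇ * L ^ 2 * Φ z + (Real.exp (1 - Real.log a₂) * X₂ - X₂ / a₂) := by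
      have h4 : X₂ / a₂ < Real.exp (1 - Real.log a₂) * X₂ := by
        rw [Real.exp_sub, Real.exp_log ha₂0, div_mul_eq_mul_div]
        have : 1 < Real.exp 1 := Real.one_lt_exp_iff.2 one_pos
        gcongr
        exact lt_mul_of_one_lt_left hX₂0 this
      have h5 : 0 ≤ C₇ * L ^ 2 * Φ z := by
        have := (hΦ z (hsub' z (hmem z ⟨le_rfl, hz.2.le⟩))).1
        positivity
      linarith
    linarith
  have hXx : ∀ r ∈ Ioc 0 r₂, cut k T₁ η r (x r) = x r := fun r hr => by
    rw [cut, max_eq_right (hxgt r hr).le, min_eq_right (hxlt r hr).le]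
  refine ⟨x, Q, C₁ * κ * C₅, fun r hr => ?_⟩
  have hr' : r ∈ Ioc 0 r₂ := ⟨hr.1, hr.2.le⟩
  have hr1 := hsub' r hr'
  have h2 := hxQ r (hsub r hr')
  rw [hXx r hr', hQmax r hr'] at h2
  refine ⟨h2.1, h2.2, (hT₁.ge r hr1).trans (hxgt r hr').le, hxlt r hr', ?_⟩
  have hg := hregX r hr1
  simp only [hXdef, hXx r hr'] at hg
  have h3 := hexpl r hr1
  rw [hQmax r hr'] at h3
  have hr0 := hr.1
  have hrle : r ^ 3 ≤ 1 := pow_le_one₀ hr0.le (hg.mem.2.le.trans hn.le_one)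
  have h4 : Real.exp (-Q r) ≤ C₅ := (h3.trans (hgap r hr1)).trans (by nlinarith)
  have h5 : areaR k K r (x r) ≤ C₁ * κ := (hn.areaR_le hη hg).trans (by
    have := hn.slope_le r hg.mem
    gcongr)
  exact mul_le_mul h5 h4 (Real.exp_pos _).le (by positivity)

end IsRay

/-- If a null geodesic with some angular momentum emanates from the singularity, then so does one
with every sufficiently small angular momentum. -/
theorem RegularData.exists_forall_existsEmanating {b : ℝ} {μ : ℝ → ℝ} (h : RegularData b μ)
    {L : ℝ} (hL : ExistsEmanating b μ L) :
    ∃ lam, 0 < lam ∧ ∀ L : ℝ, L ^ 2 ≤ lam → ExistsEmanating b μ L := by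
  obtain ⟨c, κ, η, r₁, T, Y, hcb, hn, hη, hηk, hr₁, hT, hY, hroot⟩ := h.exists_controlled_ray hL
  rw [singularTime_eq] at hT
  obtain ⟨r₂, hr₂, lam, hlam, hsol⟩ := hT.exists_solution hn hη hηk hY hr₁ hroot
  refine ⟨lam, hlam, fun L hL => ?_⟩
  obtain ⟨x, Q, C, hxQ⟩ := hsol L hL
  refine h.existsEmanating_of_solution hr₂.1 (hr₂.2.le.trans hcb) (fun r hr => (hxQ r hr).1)
    (fun r hr => (hxQ r hr).2.1) (fun r hr => ?_) (fun r hr => (hxQ r hr).2.2.2.2)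
  have hrc : r ∈ Ioo 0 c := ⟨hr.1, hr.2.trans hr₂.2⟩
  have hk := hn.k_pos r hrc
  refine ⟨by rw [singularTime_eq]; exact (hxQ r hr).2.2.1, ?_⟩
  rw [h.before_iff ⟨hr.1, hrc.2.trans_le hcb⟩]
  exact pos_of_le_level hk hη hr.1 (hxQ r hr).2.2.2.1.le

end DustCollapse

theorem theorem2 (b : ℝ) (μ : ℝ → ℝ) (hμ : DustCollapse.RegularData b μ) :
    (∃ L : ℝ, L ≠ 0 ∧ DustCollapse.ExistsEmanating b μ L) ↔
      DustCollapse.ExistsEmanating b μ 0 := by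
  constructor
  · rintro ⟨L, -, hL⟩
    obtain ⟨lam, hlam, h⟩ := hμ.exists_forall_existsEmanating hL
    exact h 0 (by simpa using hlam.le)
  · intro h0
    obtain ⟨lam, hlam, h⟩ := hμ.exists_forall_existsEmanating h0
    exact ⟨√lam, (Real.sqrt_pos.2 hlam).ne', h _ (Real.sq_sqrt hlam.le).le⟩
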